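/- Let $D\subseteq\{0,1\}^*$ be a set of (valid) instances; the size of an instance $x$ is its length $|x|$. Suppose that each $x\in D$ determines - a number $n=n(x)\le\mathrm{poly}(|x|)$, computable in unary from $x$ in time $\mathrm{poly}(|x|)$, and a Hermitian matrix $A=A_x\in\mathbb{C}^{2^n\times 2^n}$ with operator norm $\|A\|\le 1$, to which we have sparse-access: for some $s=s(x)$ every row and every column of $A$ has at most $s$ non-zero entries, and there are polynomial-time algorithms that, given $x$, (i) on input $(i,j)$ return the entry $A(i,j)$, (ii) on input $(i,l)$, $l\in[s]$, return the $l$-th non-zero entry of the $i$-th row and its column index, or an error message if there is no such entry, and (iii) do the same for columns (the order in which the non-zero entries of a row or column are enumerated is arbitrary but fixed); - a real polynomial $p=p_x$, $p(t)=\sum_{k=0}^d c_kt^k$, with a degree bound $d=d(x)\le\mathrm{poly}(|x|)$ that is computable in unary from $x$ in polynomial time, and with $\max_k|c_k|\le 2^{\mathrm{poly}(|x|)}$, whose coefficients are returned by a polynomial-time algorithm on input $x$ and $k\in\{0,\dots,d\}$; - real numbers $a=a_x$ and $b=b_x$, returned by polynomial-time algorithms on input $x$, with $b-a\ge 2^{-\mathrm{poly}(|x|)}$.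 Here $\mathrm{poly}$ stands for polynomials that do not depend on $x$, each algorithm is one deterministic Turing machine for all $x$, and an algorithm that returns a real or complex number receives in addition a precision $1^m$ and returns (the real and imaginary parts of) the number to within $2^{-m}$ as a dyadic rational with denominator $2^m$, in time polynomial in the length of its whole input. Then the promise problem with $L_{\mathrm{yes}}=\{x\in D:\operatorname{tr}[p_x(A_x)]\ge b_x\}$ and $L_{\mathrm{no}}=\{x\in D:\operatorname{tr}[p_x(A_x)]\le a_x\}$ is in $\mathsf{PP}$: there is a probabilistic Turing machine that halts in polynomial time on all inputs and all coin flips, accepts every $x\in L_{\mathrm{yes}}$ with probability at least $\tfrac12$, and accepts every $x\in L_{\mathrm{no}}$ with probability less than $\tfrac12$. -/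

import Mathlib

/-! ## Deterministic polynomial time -/

/-- A tuple of bit strings, written as one word over `{0, 1, #}`: every field is followed by the
separator `#` (`none`). -/
def encFields (w : List (List Bool)) : List (Option Bool) :=
  w.flatMap fun u => u.map some ++ [none]

/-- Functions on tuples of bit strings computed by a deterministic (multi-stack) Turing machine
in time polynomial in the length of its input. -/
def PolyTime (f : List (List Bool) → List (List Bool)) : Prop :=
  Nonempty (Turing.TM2ComputableInPolyTime encFields encFields f)

/-- Unary notation `1^m`. -/
def unary (m : ℕ) : List Bool := List.replicate m true

/-- Binary notation of an integer: the sign bit, then the bits of the absolute value, least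
significant bit first. -/
def intBits (z : ℤ) : List Bool := decide (z < 0) :: z.natAbs.bits

/-! ## Access to numerical data

Instances are bit strings `x`; the size of an instance is its length. All the data attached to an
instance is only meaningful for `x` in a set `D` of valid instances. Algorithms receive `x` in
addition to the indices. Real and complex numbers are returned as dyadic numbers, to within
`2^(-m)`, where `m` is a further argument, in unary. -/

/-- `u / 2^m` approximates `r` to within `2^(-m)`. -/
def ApproxReal (m : ℕ) (r : ℝ) (u : ℤ) : Prop :=
  |r - (u : ℝ) / 2 ^ m| ≤ 1 / 2 ^ m

/-- `(u + v i) / 2^m` approximates `z` to within `2^(-m)` in each of its two parts. -/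
def ApproxComplex (m : ℕ) (z : ℂ) (u v : ℤ) : Prop :=
  ApproxReal m z.re u ∧ ApproxReal m z.im v

/-- A natural number parameter of the instance that is polynomially bounded in the size of the
instance and can be computed (in unary) in polynomial time. -/
def PolyParam (D : Set (List Bool)) (f : List Bool → ℕ) : Prop :=
  (∃ P : Polynomial ℕ, ∀ x ∈ D, f x ≤ P.eval x.length) ∧
  ∃ alg : List (List Bool) → List (List Bool), PolyTime alg ∧
    ∀ x ∈ D, alg [x] = [unary (f x)]

/-- A real number attached to the instance, given to any precision in polynomial time. -/
def RealAccess (D : Set (List Bool)) (r : List Bool → ℝ) : Prop :=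
  ∃ alg : List (List Bool) → List (List Bool), PolyTime alg ∧
    ∀ x ∈ D, ∀ m : ℕ, ∃ u : ℤ, alg [x, unary m] = [intBits u] ∧ ApproxReal m (r x) u

/-- The coefficients `c_0, …, c_d` of a real polynomial `p` of degree at most `d` attached to the
instance, given to any precision in polynomial time. -/
def CoeffAccess (D : Set (List Bool)) (d : List Bool → ℕ) (p : List Bool → Polynomial ℝ) : Prop :=
  ∃ alg : List (List Bool) → List (List Bool), PolyTime alg ∧
    ∀ x ∈ D, ∀ k ≤ d x, ∀ m : ℕ, ∃ u : ℤ,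
      alg [x, k.bits, unary m] = [intBits u] ∧ ApproxReal m ((p x).coeff k) u

/-- Query-access to the matrices `A x` of size `2^n × 2^n`, `n = n x`: from the pair `(i, j)` a
polynomial time algorithm computes the entry `A(i, j)`. -/
def QueryAccess (D : Set (List Bool)) (n : List Bool → ℕ)
    (A : ∀ x : List Bool, Matrix (Fin (2 ^ n x)) (Fin (2 ^ n x)) ℂ) : Prop :=
  ∃ alg : List (List Bool) → List (List Bool), PolyTime alg ∧
    ∀ x ∈ D, ∀ i j : Fin (2 ^ n x), ∀ m : ℕ, ∃ u v : ℤ,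
      alg [x, (i : ℕ).bits, (j : ℕ).bits, unary m] = [intBits u, intBits v] ∧
        ApproxComplex m (A x i j) u v

/-- Each row of `A x` has at most `s x` non-zero entries, and from `(i, l)` with `l < s x` a
polynomial time algorithm computes the column index and the value of the `l`-th non-zero entry of
the `i`-th row (for some fixed enumeration `L` of the non-zero positions of that row), or returns
the empty tuple, as an error message, if there is no such entry. -/
def RowAccess (D : Set (List Bool)) (n s : List Bool → ℕ)
    (A : ∀ x : List Bool, Matrix (Fin (2 ^ n x)) (Fin (2 ^ n x)) ℂ) : Prop :=
  ∃ alg : List (List Bool) → List (List Bool), PolyTime alg ∧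
    ∀ x ∈ D, ∀ i : Fin (2 ^ n x), ∃ L : List (Fin (2 ^ n x)),
      L.Nodup ∧ (∀ j, j ∈ L ↔ A x i j ≠ 0) ∧ L.length ≤ s x ∧
      ∀ l < s x, ∀ m : ℕ,
        match L[l]? with
        | some j => ∃ u v : ℤ,
            alg [x, (i : ℕ).bits, l.bits, unary m] = [(j : ℕ).bits, intBits u, intBits v] ∧
              ApproxComplex m (A x i j) u v
        | none => alg [x, (i : ℕ).bits, l.bits, unary m] = []

/-- Sparse-access to the `s`-sparse matrices `A x`: query-access, and access to the non-zero
entries of every row and of every column. -/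
def SparseAccess (D : Set (List Bool)) (n s : List Bool → ℕ)
    (A : ∀ x : List Bool, Matrix (Fin (2 ^ n x)) (Fin (2 ^ n x)) ℂ) : Prop :=
  QueryAccess D n A ∧ RowAccess D n s A ∧ RowAccess D n s (fun x => (A x).transpose)

/-! ## Probabilistic polynomial time -/

/-- A promise problem: a set of yes-instances and a set of no-instances. -/
structure PromiseProblem where
  /-- the yes-instances -/
  yes : Set (List Bool)
  /-- the no-instances -/
  no : Set (List Bool)

/-- A probabilistic Turing machine: a (multi-stack) machine with two transition functions, `tm.m`
and `alt`, one of which is chosen by a fair coin at each step, and a set of accepting states. -/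
structure ProbTM where
  /-- the stacks, labels, states and first transition function -/
  tm : Turing.FinTM2
  /-- the second transition function -/
  alt : tm.Λ → Turing.TM2.Stmt tm.Γ tm.Λ tm.σ
  /-- the input alphabet is `{0, 1}` -/
  inputAlphabet : tm.Γ tm.k₀ ≃ Bool
  /-- the accepting states -/
  acc : tm.σ → Bool

namespace ProbTM

/-- The initial configuration on input `x`. -/
def init (M : ProbTM) (x : List Bool) : M.tm.Cfg :=
  Turing.initList M.tm (x.map M.inputAlphabet.symm)

/-- On every sequence of coin flips, the machine halts within `t` steps from the given
configuration (the label `none` is the halting one). -/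
def HaltsWithin (M : ProbTM) : ℕ → M.tm.Cfg → Prop
  | _, ⟨none, _, _⟩ => True
  | 0, ⟨some _, _, _⟩ => False
  | t + 1, ⟨some l, v, S⟩ =>
      HaltsWithin M t (Turing.TM2.stepAux (M.tm.m l) v S) ∧
      HaltsWithin M t (Turing.TM2.stepAux (M.alt l) v S)

/-- The probability, over fair independent coin flips, that the machine halts in an accepting
state within `t` steps from the given configuration. -/
def acceptProb (M : ProbTM) : ℕ → M.tm.Cfg → ℚ
  | _, ⟨none, v, _⟩ => if M.acc v = true then 1 else 0
  | 0, ⟨some _, _, _⟩ => 0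
  | t + 1, ⟨some l, v, S⟩ =>
      (acceptProb M t (Turing.TM2.stepAux (M.tm.m l) v S) +
        acceptProb M t (Turing.TM2.stepAux (M.alt l) v S)) / 2

end ProbTM

/-- The class PP of promise problems: some polynomial time probabilistic Turing machine accepts
yes-instances with probability at least `1/2` and no-instances with probability less than `1/2`. -/
def InPP (L : PromiseProblem) : Prop :=
  ∃ (M : ProbTM) (q : Polynomial ℕ),
    (∀ x : List Bool, M.HaltsWithin (q.eval x.length) (M.init x)) ∧
    (∀ x ∈ L.yes, 1 / 2 ≤ M.acceptProb (q.eval x.length) (M.init x)) ∧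
    (∀ x ∈ L.no, M.acceptProb (q.eval x.length) (M.init x) < 1 / 2)

/-! ## The trace problem -/

/-- The trace of `p(A)`, for a real polynomial `p`; for Hermitian `A` it is a real number, so
nothing is lost by taking the real part. -/
noncomputable def tracePoly {N : ℕ} (A : Matrix (Fin N) (Fin N) ℂ) (p : Polynomial ℝ) : ℝ :=
  (Polynomial.aeval A p).trace.re

/-- Deciding whether `tr[p(A)] ≥ b` or `tr[p(A)] ≤ a`, on the instances in `D`. -/
def traceProblem (D : Set (List Bool)) (n : List Bool → ℕ)
    (A : ∀ x : List Bool, Matrix (Fin (2 ^ n x)) (Fin (2 ^ n x)) ℂ)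
    (p : List Bool → Polynomial ℝ) (a b : List Bool → ℝ) : PromiseProblem where
  yes := {x | x ∈ D ∧ b x ≤ tracePoly (A x) (p x)}
  no := {x | x ∈ D ∧ tracePoly (A x) (p x) ≤ a x}

/-! The trace of `p(A)` is a sum over closed walks: the coefficient `c_k` is multiplied by the sum,
over `i_0, …, i_k = i_0`, of the products of the entries `A(i_t, i_{t+1})`. There are exponentially
many walks, but a machine with threshold 1/2 only has to get the sign of a sum of signed
contributions right, and any positive common factor, however small, is harmless.

All data are first rounded to integers over `2^m`. A string of coins selects a start index and `d`
steps. Each step either uses a matrix entry (its real or its imaginary part) or idles, and uses must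
precede idle steps, so the walks with exactly `k` uses yield the power `k` once. An integer `u` is
simulated by a uniform `r < 2^R`: the walk survives if `r < |u|` and takes over the sign of `u`,
which averages to `u / 2^R`. An idle step counts as the integer `2^m`, so every walk carries the
same factor per step, whatever the number of its uses. The last step does the same with `c_k`, and
requires the walk to be closed. Half of the strings are spent on the negated thresholds instead. The
mean phase is then a positive multiple of `tr p(A) - (a + b) / 2` for the rounded data (`avg_walk`,
`avg_phase`). Accepting on phase 1, rejecting on -1 and tossing a coin otherwise gives probability
1/2 plus half of the real part of this mean (`avg_verify`).

Rounding is harmless for polynomial `m`: entries are bounded by the operator norm, and the error of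
the trace is `2^{-m}` times a factor that is only singly exponential in the size of the instance
(`norm_sum_sub_sum_le`, `precision`). This error stays below half of the gap (`sign_of_approx`).

It remains to implement the verifier on stack machines. A small programming language with subroutine
calls is compiled to a host machine (`runs_of_eval`). Composition, pairing, case distinction and
bounded folds of polynomial time functions follow, and the verifier is assembled from these
(`pt_verify`). A last host machine computes the number of coins, tosses them and calls the verifier
(`outcome_tossTM`). Outside of the coin tosses its two transition functions act identically, which
is what `Runs` records. -/

/-! ## Runs of a machine with two transition functions -/

namespace TwoWay

open Turing Function

variable {K : Type} [DecidableEq K] {Γ : K → Type} {Λ σ : Type}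

/-- `Runs M n c c'`: whatever the coins, the machine with transition functions `M false`, `M true`
gets from `c` to `c'` in exactly `n` steps, through the same configurations. -/
def Runs (M : Bool → Λ → TM2.Stmt Γ Λ σ) : ℕ → TM2.Cfg Γ Λ σ → TM2.Cfg Γ Λ σ → Prop
  | 0, c, c' => c = c'
  | n + 1, c, c' => ∃ c₁, (∀ b, TM2.step (M b) c = some c₁) ∧ Runs M n c₁ c'

theorem Runs.trans {M : Bool → Λ → TM2.Stmt Γ Λ σ} {m n : ℕ} {c₁ c₂ c₃ : TM2.Cfg Γ Λ σ}
    (h : Runs M m c₁ c₂) (h' : Runs M n c₂ c₃) : Runs M (m + n) c₁ c₃ := by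
  induction m generalizing c₁ with
  | zero => cases h; simpa using h'
  | succ m ih =>
    obtain ⟨c, hc, hr⟩ := h
    rw [Nat.succ_add]
    exact ⟨c, hc, ih hr⟩

theorem Runs.head {M : Bool → Λ → TM2.Stmt Γ Λ σ} {n : ℕ} {l : Λ} {v : σ}
    {S : ∀ k, List (Γ k)} {c₁ c₂ : TM2.Cfg Γ Λ σ}
    (h : ∀ b, TM2.stepAux (M b l) v S = c₁) (h' : Runs M n c₁ c₂) :
    Runs M (n + 1) ⟨some l, v, S⟩ c₂ :=
  ⟨c₁, fun b => by simp [TM2.step, h b], h'⟩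

theorem Runs.one {M : Bool → Λ → TM2.Stmt Γ Λ σ} {l : Λ} {v : σ}
    {S : ∀ k, List (Γ k)} {c : TM2.Cfg Γ Λ σ}
    (h : ∀ b, TM2.stepAux (M b l) v S = c) : Runs M 1 ⟨some l, v, S⟩ c :=
  Runs.head (n := 0) h rfl

theorem iterate_bind_none {α : Type*} (f : α → Option α) (n : ℕ) :
    (flip Option.bind f)^[n] none = none := by
  induction n with
  | zero => rfl
  | succ n ih => rw [Function.iterate_succ_apply]; exact ih

/-- Translation to the iterated step function, in which the runs of `TM2ComputableInPolyTime` are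
expressed. -/
theorem runs_const_iff {m : Λ → TM2.Stmt Γ Λ σ} {n : ℕ} {c c' : TM2.Cfg Γ Λ σ} :
    Runs (fun _ => m) n c c' ↔ (flip Option.bind (TM2.step m))^[n] (some c) = some c' := by
  induction n generalizing c with
  | zero => simp [Runs]
  | succ n ih =>
    rw [Function.iterate_succ_apply]
    change (∃ c₁, (Bool → TM2.step m c = some c₁) ∧ _) ↔
      (flip Option.bind (TM2.step m))^[n] (TM2.step m c) = some c'
    cases h : TM2.step m c with
    | none => simp [iterate_bind_none]
    | some c₁ => simp [ih]

/-- The largest number of symbols a statement may push. -/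
def pushes : TM2.Stmt Γ Λ σ → ℕ
  | .push _ _ q => pushes q + 1
  | .peek _ _ q => pushes q
  | .pop _ _ q => pushes q
  | .load _ q => pushes q
  | .branch _ q₁ q₂ => pushes q₁ + pushes q₂
  | .goto _ => 0
  | .halt => 0

theorem length_stepAux_le (q : TM2.Stmt Γ Λ σ) (v : σ) (S : ∀ k, List (Γ k)) (k : K) :
    ((TM2.stepAux q v S).stk k).length ≤ (S k).length + pushes q := by
  induction q generalizing v S with
  | push k' f q ih =>
    refine (ih _ _).trans ?_
    by_cases h : k = k'
    · subst h; simp [pushes]; try omega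
    · simp [pushes, Function.update_of_ne h]
  | peek k' f q ih => exact ih _ _
  | pop k' f q ih =>
    refine (ih _ _).trans ?_
    by_cases h : k = k'
    · subst h; simp [pushes]
    · simp [pushes, Function.update_of_ne h]
  | load f q ih => exact ih _ _
  | branch f q₁ q₂ ih₁ ih₂ =>
    simp only [TM2.stepAux, pushes]
    cases f v
    · exact (ih₂ _ _).trans (by omega)
    · exact (ih₁ _ _).trans (by omega)
  | goto f => simp [pushes]
  | halt => simp [pushes]

/-- Turns a bound on the running time into one on the length of the output, which is needed to feed
the output of one machine to another. -/
theorem Runs.length_le {m : Λ → TM2.Stmt Γ Λ σ} {C : ℕ} (hC : ∀ l, pushes (m l) ≤ C) {n : ℕ}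
    {c c' : TM2.Cfg Γ Λ σ} (h : Runs (fun _ => m) n c c') (k : K) :
    (c'.stk k).length ≤ (c.stk k).length + C * n := by
  induction n generalizing c with
  | zero => cases h; simp
  | succ n ih =>
    obtain ⟨c₁, h₁, h₂⟩ := h
    refine (ih h₂).trans ?_
    obtain ⟨l, v, S⟩ := c
    cases l with
    | none => simpa using h₁ true
    | some l =>
      have h₃ := h₁ true
      simp only [TM2.step, Option.some.injEq] at h₃
      subst h₃
      have := length_stepAux_le (m l) v S k
      have := hC l
      simp only [Nat.mul_succ]
      omega

end TwoWay

/-! ## A small language of programs for stack machines with subroutines -/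

namespace StackProg

open Turing Function TwoWay

/-- Programs on stacks `K₀` of symbols `0`, `1`, `#`, with subroutines indexed by `ι`. -/
inductive Prog (ι K₀ : Type) : Type
  | skip : Prog ι K₀
  | push (k : K₀) (a : Option Bool) : Prog ι K₀
  | seq (p q : Prog ι K₀) : Prog ι K₀
  | pop (k : K₀) (c : Option (Option Bool) → Prog ι K₀) : Prog ι K₀
  | loop (k : K₀) (p : Option Bool → Bool) (c : Option Bool → Prog ι K₀) : Prog ι K₀
  | call (i : ι) (k : K₀) : Prog ι K₀
  | flip (k : K₀) : Prog ι K₀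

/-- A machine with input and output alphabet `{0, 1, #}`. -/
abbrev Sub := TM2ComputableAux (Option Bool) (Option Bool)

/-- The machine `s` outputs `w'` on input `w` after exactly `n` steps. -/
def SubRuns (s : Sub) (w w' : List (Option Bool)) (n : ℕ) : Prop :=
  Runs (fun _ => s.tm.m) n (initList s.tm (w.map s.inputAlphabet.symm))
    (haltList s.tm (w'.map s.outputAlphabet.symm))

section Host

variable {ι K₀ : Type} [DecidableEq ι] [DecidableEq K₀] (sub : ι → Sub)

/-- Big-step semantics with the exact number of machine steps; coin flips are left out. -/
inductive Eval : Prog ι K₀ → (K₀ → List (Option Bool)) → (K₀ → List (Option Bool)) → ℕ → Prop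
  | skip {S} : Eval .skip S S 1
  | push {S k a} : Eval (.push k a) S (update S k (a :: S k)) 1
  | seq {p q S S' S'' t t'} : Eval p S S' t → Eval q S' S'' t' → Eval (.seq p q) S S'' (t + t')
  | pop {k c S S' t} : Eval (c (S k).head?) (update S k (S k).tail) S' t →
      Eval (.pop k c) S S' (1 + t)
  | loop_nil {k p c S} : S k = [] → Eval (.loop k p c) S S 1
  | loop_sep {k p c S a l} : S k = a :: l → p a = false → Eval (.loop k p c) S (update S k l) 1
  | loop_cons {k p c S S' S'' a l t t'} : S k = a :: l → p a = true →
      Eval (c a) (update S k l) S' t → Eval (.loop k p c) S' S'' t' →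
      Eval (.loop k p c) S S'' (1 + t + t')
  | call {i k S w n} : SubRuns (sub i) (S k) w n →
      Eval (.call i k) S (update S k w) (n + 2 * (S k).length + 2 * w.length + 4)

/-- The stacks of the host machine: `inl (inl k)` is a stack of the program, `inl (inr true)` an
auxiliary one, `inl (inr false)` one with alphabet `{0, 1}` for the input of a probabilistic
machine, and `inr ⟨i, k⟩` a stack of the subroutine `i`. -/
abbrev HK (K₀ : Type) (sub : ι → Sub) : Type := (K₀ ⊕ Bool) ⊕ (Σ i, (sub i).tm.K)

/-- The alphabets of the host machine. -/
abbrev HG (K₀ : Type) (sub : ι → Sub) : HK K₀ sub → Type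
  | .inl (.inl _) => Option Bool
  | .inl (.inr true) => Option Bool
  | .inl (.inr false) => Bool
  | .inr ⟨i, k⟩ => (sub i).tm.Γ k

/-- The states of the host machine: a register, and the states of the subroutines. -/
abbrev HS (sub : ι → Sub) : Type := Option (Option Bool) × (∀ i, (sub i).tm.σ)

/-- The contents of the stacks of the host machine. -/
def hstk (S : K₀ → List (Option Bool)) (tmp : List (Option Bool)) (inp : List Bool)
    (Z : ∀ i k, List ((sub i).tm.Γ k)) : ∀ k : HK K₀ sub, List (HG K₀ sub k)
  | .inl (.inl k) => S k
  | .inl (.inr true) => tmp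
  | .inl (.inr false) => inp
  | .inr ⟨i, k⟩ => Z i k

variable {sub}

theorem update_hstk_own (S : K₀ → List (Option Bool)) (tmp inp) (Z : ∀ i k, List ((sub i).tm.Γ k))
    (k : K₀) (l : List (Option Bool)) :
    update (hstk sub S tmp inp Z) (.inl (.inl k)) l = hstk sub (update S k l) tmp inp Z := by
  funext k'
  rcases k' with (k' | b) | ⟨i, k'⟩
  · by_cases h : k' = k
    · subst h; rw [update_self]; simp [hstk]
    · rw [update_of_ne (by simpa using h)]; simp [hstk, h]
  · rw [update_of_ne (by simp)]; cases b <;> rfl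
  · rw [update_of_ne (by simp)]; rfl

theorem update_hstk_tmp (S : K₀ → List (Option Bool)) (tmp inp) (Z : ∀ i k, List ((sub i).tm.Γ k))
    (l : List (Option Bool)) :
    update (hstk sub S tmp inp Z) (.inl (.inr true)) l = hstk sub S l inp Z := by
  funext k'
  rcases k' with (k' | b) | ⟨i, k'⟩
  · rw [update_of_ne (by simp)]; rfl
  · cases b
    · rw [update_of_ne (by simp)]; rfl
    · rw [update_self]; rfl
  · rw [update_of_ne (by simp)]; rfl

theorem update_hstk_inp (S : K₀ → List (Option Bool)) (tmp inp) (Z : ∀ i k, List ((sub i).tm.Γ k))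
    (l : List Bool) :
    update (hstk sub S tmp inp Z) (.inl (.inr false)) l = hstk sub S tmp l Z := by
  funext k'
  rcases k' with (k' | b) | ⟨i, k'⟩
  · rw [update_of_ne (by simp)]; rfl
  · cases b
    · rw [update_self]; rfl
    · rw [update_of_ne (by simp)]; rfl
  · rw [update_of_ne (by simp)]; rfl

theorem update_hstk_sub (S : K₀ → List (Option Bool)) (tmp inp) (Z : ∀ i k, List ((sub i).tm.Γ k))
    (i : ι) (k : (sub i).tm.K) (l : List ((sub i).tm.Γ k)) :
    update (hstk sub S tmp inp Z) (.inr ⟨i, k⟩) l =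
      hstk sub S tmp inp (update Z i (update (Z i) k l)) := by
  funext k'
  rcases k' with (k' | b) | ⟨j, k'⟩
  · rw [update_of_ne (by simp)]; rfl
  · rw [update_of_ne (by simp)]; cases b <;> rfl
  · by_cases h : j = i
    · subst h
      by_cases h : k' = k
      · subst h; rw [update_self]; simp [hstk]
      · rw [update_of_ne (by simpa using h)]; simp [hstk, h]
    · rw [update_of_ne (by simp [h])]; simp [hstk, h]

variable {Λ : Type}

/-- A statement of the subroutine `i` as a statement of the host. -/
def trStmt (i : ι) (e : (sub i).tm.Λ → Λ) (x : Λ) :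
    TM2.Stmt (sub i).tm.Γ (sub i).tm.Λ (sub i).tm.σ → TM2.Stmt (HG K₀ sub) Λ (HS sub)
  | .push k f q => .push (Sum.inr ⟨i, k⟩) (fun v => f (v.2 i)) (trStmt i e x q)
  | .peek k f q => .peek (Sum.inr ⟨i, k⟩) (fun v a => (v.1, update v.2 i (f (v.2 i) a)))
      (trStmt i e x q)
  | .pop k f q => .pop (Sum.inr ⟨i, k⟩) (fun v a => (v.1, update v.2 i (f (v.2 i) a)))
      (trStmt i e x q)
  | .load f q => .load (fun v => (v.1, update v.2 i (f (v.2 i)))) (trStmt i e x q)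
  | .branch f q₁ q₂ => .branch (fun v => f (v.2 i)) (trStmt i e x q₁) (trStmt i e x q₂)
  | .goto f => .goto fun v => e (f (v.2 i))
  | .halt => .goto fun _ => x

/-- A configuration of the subroutine `i` as a configuration of the host. -/
def trCfg (i : ι) (e : (sub i).tm.Λ → Λ) (x : Λ) (r : Option (Option Bool))
    (V : ∀ i, (sub i).tm.σ) (S : K₀ → List (Option Bool)) (tmp : List (Option Bool))
    (inp : List Bool) (Z : ∀ i k, List ((sub i).tm.Γ k))
    (c : TM2.Cfg (sub i).tm.Γ (sub i).tm.Λ (sub i).tm.σ) : TM2.Cfg (HG K₀ sub) Λ (HS sub) :=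
  ⟨some (c.l.elim x e), (r, update V i c.var), hstk sub S tmp inp (update Z i c.stk)⟩

theorem stepAux_trStmt (i : ι) (e : (sub i).tm.Λ → Λ) (x : Λ) (r : Option (Option Bool))
    (V : ∀ i, (sub i).tm.σ) (S : K₀ → List (Option Bool)) (tmp : List (Option Bool))
    (inp : List Bool) (Z : ∀ i k, List ((sub i).tm.Γ k))
    (q : TM2.Stmt (sub i).tm.Γ (sub i).tm.Λ (sub i).tm.σ) (v : (sub i).tm.σ)
    (T : ∀ k, List ((sub i).tm.Γ k)) :
    TM2.stepAux (trStmt i e x q) (r, update V i v) (hstk sub S tmp inp (update Z i T)) =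
      trCfg i e x r V S tmp inp Z (TM2.stepAux q v T) := by
  have hT : ∀ (T : ∀ k, List ((sub i).tm.Γ k)) k,
      hstk sub S tmp inp (update Z i T) (.inr ⟨i, k⟩) = T k :=
    fun T k => by
      change update Z i T i k = T k
      rw [update_self]
  induction q generalizing v T with
  | push k f q ih =>
    simp only [trStmt, TM2.stepAux, hT, update_hstk_sub, update_self, update_idem]
    exact ih _ _
  | peek k f q ih =>
    simp only [trStmt, TM2.stepAux, hT, update_self, update_idem]
    exact ih _ _
  | pop k f q ih =>
    simp only [trStmt, TM2.stepAux, hT, update_hstk_sub, update_self, update_idem]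
    exact ih _ _
  | load f q ih =>
    simp only [trStmt, TM2.stepAux, update_self, update_idem]
    exact ih _ _
  | branch f q₁ q₂ ih₁ ih₂ =>
    simp only [trStmt, TM2.stepAux, update_self]
    cases f v
    · exact ih₂ _ _
    · exact ih₁ _ _
  | goto f => simp [trStmt, TM2.stepAux, trCfg]
  | halt => simp [trStmt, TM2.stepAux, trCfg]

theorem runs_trCfg {M : Bool → Λ → TM2.Stmt (HG K₀ sub) Λ (HS sub)} (i : ι)
    (e : (sub i).tm.Λ → Λ) (x : Λ) (hM : ∀ b l, M b (e l) = trStmt i e x ((sub i).tm.m l))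
    (r : Option (Option Bool)) (V : ∀ i, (sub i).tm.σ) (S : K₀ → List (Option Bool))
    (tmp : List (Option Bool)) (inp : List Bool) (Z : ∀ i k, List ((sub i).tm.Γ k)) {n : ℕ}
    {c c' : TM2.Cfg (sub i).tm.Γ (sub i).tm.Λ (sub i).tm.σ}
    (h : Runs (fun _ => (sub i).tm.m) n c c') :
    Runs M n (trCfg i e x r V S tmp inp Z c) (trCfg i e x r V S tmp inp Z c') := by
  induction n generalizing c with
  | zero => cases h; rfl
  | succ n ih =>
    obtain ⟨c₁, h₁, h₂⟩ := h
    obtain ⟨l, v, T⟩ := c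
    cases l with
    | none => simpa using h₁ true
    | some l =>
      have h₃ := h₁ true
      simp only [TM2.step, Option.some.injEq] at h₃
      subst h₃
      refine Runs.head (fun b => ?_) (ih h₂)
      simp only [Option.elim, hM]
      exact stepAux_trStmt i e x r V S tmp inp Z _ _ _

/-- Pop a symbol from `k` and push it to `k'`, or go on to `x` if there is none. -/
def moveStmt (k k' : HK K₀ sub) (u : HG K₀ sub k → Option Bool) (v : Option Bool → HG K₀ sub k')
    (self x : Λ) : TM2.Stmt (HG K₀ sub) Λ (HS sub) :=
  .pop k (fun s a => (a.map u, s.2))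
    (.branch (fun s => s.1.isSome)
      (.push k' (fun s => v (s.1.getD none)) (.goto fun _ => self))
      (.goto fun _ => x))

/-- Moving a stack symbol by symbol reverses it. A call therefore moves its argument, and later its
result, twice, through the auxiliary stack. -/
theorem runs_moveStmt {M : Bool → Λ → TM2.Stmt (HG K₀ sub) Λ (HS sub)} {k k' : HK K₀ sub}
    (hk : k ≠ k') {u : HG K₀ sub k → Option Bool} {v : Option Bool → HG K₀ sub k'} {self x : Λ}
    (hM : ∀ b, M b self = moveStmt k k' u v self x) (r : Option (Option Bool))
    (V : ∀ i, (sub i).tm.σ) (T : ∀ k : HK K₀ sub, List (HG K₀ sub k)) :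
    Runs M ((T k).length + 1) ⟨some self, (r, V), T⟩ ⟨some x, (none, V),
      update (update T k []) k' (((T k).reverse.map fun a => v (u a)) ++ T k')⟩ := by
  induction hl : T k generalizing r T with
  | nil =>
    refine Runs.one fun b => ?_
    have h1 : update T k [] = T := by rw [← hl, update_eq_self]
    simp [hM, moveStmt, TM2.stepAux, hl, h1]
  | cons a l ih =>
    set T' : ∀ k : HK K₀ sub, List (HG K₀ sub k) := update (update T k l) k' (v (u a) :: T k')
      with hT'
    have h1 : T' k = l := by rw [hT', update_of_ne hk, update_self]
    have h2 := ih (some (u a)) T' h1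
    refine Runs.head (c₁ := ⟨some self, (some (u a), V), T'⟩) (fun b => ?_) ?_
    · simp [hM, moveStmt, TM2.stepAux, hl, hT', update_of_ne hk.symm]
    · rw [List.length_cons] at *
      convert h2 using 2
      funext j
      by_cases h1 : j = k'
      · subst h1; simp [hT']
      · by_cases h2 : j = k
        · subst h2; rw [update_of_ne hk, update_of_ne hk, update_self, update_self]
        · simp [hT', h1, h2]

variable (sub)

/-- The labels of a program. -/
def Lab : Prog ι K₀ → Type
  | .skip => Unit
  | .push _ _ => Unit
  | .seq p q => Lab p ⊕ Lab q
  | .pop _ c => Option (Σ a, Lab (c a))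
  | .loop _ _ c => Option (Σ a, Lab (c a))
  | .call i _ => Fin 4 ⊕ (sub i).tm.Λ
  | .flip _ => Unit

omit [DecidableEq ι] [DecidableEq K₀] in
theorem finite_lab (p : Prog ι K₀) : Finite (Lab sub p) := by
  induction p with
  | skip => exact inferInstanceAs (Finite Unit)
  | push => exact inferInstanceAs (Finite Unit)
  | seq p q ihp ihq => exact inferInstanceAs (Finite (Lab sub p ⊕ Lab sub q))
  | pop k c ih => exact inferInstanceAs (Finite (Option (Σ a, Lab sub (c a))))
  | loop k p c ih => exact inferInstanceAs (Finite (Option (Σ a, Lab sub (c a))))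
  | call i k =>
    have := (sub i).tm.ΛFin
    exact inferInstanceAs (Finite (Fin 4 ⊕ (sub i).tm.Λ))
  | flip => exact inferInstanceAs (Finite Unit)

/-- The first label of a program. -/
def entry : (p : Prog ι K₀) → Lab sub p
  | .skip => ()
  | .push _ _ => ()
  | .seq p _ => .inl (entry p)
  | .pop _ _ => none
  | .loop _ _ _ => none
  | .call _ _ => .inl 0
  | .flip _ => ()

/-- The statements of a program, whose labels are embedded by `e` into those of a machine and which
goes on to the label `x`; flips push the coin `b`. -/
def compile (b : Bool) : (p : Prog ι K₀) → (Lab sub p → Λ) → Λ → Lab sub p →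
    TM2.Stmt (HG K₀ sub) Λ (HS sub)
  | .skip, _, x, _ => .goto fun _ => x
  | .push k a, _, x, _ => .push (Sum.inl (.inl k)) (fun _ => a) (.goto fun _ => x)
  | .seq p q, e, _, .inl l => compile b p (fun l => e (.inl l)) (e (.inr (entry sub q))) l
  | .seq _ q, e, x, .inr l => compile b q (fun l => e (.inr l)) x l
  | .pop k c, e, _, none => .pop (Sum.inl (.inl k)) (fun v a => (a, v.2))
      (.goto fun v => e (some ⟨v.1, entry sub (c v.1)⟩))
  | .pop _ c, e, x, some ⟨a, l⟩ => compile b (c a) (fun l => e (some ⟨a, l⟩)) x l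
  | .loop k p c, e, x, none => .pop (Sum.inl (.inl k)) (fun v a => (a, v.2))
      (.goto fun v => v.1.elim x fun a => if p a then e (some ⟨a, entry sub (c a)⟩) else x)
  | .loop _ _ c, e, _, some ⟨a, l⟩ => compile b (c a) (fun l => e (some ⟨a, l⟩)) (e none) l
  | .call i k, e, x, l => match l with
    | .inl 0 => moveStmt (Sum.inl (.inl k)) (Sum.inl (.inr true)) (fun a => a) (fun a => a)
        (e (.inl 0)) (e (.inl 1))
    | .inl 1 => moveStmt (Sum.inl (.inr true)) (Sum.inr ⟨i, (sub i).tm.k₀⟩) (fun a => a)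
        (sub i).inputAlphabet.symm (e (.inl 1)) (e (.inr (sub i).tm.main))
    | .inl 2 => moveStmt (Sum.inr ⟨i, (sub i).tm.k₁⟩) (Sum.inl (.inr true))
        (sub i).outputAlphabet (fun a => a) (e (.inl 2)) (e (.inl 3))
    | .inl 3 => moveStmt (Sum.inl (.inr true)) (Sum.inl (.inl k)) (fun a => a) (fun a => a)
        (e (.inl 3)) x
    | .inr l => trStmt i (fun l => e (.inr l)) (e (.inl 2)) ((sub i).tm.m l)
  | .flip k, _, x, _ => .push (Sum.inl (.inl k)) (fun _ => some b) (.goto fun _ => x)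

variable {sub}

theorem initList_stk (tm : FinTM2) (l : List (tm.Γ tm.k₀)) :
    (initList tm l).stk = update (fun _ => []) tm.k₀ l := by
  funext k
  by_cases h : k = tm.k₀
  · subst h; simp [initList]
  · simp [initList, h]

theorem haltList_stk (tm : FinTM2) (l : List (tm.Γ tm.k₁)) :
    (haltList tm l).stk = update (fun _ => []) tm.k₁ l := by
  funext k
  by_cases h : k = tm.k₁
  · subst h; simp [haltList]
  · simp [haltList, h]

omit [DecidableEq K₀] in
theorem compile_pop_entry (b : Bool) {k : K₀} {c : Option (Option Bool) → Prog ι K₀}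
    (e : Lab sub (.pop k c) → Λ) (x : Λ) :
    compile sub b (.pop k c) e x (entry sub (.pop k c)) =
      .pop (Sum.inl (.inl k)) (fun v a => (a, v.2))
      (.goto fun v => e (some ⟨v.1, entry sub (c v.1)⟩)) := rfl

omit [DecidableEq K₀] in
theorem compile_loop_entry (b : Bool) {k : K₀} {p : Option Bool → Bool}
    {c : Option Bool → Prog ι K₀} (e : Lab sub (.loop k p c) → Λ) (x : Λ) :
    compile sub b (.loop k p c) e x (entry sub (.loop k p c)) =
      .pop (Sum.inl (.inl k)) (fun v a => (a, v.2)) (.goto fun v =>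
        v.1.elim x fun a => if p a then e (some ⟨a, entry sub (c a)⟩) else x) := rfl

variable (sub) in
/-- The host at label `l`, between two commands. -/
def hcfg (l : Λ) (r : Option (Option Bool)) (S : K₀ → List (Option Bool))
    (inp : List Bool) : TM2.Cfg (HG K₀ sub) Λ (HS sub) :=
  ⟨some l, (r, fun i => (sub i).tm.initialState), hstk sub S [] inp (fun _ _ => [])⟩

/-- Five phases: two moves bring the argument in, the subroutine runs, two moves bring the result
out. Since `haltList` prescribes the initial state and empty stacks apart from the output, the
subroutine is left ready for its next call. -/
theorem runs_call {M : Bool → Λ → TM2.Stmt (HG K₀ sub) Λ (HS sub)} {i : ι} {k : K₀}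
    {e : Lab sub (.call i k : Prog ι K₀) → Λ} {x : Λ}
    (hM : ∀ b l, M b (e l) = compile sub b (.call i k) e x l)
    {S : K₀ → List (Option Bool)} {w : List (Option Bool)} {n : ℕ}
    (h : SubRuns (sub i) (S k) w n) (r : Option (Option Bool)) (inp : List Bool) :
    Runs M (n + 2 * (S k).length + 2 * w.length + 4) (hcfg sub (e (.inl 0)) r S inp)
      (hcfg sub x none (update S k w) inp) := by
  set V : ∀ i, (sub i).tm.σ := fun i => (sub i).tm.initialState with hV
  set Z : ∀ i k, List ((sub i).tm.Γ k) := fun _ _ => [] with hZ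
  have h0 := runs_moveStmt (M := M) (sub := sub) (k := Sum.inl (.inl k))
    (k' := Sum.inl (.inr true)) (by simp) (u := fun a => a) (v := fun a => a) (fun b => hM b (.inl 0)) r V (hstk sub S [] inp Z)
  rw [update_hstk_own, update_hstk_tmp] at h0
  have h1 := runs_moveStmt (M := M) (sub := sub) (k := Sum.inl (.inr true))
    (k' := Sum.inr ⟨i, (sub i).tm.k₀⟩) (by simp) (u := fun a => a)
    (v := (sub i).inputAlphabet.symm) (fun b => hM b (.inl 1)) none V
    (hstk sub (update S k []) (S k).reverse inp Z)
  rw [update_hstk_tmp, update_hstk_sub] at h1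
  have h2 := runs_trCfg (M := M) i (fun l => e (.inr l)) (e (.inl 2)) (fun b l => hM b (.inr l))
    none V (update S k []) [] inp Z h
  have h3 := runs_moveStmt (M := M) (sub := sub) (k := Sum.inr ⟨i, (sub i).tm.k₁⟩)
    (k' := Sum.inl (.inr true)) (by simp) (u := (sub i).outputAlphabet) (v := fun a => a)
    (fun b => hM b (.inl 2)) none V
    (hstk sub (update S k []) [] inp
      (update Z i (update (fun _ => []) (sub i).tm.k₁ (w.map (sub i).outputAlphabet.symm))))
  rw [update_hstk_sub, update_hstk_tmp] at h3
  have h4 := runs_moveStmt (M := M) (sub := sub) (k := Sum.inl (.inr true))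
    (k' := Sum.inl (.inl k)) (by simp) (u := fun a => a) (v := fun a => a) (fun b => hM b (.inl 3)) none V
    (hstk sub (update S k []) w.reverse inp Z)
  rw [update_hstk_tmp, update_hstk_own] at h4
  simp only [hstk, trCfg, initList_stk, haltList_stk, update_self, update_idem, List.map_id',
    List.map_reverse, List.reverse_reverse, List.append_nil, List.length_reverse] at h0 h1 h2 h3 h4
  have e1 : update Z i (update (fun _ => []) (sub i).tm.k₁ []) = Z := by
    rw [update_eq_self_iff.2 rfl, update_eq_self_iff.2 rfl]
  have e2 : update V i (haltList (sub i).tm (w.map (sub i).outputAlphabet.symm)).var = V := by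
    rw [update_eq_self_iff]; rfl
  have e3 : update V i (initList (sub i).tm ((S k).map (sub i).inputAlphabet.symm)).var = V := by
    rw [update_eq_self_iff]; rfl
  rw [e2, e3] at h2
  rw [show Z i (sub i).tm.k₀ = [] from rfl, List.append_nil] at h1
  simp only [List.map_map, List.length_map, Equiv.self_comp_symm, List.map_id] at h3
  rw [e1] at h3
  have := (((h0.trans h1).trans h2).trans h3).trans h4
  rw [show n + 2 * (S k).length + 2 * w.length + 4 = (S k).length + 1 + ((S k).length + 1) + n +
    (w.length + 1) + (w.length + 1) by ring]
  exact this

/-- The induction is on the evaluation and not on the program, because a loop is entered again after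
its body. The embedding of labels and the exit label vary, so that a subprogram is treated within
the same machine. Coins are irrelevant since `Eval` has no rule for flips. -/
theorem runs_of_eval {p : Prog ι K₀} {S S' : K₀ → List (Option Bool)} {t : ℕ}
    (h : Eval sub p S S' t) {M : Bool → Λ → TM2.Stmt (HG K₀ sub) Λ (HS sub)}
    {e : Lab sub p → Λ} {x : Λ} (hM : ∀ b l, M b (e l) = compile sub b p e x l)
    (r : Option (Option Bool)) (inp : List Bool) :
    ∃ r', Runs M t (hcfg sub (e (entry sub p)) r S inp) (hcfg sub x r' S' inp) := by
  induction h generalizing x r with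
  | skip => exact ⟨r, Runs.one fun b => by rw [hM]; rfl⟩
  | push =>
    refine ⟨r, Runs.one fun b => ?_⟩
    rw [hM]
    simp only [compile, TM2.stepAux, update_hstk_own]
    rfl
  | seq _ _ ih₁ ih₂ =>
    obtain ⟨r₁, h₁⟩ := ih₁ (e := fun l => e (.inl l)) (fun b l => hM b (.inl l)) r
    obtain ⟨r₂, h₂⟩ := ih₂ (e := fun l => e (.inr l)) (fun b l => hM b (.inr l)) r₁
    exact ⟨r₂, h₁.trans h₂⟩
  | @pop k c S S' t _ ih =>
    obtain ⟨r', h'⟩ := ih (e := fun l => e (some ⟨(S k).head?, l⟩))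
      (fun b l => hM b (some ⟨_, l⟩)) (S k).head?
    refine ⟨r', (Runs.one fun b => ?_).trans h'⟩
    rw [hM, compile_pop_entry]
    simp only [TM2.stepAux, update_hstk_own]
    rfl
  | @loop_nil k p c S hS =>
    refine ⟨none, Runs.one fun b => ?_⟩
    rw [hM, compile_loop_entry]
    simp only [TM2.stepAux, update_hstk_own, hstk, hS]
    rw [List.tail_nil, update_eq_self_iff.2 hS.symm]
    rfl
  | @loop_sep k p c S a l hS hp =>
    refine ⟨some a, Runs.one fun b => ?_⟩
    rw [hM, compile_loop_entry]
    simp only [TM2.stepAux, update_hstk_own, hstk, hS]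
    simp [hp, hcfg]
  | @loop_cons k p c S S' S'' a l t t' hS hp _ _ ih₁ ih₂ =>
    obtain ⟨r₁, h₁⟩ := ih₁ (e := fun l => e (some ⟨a, l⟩)) (fun b l => hM b (some ⟨a, l⟩)) (some a)
    obtain ⟨r₂, h₂⟩ := ih₂ hM r₁
    refine ⟨r₂, ((Runs.one fun b => ?_).trans h₁).trans h₂⟩
    rw [hM, compile_loop_entry]
    simp only [TM2.stepAux, update_hstk_own, hstk, hS]
    simp [hp, hcfg]
  | call h => exact ⟨none, runs_call hM h r inp⟩

end Host

end StackProg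

/-! ### From programs to machines and from machines to subroutines -/

namespace StackProg

open Turing Function TwoWay

section HostMachine

variable {ι K₀ : Type} [DecidableEq ι] [Fintype ι] [DecidableEq K₀] [Fintype K₀] (sub : ι → Sub)

/-- The machine that runs a program, with input on the stack `kin` and output on the stack
`kout`. -/
noncomputable def hostTM (p : Prog ι K₀) (kin kout : K₀) : FinTM2 :=
  letI := fun i => (sub i).tm.kFin
  letI := fun i => (sub i).tm.σFin
  haveI := finite_lab sub p
  letI := Fintype.ofFinite (Lab sub p)
  { K := HK K₀ sub
    k₀ := .inl (.inl kin)
    k₁ := .inl (.inl kout)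
    Γ := HG K₀ sub
    Λ := Lab sub p ⊕ Unit
    main := .inl (entry sub p)
    σ := HS sub
    initialState := (none, fun i => (sub i).tm.initialState)
    Γk₀Fin := inferInstanceAs (Fintype (Option Bool))
    m := fun l => match l with
      | .inl l => compile sub false p Sum.inl (.inr ()) l
      -- The register is reset because `haltList` prescribes the initial state; this is the extra
      -- step in the running time.
      | .inr () => .load (fun v => (none, v.2)) .halt }

variable {sub}

theorem _root_.TwoWay.Runs.const {K : Type} [DecidableEq K] {Γ : K → Type} {Λ σ : Type}
    {M : Bool → Λ → TM2.Stmt Γ Λ σ} {n : ℕ} {c c' : TM2.Cfg Γ Λ σ} (h : Runs M n c c') (b : Bool) :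
    Runs (fun _ => M b) n c c' := by
  induction n generalizing c with
  | zero => exact h
  | succ n ih =>
    obtain ⟨c₁, h₁, h₂⟩ := h
    exact ⟨c₁, fun _ => h₁ b, ih h₂⟩

/-- A stack contents with only one non-empty stack. -/
def single (k : K₀) (l : List (Option Bool)) : K₀ → List (Option Bool) := update (fun _ => []) k l

theorem runs_hostTM {p : Prog ι K₀} {kin kout : K₀} {w w' : List (Option Bool)} {t : ℕ}
    (h : Eval sub p (single kin w) (single kout w') t) :
    Runs (fun _ => (hostTM sub p kin kout).m) (t + 1)
      (initList (hostTM sub p kin kout) w) (haltList (hostTM sub p kin kout) w') := by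
  have hz : hstk (K₀ := K₀) sub (fun _ => []) [] [] (fun _ _ => []) = fun _ => [] := by
    funext k
    rcases k with (k | b) | ⟨i, k⟩
    · rfl
    · cases b <;> rfl
    · rfl
  let M : Bool → Lab sub p ⊕ Unit → TM2.Stmt (HG K₀ sub) (Lab sub p ⊕ Unit) (HS sub) :=
    fun b l => match l with
      | .inl l => compile sub b p Sum.inl (.inr ()) l
      | .inr () => .load (fun v => (none, v.2)) .halt
  obtain ⟨r, hr⟩ := runs_of_eval h (M := M) (e := Sum.inl) (x := .inr ()) (fun b l => rfl) none []
  have h2 : Runs M 1 (hcfg sub (.inr ()) r (single kout w') [])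
      ⟨none, (none, fun i => (sub i).tm.initialState),
        hstk sub (single kout w') [] [] (fun _ _ => [])⟩ := Runs.one fun b => rfl
  have h3 := (hr.trans h2).const false
  have e1 : initList (hostTM sub p kin kout) w = hcfg sub (.inl (entry sub p)) none
      (single kin w) [] := by
    have := initList_stk (hostTM sub p kin kout) w
    unfold hcfg single
    rw [← update_hstk_own, hz]
    change (⟨_, _, (initList (hostTM sub p kin kout) w).stk⟩ : TM2.Cfg _ _ _) = _
    rw [this]
    rfl
  have e2 : haltList (hostTM sub p kin kout) w' =
      ⟨none, (none, fun i => (sub i).tm.initialState),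
        hstk sub (single kout w') [] [] (fun _ _ => [])⟩ := by
    have := haltList_stk (hostTM sub p kin kout) w'
    unfold single
    rw [← update_hstk_own, hz]
    change (⟨_, _, (haltList (hostTM sub p kin kout) w').stk⟩ : TM2.Cfg _ _ _) = _
    rw [this]
    rfl
  rw [e1, e2]
  exact h3

end HostMachine

/-- `p` gets from the stacks `S` to the stacks `S'` in at most `T` machine steps. -/
def EvalLe {ι K₀ : Type} [DecidableEq ι] [DecidableEq K₀] (sub : ι → Sub) (p : Prog ι K₀)
    (S S' : K₀ → List (Option Bool)) (T : ℕ) : Prop := ∃ t ≤ T, Eval sub p S S' t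

/-- Functions between types with given encodings that are computed in polynomial time. -/
def PolyTimeEnc {α β : Type} (ea : α → List (Option Bool)) (eb : β → List (Option Bool))
    (f : α → β) : Prop :=
  Nonempty (TM2ComputableInPolyTime ea eb f)

theorem polyTimeEnc_of_prog {ι K₀ : Type} [DecidableEq ι] [Fintype ι] [DecidableEq K₀]
    [Fintype K₀] {sub : ι → Sub} {α β : Type} {ea : α → List (Option Bool)}
    {eb : β → List (Option Bool)} {f : α → β} (p : Prog ι K₀) (kin kout : K₀) (T : Polynomial ℕ)
    (h : ∀ a, EvalLe sub p (single kin (ea a)) (single kout (eb (f a))) (T.eval (ea a).length)) :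
    PolyTimeEnc ea eb f := by
  refine ⟨⟨⟨hostTM sub p kin kout, Equiv.refl (Option Bool), Equiv.refl (Option Bool)⟩, T + 1,
    fun a => ?_⟩⟩
  have h' : ∃ t ≤ (T + 1).eval (ea a).length, Runs (fun _ => (hostTM sub p kin kout).m) t
      (initList (hostTM sub p kin kout) (ea a)) (haltList (hostTM sub p kin kout) (eb (f a))) := by
    obtain ⟨t, ht, he⟩ := h a
    exact ⟨t + 1, by simpa using ht, runs_hostTM he⟩
  refine ⟨⟨h'.choose, ?_⟩, h'.choose_spec.1⟩
  have h2 := runs_const_iff.1 h'.choose_spec.2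
  have e1 : List.map (Equiv.refl (Option Bool)).invFun (ea a) = ea a := List.map_id _
  have e2 : List.map (Equiv.refl (Option Bool)).invFun (eb (f a)) = eb (f a) := List.map_id _
  exact (congrArg (fun l => (flip Option.bind (TM2.step (hostTM sub p kin kout).m))^[h'.choose]
      (some (initList (hostTM sub p kin kout) l))) e1).trans
    (h2.trans (congrArg (fun l => some (haltList (hostTM sub p kin kout) l)) e2.symm))

theorem monotone_eval (P : Polynomial ℕ) : Monotone fun n => P.eval n := by
  intro m n hmn
  simp only [Polynomial.eval_eq_sum, Polynomial.sum]
  gcongr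

/-- There are finitely many labels, so some constant bounds the number of symbols pushed in any one
step, and the output is at most as long as the input plus this constant times the time. A single
polynomial serves for both bounds. -/
theorem PolyTimeEnc.exists_sub {α β : Type} {ea : α → List (Option Bool)}
    {eb : β → List (Option Bool)} {f : α → β} (h : PolyTimeEnc ea eb f) :
    ∃ (s : Sub) (T : Polynomial ℕ), ∀ a,
      (∃ n ≤ T.eval (ea a).length, SubRuns s (ea a) (eb (f a)) n) ∧
      (eb (f a)).length ≤ T.eval (ea a).length := by
  obtain ⟨h⟩ := h
  have := h.tm.ΛFin
  obtain ⟨C, hC⟩ : ∃ C, ∀ l, pushes (h.tm.m l) ≤ C :=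
    ⟨Finset.univ.sup fun l => pushes (h.tm.m l),
      fun l => Finset.le_sup (f := fun l => pushes (h.tm.m l)) (Finset.mem_univ l)⟩
  have hrun : ∀ a, ∃ n ≤ h.time.eval (ea a).length,
      SubRuns h.toTM2ComputableAux (ea a) (eb (f a)) n := fun a =>
    ⟨(h.outputsFun a).steps, (h.outputsFun a).steps_le_m,
      runs_const_iff.2 (h.outputsFun a).evals_in_steps⟩
  refine ⟨h.toTM2ComputableAux, h.time + Polynomial.X + Polynomial.C C * h.time, fun a => ?_⟩
  obtain ⟨n, hn, hr⟩ := hrun a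
  simp only [Polynomial.eval_add, Polynomial.eval_mul, Polynomial.eval_C, Polynomial.eval_X]
  refine ⟨⟨n, by omega, hr⟩, ?_⟩
  have h1 := hr.length_le hC h.tm.k₁
  rw [haltList_stk, initList_stk, update_self, List.length_map] at h1
  have h2 : (update (fun _ => []) h.tm.k₀ (List.map (h.inputAlphabet.symm) (ea a))
      h.tm.k₁ : List (h.tm.Γ h.tm.k₁)).length ≤ (ea a).length := by
    -- Input and output may share a stack, in which case the input already occupies it at the start.
    by_cases hk : h.tm.k₁ = h.tm.k₀
    · have : ∀ k (_ : k = h.tm.k₀), (update (fun _ => []) h.tm.k₀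
        (List.map (h.inputAlphabet.symm) (ea a)) k : List (h.tm.Γ k)).length ≤ (ea a).length := by
        rintro k rfl; simp
      exact this _ hk
    · rw [update_of_ne hk]; simp
  have h3 : C * n ≤ C * h.time.eval (ea a).length := Nat.mul_le_mul_left _ hn
  change _ ≤ (update (fun _ => []) h.tm.k₀ (List.map (h.inputAlphabet.symm) (ea a))
      h.tm.k₁ : List (h.tm.Γ h.tm.k₁)).length + _ at h1
  omega

end StackProg

/-! ### Basic programs: copying, moving and dropping fields -/

namespace StackProg

open Turing Function TwoWay

section EvalLe

variable {ι K₀ : Type} [DecidableEq ι] [DecidableEq K₀] {sub : ι → Sub}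
  {S S' S'' : K₀ → List (Option Bool)}

theorem EvalLe.mono {p : Prog ι K₀} {T T' : ℕ} (h : EvalLe sub p S S' T) (hT : T ≤ T') :
    EvalLe sub p S S' T' :=
  let ⟨t, ht, he⟩ := h
  ⟨t, ht.trans hT, he⟩

theorem EvalLe.of_eq {p : Prog ι K₀} {T T' : ℕ} (h : EvalLe sub p S S' T) (hS : S' = S'')
    (hT : T ≤ T') : EvalLe sub p S S'' T' :=
  hS ▸ h.mono hT

omit [DecidableEq ι] in
theorem Eval.of_eq {p : Prog ι K₀} {t t' : ℕ} (h : Eval sub p S S' t) (hS : S' = S'')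
    (ht : t = t') : Eval sub p S S'' t' :=
  hS ▸ ht ▸ h

theorem EvalLe.seq {p q : Prog ι K₀} {T T' : ℕ} (h : EvalLe sub p S S' T)
    (h' : EvalLe sub q S' S'' T') : EvalLe sub (.seq p q) S S'' (T + T') :=
  let ⟨_, ht, he⟩ := h
  let ⟨_, ht', he'⟩ := h'
  ⟨_, add_le_add ht ht', .seq he he'⟩

theorem evalLe_skip : EvalLe sub .skip S S 1 := ⟨1, le_rfl, .skip⟩

theorem evalLe_push (k : K₀) (a : Option Bool) :
    EvalLe sub (.push k a) S (update S k (a :: S k)) 1 := ⟨1, le_rfl, .push⟩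

theorem evalLe_pop {k : K₀} {c : Option (Option Bool) → Prog ι K₀} {T : ℕ}
    (h : EvalLe sub (c (S k).head?) (update S k (S k).tail) S' T) :
    EvalLe sub (.pop k c) S S' (1 + T) :=
  let ⟨_, ht, he⟩ := h
  ⟨_, add_le_add le_rfl ht, .pop he⟩

theorem evalLe_call {i : ι} {k : K₀} {w w' : List (Option Bool)} {T : ℕ} (hk : S k = w)
    (h : ∃ n ≤ T, SubRuns (sub i) w w' n) :
    EvalLe sub (.call i k) S (update S k w') (T + 2 * w.length + 2 * w'.length + 4) := by
  subst hk
  obtain ⟨n, hn, h⟩ := h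
  exact ⟨_, by omega, .call h⟩

/-- Push the symbol `a` on each of the stacks `ks`. -/
def pushAll (ks : List K₀) (a : Option Bool) : Prog ι K₀ :=
  ks.foldr (fun k p => .seq (.push k a) p) .skip

omit [DecidableEq ι] in
theorem eval_pushAll {ks : List K₀} (hks : ks.Nodup) (a : Option Bool) :
    Eval sub (pushAll ks a) S (fun j => if j ∈ ks then a :: S j else S j) (ks.length + 1) := by
  induction ks generalizing S with
  | nil => simpa [pushAll] using Eval.skip
  | cons k ks ih =>
    rw [List.nodup_cons] at hks
    have := Eval.seq (Eval.push (sub := sub) (S := S) (k := k) (a := a)) (ih hks.2)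
    refine this.of_eq ?_ (by rw [List.length_cons]; ring)
    funext j
    by_cases h : j = k
    · subst h; simp [hks.1]
    · simp [h]

/-- Move symbols from the stack `k` to each of the stacks `ks`, which reverses their order, up to
the first separator if `sep` is set, and up to the end otherwise. -/
def transfer (k : K₀) (sep : Bool) (ks : List K₀) : Prog ι K₀ :=
  .loop k (fun a => !sep || a.isSome) (pushAll ks)

/-- The loop stops either at the bottom of the stack or at a separator, and in the second case the
separator is consumed. -/
theorem evalLe_transfer_aux {k : K₀} {sep : Bool} {ks : List K₀} (hks : (k :: ks).Nodup)
    {l rest rest' : List (Option Bool)} (hl : ∀ a ∈ l, (!sep || a.isSome) = true)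
    (hrest : (rest = [] ∧ rest' = []) ∨ (sep = true ∧ rest = none :: rest'))
    (hS : S k = l ++ rest) :
    EvalLe sub (transfer k sep ks) S
      (fun j => if j = k then rest' else if j ∈ ks then l.reverse ++ S j else S j)
      ((ks.length + 2) * l.length + 1) := by
  rw [List.nodup_cons] at hks
  induction l generalizing S with
  | nil =>
    refine ⟨1, by simp, ?_⟩
    rcases hrest with ⟨rfl, rfl⟩ | ⟨rfl, rfl⟩
    · refine (Eval.loop_nil hS).of_eq ?_ rfl
      funext j
      by_cases h : j = k
      · subst h; simpa using hS.symm
      · simp [h]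
    · refine (Eval.loop_sep hS (by rfl)).of_eq ?_ rfl
      funext j
      by_cases h : j = k
      · subst h; simp
      · simp [h]
  | cons a l ih =>
    set S₁ := update S k (l ++ rest) with hS₁
    set S₂ : K₀ → List (Option Bool) := fun j => if j ∈ ks then a :: S₁ j else S₁ j with hS₂
    have h₁ : Eval sub (pushAll ks a) S₁ S₂ (ks.length + 1) := eval_pushAll hks.2 a
    obtain ⟨t, ht, h₂⟩ := ih (S := S₂) (fun a ha => hl a (List.mem_cons_of_mem _ ha))
      (by simp [hS₂, hS₁, hks.1])
    refine ⟨1 + (ks.length + 1) + t, by rw [List.length_cons]; linarith, ?_⟩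
    refine (Eval.loop_cons (by rw [hS]; rfl) (hl a List.mem_cons_self) h₁ h₂).of_eq ?_ rfl
    funext j
    by_cases h : j = k
    · simp [h]
    · by_cases hj : j ∈ ks <;> simp [h, hj, hS₂, hS₁]

theorem evalLe_transfer_all {k : K₀} {ks : List K₀} (hks : (k :: ks).Nodup)
    {l : List (Option Bool)} (hS : S k = l) :
    EvalLe sub (transfer k false ks) S
      (fun j => if j = k then [] else if j ∈ ks then l.reverse ++ S j else S j)
      ((ks.length + 2) * l.length + 1) :=
  evalLe_transfer_aux (rest := []) hks (by simp) (.inl ⟨rfl, rfl⟩) (by simpa using hS)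

theorem evalLe_transfer_field {k : K₀} {ks : List K₀} (hks : (k :: ks).Nodup)
    {u : List Bool} {rest : List (Option Bool)} (hS : S k = u.map some ++ none :: rest) :
    EvalLe sub (transfer k true ks) S
      (fun j => if j = k then rest else if j ∈ ks then u.reverse.map some ++ S j else S j)
      ((ks.length + 2) * u.length + 1) := by
  have := evalLe_transfer_aux (sub := sub) (sep := true) (rest := none :: rest)
    (l := u.map some) hks (fun a ha => by
      obtain ⟨b, -, rfl⟩ := List.mem_map.1 ha; rfl) (.inr ⟨rfl, rfl⟩) hS
  simpa using this

end EvalLe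

theorem encFields_cons (u : List Bool) (w : List (List Bool)) :
    encFields (u :: w) = u.map some ++ none :: encFields w := by
  simp [encFields]

theorem encFields_append (w w' : List (List Bool)) :
    encFields (w ++ w') = encFields w ++ encFields w' := by
  simp [encFields]

section Three

variable {ι : Type} [DecidableEq ι] {sub : ι → Sub}

theorem single_zero (w : List (Option Bool)) : single (0 : Fin 3) w = ![w, [], []] := by
  funext j; fin_cases j <;> simp [single]

theorem single_one (w : List (Option Bool)) : single (1 : Fin 3) w = ![[], w, []] := by
  funext j; fin_cases j <;> simp [single]

theorem evalLe_call0 {i : ι} {w w' b c : List (Option Bool)} {T : ℕ}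
    (h : ∃ n ≤ T, SubRuns (sub i) w w' n) :
    EvalLe sub (.call i (0 : Fin 3)) ![w, b, c] ![w', b, c]
      (T + 2 * w.length + 2 * w'.length + 4) := by
  refine (evalLe_call (S := ![w, b, c]) (k := 0) rfl h).of_eq ?_ le_rfl
  funext j; fin_cases j <;> simp

theorem evalLe_call1 {i : ι} {w w' a c : List (Option Bool)} {T : ℕ}
    (h : ∃ n ≤ T, SubRuns (sub i) w w' n) :
    EvalLe sub (.call i (1 : Fin 3)) ![a, w, c] ![a, w', c]
      (T + 2 * w.length + 2 * w'.length + 4) := by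
  refine (evalLe_call (S := ![a, w, c]) (k := 1) rfl h).of_eq ?_ le_rfl
  funext j; fin_cases j <;> simp

theorem evalLe_push0 (s : Option Bool) {a b c : List (Option Bool)} :
    EvalLe sub (.push (0 : Fin 3) s) ![a, b, c] ![s :: a, b, c] 1 := by
  refine (evalLe_push (S := ![a, b, c]) (0 : Fin 3) s).of_eq
    ?_ (by simp)
  funext j; fin_cases j <;> simp

theorem evalLe_pop0 {p : Option (Option Bool) → Prog ι (Fin 3)} {s : Option Bool}
    {a b c : List (Option Bool)} {S' : Fin 3 → List (Option Bool)} {T : ℕ}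
    (h : EvalLe sub (p (some s)) ![a, b, c] S' T) :
    EvalLe sub (.pop 0 p) ![s :: a, b, c] S' (1 + T) := by
  refine evalLe_pop ?_
  rw [show update ![s :: a, b, c] (0 : Fin 3) (![s :: a, b, c] 0).tail = ![a, b, c] by
    funext j; fin_cases j <;> simp]
  exact h

theorem evalLe_push1 (s : Option Bool) {a b c : List (Option Bool)} :
    EvalLe sub (.push (1 : Fin 3) s) ![a, b, c] ![a, s :: b, c] 1 := by
  refine (evalLe_push (S := ![a, b, c]) (1 : Fin 3) s).of_eq
    ?_ (by simp)
  funext j; fin_cases j <;> simp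

theorem evalLe_clear0 {a b c : List (Option Bool)} :
    EvalLe sub (transfer (0 : Fin 3) false []) ![a, b, c] ![[], b, c] (2 * a.length + 1) := by
  refine (evalLe_transfer_all (sub := sub) (S := ![a, b, c]) (k := 0) (ks := []) (by simp) rfl).of_eq
    ?_ (by simp)
  funext j; fin_cases j <;> simp

theorem evalLe_move10 {a b c : List (Option Bool)} :
    EvalLe sub (transfer (1 : Fin 3) false [0]) ![a, b, c] ![b.reverse ++ a, [], c]
      (3 * b.length + 1) := by
  refine (evalLe_transfer_all (sub := sub) (S := ![a, b, c]) (k := 1) (ks := [0]) (by simp) rfl).of_eq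
    ?_ (by simp)
  funext j; fin_cases j <;> simp

theorem evalLe_move02 {a b c : List (Option Bool)} :
    EvalLe sub (transfer (0 : Fin 3) false [2]) ![a, b, c] ![[], b, a.reverse ++ c]
      (3 * a.length + 1) := by
  refine (evalLe_transfer_all (sub := sub) (S := ![a, b, c]) (k := 0) (ks := [2]) (by simp) rfl).of_eq
    ?_ (by simp)
  funext j; fin_cases j <;> simp

theorem evalLe_move12 {a b c : List (Option Bool)} :
    EvalLe sub (transfer (1 : Fin 3) false [2]) ![a, b, c] ![a, [], b.reverse ++ c]
      (3 * b.length + 1) := by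
  refine (evalLe_transfer_all (sub := sub) (S := ![a, b, c]) (k := 1) (ks := [2]) (by simp) rfl).of_eq
    ?_ (by simp)
  funext j; fin_cases j <;> simp

theorem evalLe_move21 {a b c : List (Option Bool)} :
    EvalLe sub (transfer (2 : Fin 3) false [1]) ![a, b, c] ![a, c.reverse ++ b, []]
      (3 * c.length + 1) := by
  refine (evalLe_transfer_all (sub := sub) (S := ![a, b, c]) (k := 2) (ks := [1]) (by simp) rfl).of_eq
    ?_ (by simp)
  funext j; fin_cases j <;> simp

theorem evalLe_move201 {a b c : List (Option Bool)} :
    EvalLe sub (transfer (2 : Fin 3) false [0, 1]) ![a, b, c]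
      ![c.reverse ++ a, c.reverse ++ b, []] (4 * c.length + 1) := by
  refine (evalLe_transfer_all (sub := sub) (S := ![a, b, c]) (k := 2) (ks := [0, 1]) (by simp) rfl).of_eq
    ?_ (by simp)
  funext j; fin_cases j <;> simp

theorem evalLe_field0 {u : List Bool} {a b c : List (Option Bool)} :
    EvalLe sub (transfer (0 : Fin 3) true []) ![u.map some ++ none :: a, b, c] ![a, b, c]
      (2 * u.length + 1) := by
  refine (evalLe_transfer_field (sub := sub) (S := ![u.map some ++ none :: a, b, c]) (k := 0) (ks := []) (by simp) rfl).of_eq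
    ?_ (by simp)
  funext j; fin_cases j <;> simp

theorem evalLe_field01 {u : List Bool} {a b c : List (Option Bool)} :
    EvalLe sub (transfer (0 : Fin 3) true [1]) ![u.map some ++ none :: a, b, c]
      ![a, u.reverse.map some ++ b, c] (3 * u.length + 1) := by
  refine (evalLe_transfer_field (sub := sub) (S := ![u.map some ++ none :: a, b, c]) (k := 0) (ks := [1]) (by simp) rfl).of_eq
    ?_ (by simp)
  funext j; fin_cases j <;> simp

/-- Move `n` fields from the first to the second stack. -/
def moveFields : ℕ → Prog ι (Fin 3)
  | 0 => .skip
  | n + 1 => .seq (transfer 0 true [1]) (.seq (.push 1 none) (moveFields n))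

theorem evalLe_moveFields (fs : List (List Bool)) {a b c : List (Option Bool)} :
    EvalLe sub (moveFields fs.length) ![encFields fs ++ a, b, c]
      ![a, (encFields fs).reverse ++ b, c] (3 * (encFields fs).length + 1) := by
  induction fs generalizing b with
  | nil => simpa [encFields, moveFields] using evalLe_skip
  | cons u fs ih =>
    have h1 := evalLe_field01 (sub := sub) (u := u) (a := encFields fs ++ a) (b := b) (c := c)
    have h2 := evalLe_push1 (sub := sub) none (a := encFields fs ++ a)
      (b := u.reverse.map some ++ b) (c := c)
    have h3 := h1.seq (h2.seq (ih (b := none :: (u.reverse.map some ++ b))))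
    refine EvalLe.mono (by simpa [encFields_cons, moveFields] using h3) ?_
    simp only [encFields_cons, List.length_append, List.length_map, List.length_cons]
    omega

/-- Drop `n` fields from the first stack. -/
def dropFields : ℕ → Prog ι (Fin 3)
  | 0 => .skip
  | n + 1 => .seq (transfer 0 true []) (dropFields n)

theorem evalLe_dropFields (n : ℕ) (w : List (List Bool)) {b c : List (Option Bool)} :
    EvalLe sub (dropFields n) ![encFields w, b, c] ![encFields (w.drop n), b, c]
      (2 * (encFields w).length + n + 1) := by
  induction n generalizing w with
  | zero => simpa [dropFields] using evalLe_skip.mono (by omega)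
  | succ n ih =>
    cases w with
    | nil =>
      have h1 := evalLe_clear0 (sub := sub) (a := []) (b := b) (c := c)
      -- On an empty stack the loop ends at once, so dropping more fields than there are does no
      -- harm.
      have h1' : EvalLe sub (transfer (0 : Fin 3) true []) ![[], b, c] ![[], b, c] 1 :=
        ⟨1, le_rfl, .loop_nil rfl⟩
      have h2 := h1'.seq (ih [])
      refine EvalLe.mono (by simpa [encFields, dropFields] using h2) ?_
      simp [encFields]; omega
    | cons u w =>
      have h2 := (evalLe_field0 (sub := sub) (u := u) (a := encFields w) (b := b) (c := c)).seq
        (ih w)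
      refine EvalLe.mono (by simpa [encFields_cons, dropFields] using h2) ?_
      simp only [encFields_cons, List.length_append, List.length_map, List.length_cons]
      omega

end Three

/-! ### Closure properties of polynomial time -/

section Closure

variable {α β γ δ : Type} {ea : α → List (Option Bool)} {eb : β → List (Option Bool)}
  {ec : γ → List (Option Bool)} {ed : δ → List (Option Bool)}

/-- The family of subroutines of a program without subroutines. -/
def noSub : Empty → Sub := Empty.elim

/-- A function that does not change the encoding. -/
theorem PolyTimeEnc.recode {f : α → β} (h : ∀ a, eb (f a) = ea a) : PolyTimeEnc ea eb f := by
  refine polyTimeEnc_of_prog (sub := noSub) .skip (0 : Fin 3) 0 1 fun a => ?_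
  rw [h]
  simpa using evalLe_skip

/-- The second machine runs on an input of length at most `T₁`, hence the composition of polynomials
in the time bound. -/
theorem PolyTimeEnc.comp {f : α → β} {g : β → γ} (hg : PolyTimeEnc eb ec g)
    (hf : PolyTimeEnc ea eb f) : PolyTimeEnc ea ec (fun a => g (f a)) := by
  obtain ⟨s₁, T₁, h₁⟩ := hf.exists_sub
  obtain ⟨s₂, T₂, h₂⟩ := hg.exists_sub
  refine polyTimeEnc_of_prog (sub := fun b : Bool => cond b s₂ s₁)
    (.seq (.call false 0) (.call true 0)) (0 : Fin 3) 0
    (T₁ + 2 * .X + 4 * T₁ + 8 + 3 * T₂.comp T₁) fun a => ?_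
  simp only [single_zero]
  have e := (evalLe_call0 (sub := fun b : Bool => cond b s₂ s₁) (i := false) (b := []) (c := [])
    (h₁ a).1).seq (evalLe_call0 (i := true) (h₂ (f a)).1)
  refine e.mono ?_
  have h3 := (h₁ a).2
  have h4 := (h₂ (f a)).2
  have h5 := monotone_eval T₂ h3
  simp only [Polynomial.eval_add, Polynomial.eval_mul, Polynomial.eval_X, Polynomial.eval_comp,
    Polynomial.eval_ofNat] at *
  omega

/-- The input is duplicated by way of the third stack, each copy is handed to one subroutine, and
the first result is moved on top of the second, again by way of the third stack to keep its order.
-/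
theorem PolyTimeEnc.append {f : α → β} {g : α → γ} {h : α → δ} (hf : PolyTimeEnc ea eb f)
    (hg : PolyTimeEnc ea ec g) (hh : ∀ a, ed (h a) = eb (f a) ++ ec (g a)) :
    PolyTimeEnc ea ed h := by
  obtain ⟨s₁, T₁, h₁⟩ := hf.exists_sub
  obtain ⟨s₂, T₂, h₂⟩ := hg.exists_sub
  refine polyTimeEnc_of_prog (sub := fun b : Bool => cond b s₂ s₁)
    (.seq (transfer 0 false [2]) (.seq (transfer 2 false [0, 1])
      (.seq (.call false 0) (.seq (.call true 1) (.seq (transfer 0 false [2])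
        (transfer 2 false [1])))))) (0 : Fin 3) 1
    (11 * .X + 9 * T₁ + 3 * T₂ + 12) fun a => ?_
  simp only [single_zero, single_one, hh]
  have e := ((evalLe_move02 (sub := fun b : Bool => cond b s₂ s₁) (a := ea a) (b := [])
    (c := [])).seq (evalLe_move201.seq ((evalLe_call0 (i := false) (by
      simpa using (h₁ a).1)).seq ((evalLe_call1 (i := true) (by
      simpa using (h₂ a).1)).seq (evalLe_move02.seq evalLe_move21)))))
  simp only [List.append_nil, List.reverse_reverse] at e
  refine e.mono ?_
  have h3 := (h₁ a).2
  have h4 := (h₂ a).2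
  simp only [Polynomial.eval_add, Polynomial.eval_mul, Polynomial.eval_X, List.length_reverse,
    Polynomial.eval_ofNat] at *
  omega

theorem PolyTimeEnc.cons {f : α → β} (s : Option Bool) (h : ∀ a, eb (f a) = s :: ea a) :
    PolyTimeEnc ea eb f := by
  refine polyTimeEnc_of_prog (sub := noSub) (.push 0 s) (0 : Fin 3) 0 1 fun a => ?_
  simp only [single_zero, h]
  simpa using evalLe_push0 s

theorem PolyTimeEnc.empty {f : α → β} (h : ∀ a, eb (f a) = []) : PolyTimeEnc ea eb f := by
  refine polyTimeEnc_of_prog (sub := noSub) (transfer 0 false []) (0 : Fin 3) 0 (2 * .X + 1)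
    fun a => ?_
  simp only [single_zero, h]
  exact evalLe_clear0.mono (by simp)

theorem PolyTimeEnc.const (b : β) : PolyTimeEnc ea eb (fun _ => b) := by
  -- A fixed word is written by emptying the stack and pushing its symbols one at a time.
  suffices h : ∀ w : List (Option Bool), PolyTimeEnc ea (fun _ : Unit => w) (fun _ => ()) from
    (PolyTimeEnc.recode (f := fun _ : Unit => b) fun _ => rfl).comp (h (eb b))
  intro w
  induction w with
  | nil => exact .empty fun _ => rfl
  | cons s w ih => exact (PolyTimeEnc.cons (f := fun _ : Unit => ()) s fun _ => rfl).comp ih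

theorem PolyTimeEnc.take {f : α → β} (n : ℕ) (h : ∀ a, ∃ fs rest, fs.length = n ∧
    ea a = encFields fs ++ rest ∧ eb (f a) = encFields fs) : PolyTimeEnc ea eb f := by
  refine polyTimeEnc_of_prog (sub := noSub)
    (.seq (moveFields n) (.seq (transfer 0 false []) (transfer 1 false [0]))) (0 : Fin 3) 0
    (8 * .X + 3) fun a => ?_
  obtain ⟨fs, rest, rfl, h1, h2⟩ := h a
  simp only [single_zero, h1, h2]
  have e := (evalLe_moveFields (sub := noSub) fs (a := rest) (b := []) (c := [])).seq
    (evalLe_clear0.seq evalLe_move10)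
  simp only [List.append_nil, List.reverse_reverse] at e
  refine e.mono ?_
  simp only [Polynomial.eval_add, Polynomial.eval_mul, Polynomial.eval_X, List.length_reverse,
    Polynomial.eval_ofNat, List.length_append] at *
  omega

theorem PolyTimeEnc.drop {f : α → β} (n : ℕ) (h : ∀ a, ∃ fs, ea a = encFields fs ∧
    eb (f a) = encFields (fs.drop n)) : PolyTimeEnc ea eb f := by
  refine polyTimeEnc_of_prog (sub := noSub) (dropFields n) (0 : Fin 3) 0
    (2 * .X + .C n + 1) fun a => ?_
  obtain ⟨fs, h1, h2⟩ := h a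
  simp only [single_zero, h1, h2]
  exact (evalLe_dropFields n fs).mono (by simp)

/-- Reading a field of a tuple, which is empty if there is no such field. -/
theorem PolyTimeEnc.getD {f : α → β} (n : ℕ) (h : ∀ a, ∃ fs, ea a = encFields fs ∧
    eb (f a) = encFields [fs.getD n []]) : PolyTimeEnc ea eb f := by
  refine polyTimeEnc_of_prog (sub := noSub)
    (.seq (dropFields n) (.seq (transfer 0 true [1]) (.seq (transfer 0 false [])
      (.seq (.push 0 none) (transfer 1 false [0]))))) (0 : Fin 3) 0
    (10 * .X + .C n + 5) fun a => ?_
  obtain ⟨fs, h1, h2⟩ := h a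
  simp only [single_zero, h1, h2]
  have hlen : ∀ (n : ℕ) (fs : List (List Bool)),
      (encFields (fs.drop n)).length ≤ (encFields fs).length := fun n fs => by
    conv_rhs => rw [← List.take_append_drop n fs, encFields_append]
    simp
  have e1 := evalLe_dropFields (sub := noSub) n fs (b := []) (c := [])
  have e2 : EvalLe noSub (.seq (transfer 0 true [1]) (.seq (transfer 0 false [])
      (.seq (.push 0 none) (transfer 1 false [0])))) ![encFields (fs.drop n), [], []]
      ![encFields [fs.getD n []], [], []] (8 * (encFields (fs.drop n)).length + 4) := by
    have hg : fs.getD n [] = (fs.drop n).headD [] := by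
      rw [List.getD_eq_getElem?_getD, List.headD_eq_head?_getD, List.head?_drop]
    rw [hg]
    cases hd : fs.drop n with
    | nil =>
      have h1' : EvalLe noSub (transfer (0 : Fin 3) true [1]) ![[], [], []] ![[], [], []] 1 :=
        ⟨1, le_rfl, .loop_nil rfl⟩
      have := h1'.seq (evalLe_clear0.seq ((evalLe_push0 none).seq evalLe_move10))
      simpa [encFields] using this
    | cons u w =>
      have := (evalLe_field01 (sub := noSub) (u := u) (a := encFields w) (b := []) (c := [])).seq
        (evalLe_clear0.seq ((evalLe_push0 none).seq evalLe_move10))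
      refine EvalLe.mono (by simpa [encFields] using this) ?_
      simp [encFields]; omega
  refine (e1.seq e2).mono ?_
  have := hlen n fs
  simp only [Polynomial.eval_add, Polynomial.eval_mul, Polynomial.eval_X, Polynomial.eval_C,
    Polynomial.eval_ofNat] at *
  omega

theorem PolyTimeEnc.cond {f g : α → β} {c : δ → Bool} {d : δ → α} (hf : PolyTimeEnc ea eb f)
    (hg : PolyTimeEnc ea eb g) (h : ∀ x, ed x = some (c x) :: none :: ea (d x)) :
    PolyTimeEnc ed eb (fun x => bif c x then f (d x) else g (d x)) := by
  obtain ⟨s₁, T₁, h₁⟩ := hf.exists_sub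
  obtain ⟨s₂, T₂, h₂⟩ := hg.exists_sub
  refine polyTimeEnc_of_prog (sub := fun b : Bool => Bool.rec s₂ s₁ b)
    (.pop 0 fun a => .pop 0 fun _ => .call (decide (a = some (some true))) 0) (0 : Fin 3) 0
    (2 * .X + 3 * T₁ + 3 * T₂ + 6) fun x => ?_
  simp only [single_zero, h]
  have key : EvalLe (fun b : Bool => Bool.rec s₂ s₁ b)
      (.call (decide (some (some (c x)) = some (some true))) (0 : Fin 3)) ![ea (d x), [], []]
      ![eb (bif c x then f (d x) else g (d x)), [], []] (3 * T₁.eval (ea (d x)).length +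
        3 * T₂.eval (ea (d x)).length + 2 * (ea (d x)).length + 4) := by
    cases c x
    · refine (evalLe_call0 (sub := fun b : Bool => Bool.rec s₂ s₁ b) (i := false)
        (h₂ (d x)).1).of_eq rfl ?_
      have := (h₂ (d x)).2
      omega
    · refine (evalLe_call0 (sub := fun b : Bool => Bool.rec s₂ s₁ b) (i := true)
        (h₁ (d x)).1).of_eq rfl ?_
      have := (h₁ (d x)).2
      omega
  have e := evalLe_pop0 (p := fun a => .pop 0 fun _ => .call (decide (a = some (some true))) 0)
    (evalLe_pop0 (p := fun _ => .call (decide (some (some (c x)) = some (some true))) 0)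
      (s := none) key)
  refine e.mono ?_
  have m1 := monotone_eval T₁ (show (ea (d x)).length ≤ (ea (d x)).length + 1 + 1 by omega)
  have m2 := monotone_eval T₂ (show (ea (d x)).length ≤ (ea (d x)).length + 1 + 1 by omega)
  simp only [Polynomial.eval_add, Polynomial.eval_mul, Polynomial.eval_X, Polynomial.eval_ofNat,
    List.length_cons] at *
  omega

theorem evalLe_foldl_loop {sub : Option Bool → Sub} {G : Bool → β → β} {B T : ℕ}
    (hG : ∀ b s, (eb s).length ≤ B → ∃ n ≤ T, SubRuns (sub (some b)) (eb s) (eb (G b s)) n)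
    (l : List Bool) (s : β)
    (hB : ∀ pre, pre <+: l → (eb (pre.foldl (fun s b => G b s) s)).length ≤ B) :
    EvalLe sub (.loop (2 : Fin 3) (fun _ => true) fun a => .call (some (decide (a = some true))) 0)
      ![eb s, [], l.map some] ![eb (l.foldl (fun s b => G b s) s), [], []]
      (l.length * (T + 4 * B + 5) + 1) := by
  induction l generalizing s with
  | nil => exact ⟨1, by simp, .loop_nil rfl⟩
  | cons b l ih =>
    obtain ⟨t', ht', h'⟩ := ih (G b s) fun pre hpre => hB (b :: pre) (by simpa using hpre)
    have hs : (eb s).length ≤ B := hB [] (by simp)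
    have hs' : (eb (G b s)).length ≤ B := hB [b] (by simp)
    obtain ⟨t, ht, h⟩ := evalLe_call0 (sub := sub) (b := []) (c := l.map some) (hG b s hs)
    have hb : decide (some b = some true) = b := by cases b <;> rfl
    refine ⟨1 + t + t', ?_, ?_⟩
    · rw [List.length_cons, Nat.succ_mul]; omega
    · refine Eval.loop_cons (a := some b) (l := l.map some) rfl rfl ?_ h'
      rw [hb]
      convert h using 1
      funext j; fin_cases j <;> simp

/-- The string is put on the third stack, and each of its symbols triggers a call of the subroutine
for that symbol on the current state. Iterating a polynomial time function may blow up the state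
exponentially, so a bound on all intermediate states has to be supplied. -/
theorem PolyTimeEnc.foldl {prep : α → δ} {l : α → List Bool} {s : α → β} {G : Bool → β → β}
    (hprep : PolyTimeEnc ea ed prep)
    (hd : ∀ a, ed (prep a) = (l a).map some ++ none :: eb (s a))
    (hG : ∀ b, PolyTimeEnc eb eb (G b))
    (hB : ∃ Q : Polynomial ℕ, ∀ a pre, pre <+: l a →
      (eb (pre.foldl (fun s b => G b s) (s a))).length ≤ Q.eval (ea a).length) :
    PolyTimeEnc ea eb (fun a => (l a).foldl (fun s b => G b s) (s a)) := by
  obtain ⟨s₀, T₀, h₀⟩ := hprep.exists_sub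
  obtain ⟨s₁, T₁, h₁⟩ := (hG false).exists_sub
  obtain ⟨s₂, T₂, h₂⟩ := (hG true).exists_sub
  obtain ⟨Q, hQ⟩ := hB
  refine polyTimeEnc_of_prog (sub := fun b : Option Bool => b.elim s₀ fun b => Bool.rec s₁ s₂ b)
    (.seq (.call none 0) (.seq (transfer 0 true [1]) (.seq (transfer 1 false [2])
      (.loop 2 (fun _ => true) fun a => .call (some (decide (a = some true))) 0)))) (0 : Fin 3) 0
    (9 * T₀ + 2 * .X + 7 + T₀ * (T₁.comp Q + T₂.comp Q + 4 * Q + 5)) fun a => ?_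
  simp only [single_zero]
  have e1 := evalLe_call0 (sub := fun b : Option Bool => b.elim s₀ fun b => Bool.rec s₁ s₂ b)
    (i := none) (b := []) (c := []) (h₀ a).1
  have e2 := evalLe_foldl_loop (eb := eb) (G := G) (T := (T₁.comp Q + T₂.comp Q).eval (ea a).length)
    (sub := fun b : Option Bool => b.elim s₀ fun b => Bool.rec s₁ s₂ b)
    (B := Q.eval (ea a).length) (fun b s hs => by
      simp only [Polynomial.eval_add, Polynomial.eval_comp]
      cases b
      · obtain ⟨n, hn, hr⟩ := (h₁ s).1
        exact ⟨n, le_add_right (hn.trans (monotone_eval T₁ hs)), hr⟩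
      · obtain ⟨n, hn, hr⟩ := (h₂ s).1
        exact ⟨n, le_add_left (hn.trans (monotone_eval T₂ hs)), hr⟩) (l a) (s a) (hQ a)
  have e3 := evalLe_field01 (sub := fun b : Option Bool => b.elim s₀ fun b => Bool.rec s₁ s₂ b)
    (u := l a) (a := eb (s a)) (b := []) (c := [])
  have hlen := (h₀ a).2
  rw [hd] at e1 hlen
  have e := e1.seq (e3.seq (evalLe_move12.seq (by simpa using e2)))
  refine e.mono ?_
  simp only [Polynomial.eval_add, Polynomial.eval_mul, Polynomial.eval_X, Polynomial.eval_ofNat,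
    List.length_cons, List.length_append, List.length_map, List.length_reverse,
    Polynomial.eval_comp, List.length_nil] at *
  have := Nat.mul_le_mul_right ((T₁.eval (Q.eval (ea a).length) +
    T₂.eval (Q.eval (ea a).length) + 4 * Q.eval (ea a).length + 5)) (show (l a).length ≤ _ from
      (by omega : (l a).length ≤ T₀.eval (ea a).length))
  omega

end Closure

end StackProg

/-! ## Polynomial time functions on tuples -/

/-- Types whose elements are written as tuples of bit strings of a fixed length. -/
class Enc (α : Type) where
  /-- the bit strings -/
  enc : α → List (List Bool)
  /-- their number -/
  arity : ℕ
  length_enc : ∀ a, (enc a).length = arity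

namespace Enc

instance : Enc (List Bool) := ⟨fun l => [l], 1, fun _ => rfl⟩

instance : Enc Bool := ⟨fun b => [[b]], 1, fun _ => rfl⟩

instance {α β : Type} [Enc α] [Enc β] : Enc (α × β) :=
  ⟨fun p => enc p.1 ++ enc p.2, arity α + arity β, fun p => by simp [length_enc]⟩

/-- The word over `{0, 1, #}` that represents an element. -/
def word {α : Type} [Enc α] (a : α) : List (Option Bool) := encFields (enc a)

/-- The length of the representation of an element. -/
def size {α : Type} [Enc α] (a : α) : ℕ := (word a).length

variable {α β : Type} [Enc α] [Enc β]

theorem word_list (l : List Bool) : word l = l.map some ++ [none] := by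
  simp [word, enc, encFields]

theorem word_bool (b : Bool) : word b = [some b, none] := by
  simp [word, enc, encFields]

theorem word_pair (p : α × β) : word p = word p.1 ++ word p.2 := by
  simp [word, enc, StackProg.encFields_append]

@[simp] theorem size_list (l : List Bool) : size l = l.length + 1 := by simp [size, word_list]

@[simp] theorem size_bool (b : Bool) : size b = 2 := by simp [size, word_bool]

@[simp] theorem size_pair (a : α) (b : β) : size (a, b) = size a + size b := by
  simp [size, word_pair]

theorem size_prod (p : α × β) : size p = size p.1 + size p.2 := size_pair p.1 p.2

end Enc

open Enc in
/-- Functions computed in polynomial time. -/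
def PT {α β : Type} [Enc α] [Enc β] (f : α → β) : Prop :=
  StackProg.PolyTimeEnc (word : α → _) (word : β → _) f

namespace PT

open Enc StackProg

variable {α β γ δ : Type} [Enc α] [Enc β] [Enc γ] [Enc δ]

theorem size_le {f : α → β} (hf : PT f) :
    ∃ Q : Polynomial ℕ, ∀ a, size (f a) ≤ Q.eval (size a) := by
  obtain ⟨_, T, h⟩ := hf.exists_sub
  exact ⟨T, fun a => (h a).2⟩

theorem id : PT (fun a : α => a) := PolyTimeEnc.recode fun _ => rfl

theorem const (b : β) : PT (fun _ : α => b) := PolyTimeEnc.const b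

theorem comp {g : β → γ} {f : α → β} (hg : PT g) (hf : PT f) : PT (fun a => g (f a)) :=
  PolyTimeEnc.comp hg hf

theorem pair {f : α → β} {g : α → γ} (hf : PT f) (hg : PT g) : PT (fun a => (f a, g a)) :=
  PolyTimeEnc.append hf hg fun _ => word_pair _

theorem fst {f : α → β × γ} (hf : PT f) : PT (fun a => (f a).1) :=
  comp (PolyTimeEnc.take (arity β) fun p => ⟨enc p.1, word p.2, length_enc _, word_pair p, rfl⟩ :
    PT (fun p : β × γ => p.1)) hf

theorem snd {f : α → β × γ} (hf : PT f) : PT (fun a => (f a).2) :=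
  comp (PolyTimeEnc.drop (arity β) fun p => ⟨enc p.1 ++ enc p.2, rfl, by
    rw [← length_enc p.1, List.drop_left]; rfl⟩ : PT (fun p : β × γ => p.2)) hf

theorem congr {f g : α → β} (hf : PT f) (h : ∀ a, g a = f a) : PT g :=
  (funext h : g = f) ▸ hf

theorem cond {c : α → Bool} {f g : α → β} (hc : PT c) (hf : PT f) (hg : PT g) :
    PT (fun a => bif c a then f a else g a) :=
  comp (PolyTimeEnc.cond (c := Prod.fst) (d := Prod.snd) hf hg (fun p => by
    rw [word_pair, word_bool]; rfl) : PT (fun p : Bool × α => bif p.1 then f p.2 else g p.2))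
    (pair hc id)

theorem not {c : α → Bool} (hc : PT c) : PT (fun a => !c a) :=
  (cond hc (const false) (const true)).congr fun a => by cases c a <;> rfl

theorem and {c d : α → Bool} (hc : PT c) (hd : PT d) : PT (fun a => c a && d a) :=
  (cond hc hd (const false)).congr fun a => by cases c a <;> rfl

theorem or {c d : α → Bool} (hc : PT c) (hd : PT d) : PT (fun a => c a || d a) :=
  (cond hc (const true) hd).congr fun a => by cases c a <;> rfl

theorem xor {c d : α → Bool} (hc : PT c) (hd : PT d) : PT (fun a => Bool.xor (c a) (d a)) :=
  (cond hc hd.not hd).congr fun a => by cases c a <;> simp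

theorem cons {c : α → Bool} {l : α → List Bool} (hc : PT c) (hl : PT l) :
    PT (fun a => c a :: l a) := by
  have h : ∀ b, PT (fun a => b :: l a) := fun b =>
    comp (PolyTimeEnc.cons (some b) fun u => by simp [word_list] :
      PT (fun u : List Bool => b :: u)) hl
  exact (cond hc (h true) (h false)).congr fun a => by cases c a <;> rfl

/-- The output of an algorithm on tuples of bit strings, restricted to one field. -/
theorem alg {f : List (List Bool) → List (List Bool)} (hf : PolyTime f) (k : ℕ) :
    PT (fun a : α => (f (enc a)).getD k []) := by
  have h1 : PolyTimeEnc (word : α → _) encFields enc := .recode fun _ => rfl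
  have h2 : PolyTimeEnc encFields (word : List Bool → _) fun w => w.getD k [] :=
    .getD k fun w => ⟨w, rfl, rfl⟩
  exact h2.comp (PolyTimeEnc.comp hf h1)

/-- The parameter `a` travels along as part of the state. Growth by an additive amount that depends
on `a` only keeps all intermediate states polynomial; this criterion is used for all loops below. -/
theorem foldl {l : α → List Bool} {s : α → β} {G : α → Bool → β → β} (hl : PT l) (hs : PT s)
    (hG : ∀ b, PT fun p : α × β => G p.1 b p.2)
    (hB : ∃ Q : Polynomial ℕ, ∀ a b t, size (G a b t) ≤ size t + Q.eval (size a)) :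
    PT (fun a => (l a).foldl (fun t b => G a b t) (s a)) := by
  have key : ∀ a (u : List Bool) t, u.foldl (fun (p : α × β) b => (p.1, G p.1 b p.2)) (a, t) =
      (a, u.foldl (fun t b => G a b t) t) := by
    intro a u
    induction u with
    | nil => intro t; rfl
    | cons b u ih => intro t; exact ih _
  obtain ⟨Q, hQ⟩ := hB
  obtain ⟨L, hL⟩ := hl.size_le
  obtain ⟨S, hS⟩ := hs.size_le
  have hgrow : ∀ a (u : List Bool) t,
      size (u.foldl (fun t b => G a b t) t) ≤ size t + u.length * Q.eval (size a) := by
    intro a u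
    induction u with
    | nil => intro t; simp
    | cons b u ih =>
      intro t
      refine (ih _).trans ?_
      have := hQ a b t
      dsimp only
      rw [List.length_cons, Nat.succ_mul]
      omega
  have h := PolyTimeEnc.foldl (prep := fun a => (l a, (a, s a))) (l := l)
    (ea := word) (eb := word) (ed := word)
    (s := fun a => (a, s a)) (G := fun b (p : α × β) => (p.1, G p.1 b p.2))
    (pair hl (pair id hs)) (fun a => by rw [word_pair, word_list]; simp)
    (fun b => pair (fst id) (hG b)) ⟨.X + S + L * Q, fun a pre hpre => ?_⟩
  · exact (snd h).congr fun a => by rw [key]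
  · rw [key]
    change size (_, _) ≤ _
    rw [size_pair]
    have h1 := hgrow a pre (s a)
    have h2 := hS a
    have h3 := hL a
    have h4 : pre.length ≤ L.eval (size a) := by
      have := hpre.length_le
      rw [size_list] at h3
      omega
    have h5 := Nat.mul_le_mul_right (Q.eval (size a)) h4
    change _ ≤ Polynomial.eval (size a) _
    simp only [Polynomial.eval_add, Polynomial.eval_mul, Polynomial.eval_X]
    omega

theorem reverse {l : α → List Bool} (hl : PT l) : PT (fun a => (l a).reverse) := by
  refine comp (f := l) (g := List.reverse) ?_ hl
  refine (foldl (s := fun _ => []) (G := fun _ b t => b :: t) id (const [])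
    (fun b => cons (const b) (snd id)) ⟨1, fun a b t => by simp⟩).congr fun l => ?_
  have : ∀ t : List Bool, l.foldl (fun t b => b :: t) t = l.reverse ++ t := by
    induction l with
    | nil => simp
    | cons b l ih => simp [ih]
  simp [this]

theorem foldr {l : α → List Bool} {s : α → β} {G : α → Bool → β → β} (hl : PT l) (hs : PT s)
    (hG : ∀ b, PT fun p : α × β => G p.1 b p.2)
    (hB : ∃ Q : Polynomial ℕ, ∀ a b t, size (G a b t) ≤ size t + Q.eval (size a)) :
    PT (fun a => (l a).foldr (fun b t => G a b t) (s a)) :=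
  (foldl hl.reverse hs hG hB).congr fun a => by rw [List.foldl_reverse]

theorem append {l l' : α → List Bool} (hl : PT l) (hl' : PT l') : PT (fun a => l a ++ l' a) :=
  (foldr (G := fun _ b t => b :: t) hl hl' (fun b => cons (const b) (snd id))
    ⟨1, fun a b t => by simp⟩).congr fun a => by
      induction l a with
      | nil => rfl
      | cons b l ih => rw [List.foldr_cons, ← ih, List.cons_append]

theorem isEmpty {l : α → List Bool} (hl : PT l) : PT (fun a => (l a).isEmpty) := by
  refine (foldr (s := fun _ => true) (G := fun _ _ _ => false) hl (const true)
    (fun b => const false) ⟨0, fun a b t => by simp⟩).congr fun a => ?_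
  cases l a <;> rfl

theorem headD {l : α → List Bool} (hl : PT l) : PT (fun a => (l a).headD false) := by
  refine (foldr (s := fun _ => false) (G := fun _ b _ => b) hl (const false)
    (fun b => const b) ⟨0, fun a b t => by simp⟩).congr fun a => ?_
  cases l a <;> rfl

theorem tail {l : α → List Bool} (hl : PT l) : PT (fun a => (l a).tail) := by
  -- The flag records whether the first symbol has been passed; the later ones are collected in
  -- reverse order.
  refine (reverse (snd (foldl (s := fun _ => (false, []))
    (G := fun _ b (t : Bool × List Bool) => (true, bif t.1 then b :: t.2 else t.2)) hl (const _)
    (fun b => pair (const true) (cond (fst (snd id)) (cons (const b) (snd (snd id)))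
      (snd (snd id)))) ⟨1, fun a b t => ?_⟩))).congr fun a => ?_
  · obtain ⟨c, t⟩ := t
    cases c
    · simp
    · simp; omega
  · have key : ∀ l t : List Bool, l.foldl (fun (t : Bool × List Bool) b =>
        (true, bif t.1 then b :: t.2 else t.2)) (true, t) = (true, l.reverse ++ t) := by
      intro l
      induction l with
      | nil => intro t; rfl
      | cons b l ih => intro t; simpa using ih (b :: t)
    cases l a with
    | nil => rfl
    | cons b l =>
      rw [List.foldl_cons, _root_.cond_false, key]
      simp

/-- Unary notation for the length of a string. -/
theorem unary_length {l : α → List Bool} (hl : PT l) : PT (fun a => unary (l a).length) :=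
  (foldr (s := fun _ => []) (G := fun _ _ t => true :: t) hl (const [])
    (fun b => cons (const true) (snd id)) ⟨1, fun a b t => by simp⟩).congr fun a => by
      induction l a with
      | nil => rfl
      | cons b l ih => simp [← ih, unary, List.replicate_succ]

theorem length_unary (m : ℕ) : (unary m).length = m := by simp [unary]

theorem unary_add {m n : α → ℕ} (hm : PT fun a => unary (m a)) (hn : PT fun a => unary (n a)) :
    PT (fun a => unary (m a + n a)) :=
  (append hm hn).congr fun a => by simp [unary]

theorem unary_mul {m n : α → ℕ} (hm : PT fun a => unary (m a)) (hn : PT fun a => unary (n a)) :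
    PT (fun a => unary (m a * n a)) := by
  obtain ⟨Q, hQ⟩ := hn.size_le
  refine (foldr (s := fun _ => []) (G := fun a _ t => unary (n a) ++ t) hm (const [])
    (fun b => append (comp (g := fun a => unary (n a)) hn (fst id)) (snd id)) ⟨Q, fun a b t => ?_⟩).congr fun a => ?_
  · have := hQ a
    simp only [size_list, List.length_append] at *
    omega
  · have : ∀ k, (unary k).foldr (fun _ t => unary (n a) ++ t) [] = unary (k * n a) := by
      intro k
      induction k with
      | zero => simp [unary]
      | succ k ih =>
        rw [show unary (k + 1) = true :: unary k from List.replicate_succ, List.foldr_cons, ih]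
        simp [unary, Nat.succ_mul, Nat.add_comm]
    exact (this _).symm

theorem unary_eval {m : α → ℕ} (hm : PT fun a => unary (m a)) (P : Polynomial ℕ) :
    PT (fun a => unary (P.eval (m a))) := by
  induction P using Polynomial.induction_on with
  | C c => simpa using const (unary c)
  | add p q hp hq => simpa using unary_add hp hq
  | monomial k c ih =>
    refine (unary_mul ih hm).congr fun a => ?_
    simp [pow_succ, mul_assoc]

end PT

/-! ## Algorithms on bit strings -/

namespace BitString

open Enc

/-- The number with a given binary notation, least significant bit first. -/
def val : List Bool → ℕ
  | [] => 0
  | b :: l => Nat.bit b (val l)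

theorem val_bits (n : ℕ) : val n.bits = n := by
  induction n using Nat.binaryRec' with
  | zero => rfl
  | bit b n h ih => rw [Nat.bits_append_bit _ _ h, val, ih]

theorem val_lt (l : List Bool) : val l < 2 ^ l.length := by
  induction l with
  | nil => simp [val]
  | cons b l ih => cases b <;> simp [val, Nat.bit, pow_succ] <;> omega

/-- Remove leading zeros. -/
def trim (l : List Bool) : List Bool :=
  l.foldr (fun b t => bif !b && t.isEmpty then [] else b :: t) []

/-- The access algorithms are specified on `Nat.bits` only, whereas indices read from coins have a
fixed length with leading zeros; trimming converts one into the other. -/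
theorem trim_eq (l : List Bool) : trim l = (val l).bits := by
  induction l with
  | nil => rfl
  | cons b l ih =>
    have h : trim (b :: l) = bif !b && (trim l).isEmpty then [] else b :: trim l := rfl
    rw [h, ih, val]
    rcases Nat.eq_zero_or_pos (val l) with h0 | h0
    · rw [h0]; cases b <;> rfl
    · rw [Nat.bits_append_bit _ _ (by omega)]
      have : (val l).bits ≠ [] := fun h => by
        have := val_bits (val l)
        rw [h, val] at this
        omega
      cases hb : (val l).bits with
      | nil => exact absurd hb this
      | cons c t => simp

/-- Add a carry. -/
def addCarry : Bool → List Bool → List Bool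
  | c, [] => bif c then [true] else []
  | c, b :: l => Bool.xor c b :: addCarry (c && b) l

/-- Add one to a number in binary notation. -/
def inc (l : List Bool) : List Bool := addCarry true l

theorem addCarry_false (l : List Bool) : addCarry false l = l := by
  induction l with
  | nil => rfl
  | cons b l ih => simp [addCarry, ih]

theorem inc_bits (n : ℕ) : inc n.bits = (n + 1).bits := by
  induction n using Nat.binaryRec' with
  | zero => rfl
  | bit b n h ih =>
    rw [Nat.bits_append_bit _ _ h]
    cases b
    · rw [show Nat.bit false n + 1 = Nat.bit true n by simp [Nat.bit],
        Nat.bits_append_bit _ _ (by simp)]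
      simp [inc, addCarry, addCarry_false]
    · rw [show Nat.bit true n + 1 = Nat.bit false (n + 1) by simp [Nat.bit]; ring,
        Nat.bits_append_bit _ _ (by simp), ← ih]
      simp [inc, addCarry]

theorem length_addCarry_le (c : Bool) (l : List Bool) :
    (addCarry c l).length ≤ l.length + 1 := by
  induction l generalizing c with
  | nil => cases c <;> simp [addCarry]
  | cons b l ih => simpa [addCarry] using ih _

/-- Expresses the recursion as a left fold with the carry and the reversed output as state, the form
in which it is known to be polynomial time. -/
theorem foldl_addCarry (l : List Bool) (c : Bool) (o : List Bool) :
    let r := l.foldl (fun (t : Bool × List Bool) b => (t.1 && b, Bool.xor t.1 b :: t.2)) (c, o)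
    (bif r.1 then true :: r.2 else r.2).reverse = o.reverse ++ addCarry c l := by
  induction l generalizing c o with
  | nil => cases c <;> simp [addCarry]
  | cons b l ih =>
    simp only [List.foldl_cons, addCarry]
    rw [ih]
    simp

/-- Comparison of numbers in binary notation; `u` must not be longer than `r`. -/
def ltBits (r u : List Bool) : Bool :=
  (r.foldl (fun (t : Bool × List Bool) b =>
    (bif Bool.xor b (t.2.headD false) then t.2.headD false else t.1, t.2.tail)) (false, u)).1

theorem ltBits_eq (r u : List Bool) (h : u.length ≤ r.length) :
    ltBits r u = decide (val r < val u) := by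
  -- Digits come least significant first, so each differing digit overrides the verdict reached so
  -- far. The initial verdict `c` survives exactly if the two numbers are equal.
  have key : ∀ (r u : List Bool) (c : Bool), u.length ≤ r.length →
      (r.foldl (fun (t : Bool × List Bool) b =>
        (bif Bool.xor b (t.2.headD false) then t.2.headD false else t.1, t.2.tail)) (c, u)).1 =
      decide (val r < val u ∨ (val r = val u ∧ c = true)) := by
    intro r
    induction r with
    | nil => intro u c hu; simp at hu; subst hu; cases c <;> simp [val]
    | cons b r ih =>
      intro u c hu
      rw [List.foldl_cons, ih _ _ (by simp at hu ⊢; omega)]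
      cases u with
      | nil => cases b <;> cases c <;> simp [val, Nat.bit]
      | cons b' u =>
        cases b <;> cases b' <;> cases c <;>
          simp [val, Nat.bit, -Bool.decide_or] <;> omega
  rw [ltBits, key r u false h]
  simp

/-- Split off the first `n` bits of a string, which is padded by zeros if necessary. -/
def chunk : ℕ → List Bool → List Bool × List Bool
  | 0, w => ([], w)
  | n + 1, w => (w.headD false :: (chunk n w.tail).1, (chunk n w.tail).2)

theorem length_chunk_fst (n : ℕ) (w : List Bool) : (chunk n w).1.length = n := by
  induction n generalizing w with
  | zero => rfl
  | succ n ih => simp [chunk, ih]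

theorem length_chunk_snd (n : ℕ) (w : List Bool) : (chunk n w).2.length ≤ w.length := by
  induction n generalizing w with
  | zero => simp [chunk]
  | succ n ih => exact (ih _).trans (by simp)

theorem foldl_chunk (n : ℕ) (w acc : List Bool) :
    (unary n).foldl (fun (t : List Bool × List Bool) _ => (t.2.headD false :: t.1, t.2.tail))
      (acc, w) = ((chunk n w).1.reverse ++ acc, (chunk n w).2) := by
  induction n generalizing w acc with
  | zero => rfl
  | succ n ih =>
    rw [show unary (n + 1) = true :: unary n from List.replicate_succ, List.foldl_cons, ih]
    simp [chunk]

end BitString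

namespace PT

open Enc StackProg BitString

variable {α : Type} [Enc α]

theorem trim {l : α → List Bool} (hl : PT l) : PT (fun a => trim (l a)) := by
  refine foldr (s := fun _ => []) (G := fun _ b t => bif !b && t.isEmpty then [] else b :: t) hl
    (const []) (fun b => cond (and (const _) (isEmpty (snd id))) (const [])
      (cons (const b) (snd id))) ⟨1, fun a b t => ?_⟩
  cases h : (!b && t.isEmpty) <;> simp

theorem inc {l : α → List Bool} (hl : PT l) : PT (fun a => inc (l a)) := by
  have h := foldl (s := fun _ => (true, []))
    (G := fun _ b (t : Bool × List Bool) => (t.1 && b, Bool.xor t.1 b :: t.2)) hl (const _)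
    (fun b => pair (and (fst (snd id)) (const b)) (cons (xor (fst (snd id)) (const b))
      (snd (snd id)))) ⟨1, fun a b t => by rw [size_prod t]; simp; omega⟩
  refine (reverse (cond (fst h) (cons (const true) (snd h)) (snd h))).congr fun a => ?_
  rw [foldl_addCarry]
  rfl

theorem ltBits {r u : α → List Bool} (hr : PT r) (hu : PT u) :
    PT (fun a => ltBits (r a) (u a)) :=
  fst (foldl (G := fun _ b (t : Bool × List Bool) =>
    (bif Bool.xor b (t.2.headD false) then t.2.headD false else t.1, t.2.tail)) hr
    (pair (const false) hu)
    (fun b => pair (cond (xor (const b) (headD (snd (snd id)))) (headD (snd (snd id)))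
      (fst (snd id))) (tail (snd (snd id))))
    ⟨0, fun a b t => by rw [size_prod t]; simp⟩)

theorem chunk {n : α → ℕ} {w : α → List Bool} (hn : PT fun a => unary (n a)) (hw : PT w) :
    PT (fun a => chunk (n a) (w a)) := by
  have h := foldl (G := fun _ _ (t : List Bool × List Bool) => (t.2.headD false :: t.1, t.2.tail))
    hn (pair (const []) hw)
    (fun b => pair (cons (headD (snd (snd id))) (fst (snd id))) (tail (snd (snd id))))
    ⟨1, fun a b t => by rw [size_prod t]; simp; omega⟩
  refine (pair (reverse (fst h)) (snd h)).congr fun a => ?_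
  rw [foldl_chunk]
  simp

end PT

/-! ## The random walk verifier

A walk `i_0, …, i_d` through the index set of the matrix, the powers of the matrix used, and the
comparisons of random numbers with the entries along the walk are all read off a string of coins.
The result is a *phase*: zero, or a fourth root of unity. -/

namespace WalkVerifier

open Enc BitString

/-- Phases `(alive, axis, sign)`: `0` if not `alive`, and otherwise `1`, `-1`, `i` or `-i`. -/
abbrev Phase := Bool × Bool × Bool

/-- The product of two phases. -/
def mulPhase (p q : Phase) : Phase :=
  (p.1 && q.1, Bool.xor p.2.1 q.2.1, Bool.xor (Bool.xor p.2.2 q.2.2) (p.2.1 && q.2.1))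

/-- Equality of strings of the same length. -/
def sameBits (u v : List Bool) : Bool := !ltBits u v && !ltBits v u

/-- The numerical data of an instance, given by algorithms: the number of bits of an index, the
number of steps of a walk, the precision, the length of random numbers, the entries of the matrix,
the coefficients of the polynomial and the two thresholds. -/
structure Data where
  n : List Bool → ℕ
  d : List Bool → ℕ
  m : List Bool → ℕ
  R : List Bool → ℕ
  re : List Bool → List Bool → List Bool → List Bool
  im : List Bool → List Bool → List Bool → List Bool
  coef : List Bool → List Bool → List Bool
  lo : List Bool → List Bool
  hi : List Bool → List Bool

/-- The data are computed in polynomial time. -/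
structure Data.Poly (V : Data) : Prop where
  n : PT fun x => unary (V.n x)
  d : PT fun x => unary (V.d x)
  m : PT fun x => unary (V.m x)
  R : PT fun x => unary (V.R x)
  re : PT fun p : List Bool × List Bool × List Bool => V.re p.1 p.2.1 p.2.2
  im : PT fun p : List Bool × List Bool × List Bool => V.im p.1 p.2.1 p.2.2
  coef : PT fun p : List Bool × List Bool => V.coef p.1 p.2
  lo : PT V.lo
  hi : PT V.hi

/-- The state of a walk: current index, number of uses of the matrix, whether it was used in all
steps so far, and the phase. -/
abbrev Walk := List Bool × List Bool × Bool × Phase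

variable (V : Data)

/-- The signed number that a step from `cur` to `nxt` compares with a random number. -/
def stepEntry (x cur nxt : List Bool) (use axis : Bool) : List Bool :=
  bif use then (bif axis then V.im x (trim cur) (trim nxt) else V.re x (trim cur) (trim nxt))
  -- The binary notation of `2^m`: at scale `2^m`, idling counts as the entry 1.
  else false :: ((unary (V.m x)).map (fun _ => false) ++ [true])

/-- The phase of a step. -/
def stepPhase (x cur nxt : List Bool) (use axis used : Bool) (r : List Bool) : Phase :=
  (ltBits r (stepEntry V x cur nxt use axis).tail &&
    -- The matrix may be used only if it was used in all earlier steps, so that for every `k` a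
    -- single pattern of uses has length `k`. Idling must keep the index, and the axis coin is fixed
    -- so as not to count it twice.
    (bif use then used else sameBits cur nxt && !axis), axis,
    (stepEntry V x cur nxt use axis).headD false)

/-- A step of the walk, with given coins. -/
def walkStep (x : List Bool) (s : Walk) (use axis : Bool) (nxt r : List Bool) : Walk :=
  (nxt, bif use then inc s.2.1 else s.2.1, s.2.2.1 && use,
    mulPhase s.2.2.2 (stepPhase V x s.1 nxt use axis s.2.2.1 r))

/-- A step of the walk that reads its coins from a string. -/
def readStep (x : List Bool) (t : List Bool × Walk) : List Bool × Walk :=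
  ((chunk (V.R x) (chunk (V.n x) t.1.tail.tail).2).2,
    walkStep V x t.2 (t.1.headD false) (t.1.tail.headD false) (chunk (V.n x) t.1.tail.tail).1
      (chunk (V.R x) (chunk (V.n x) t.1.tail.tail).2).1)

/-- The phase of the end of a walk from `i` to `cur`, with `cnt` uses of the matrix; `thr` tells
that a threshold takes the place of the coefficient, and `up` which one. -/
def endPhase (x : List Bool) (thr up : Bool) (i cur cnt r : List Bool) : Phase :=
  (ltBits r (bif thr then (bif up then V.hi x else V.lo x) else V.coef x cnt).tail &&
    -- Averaging over the start index divides the trace by `2^n`. Admitting only the index 0 gives a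
    -- threshold the same factor.
    (sameBits cur i && (!thr || (trim i).isEmpty)), false,
    Bool.xor thr ((bif thr then (bif up then V.hi x else V.lo x) else V.coef x cnt).headD false))

/-- The walk from `i`. -/
def walk (x w i : List Bool) (thr : Bool) : List Bool × Walk :=
  -- For a threshold the flag `used` starts as false, which kills every walk that does not idle
  -- throughout.
  (readStep V x)^[V.d x] (w, (i, [], !thr, (true, false, false)))

/-- The phase of a string of coins. -/
def phase (x w : List Bool) : Phase :=
  mulPhase (walk V x (chunk (V.n x) w.tail.tail).2 (chunk (V.n x) w.tail.tail).1
      (w.headD false)).2.2.2.2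
    (endPhase V x (w.headD false) (w.tail.headD false) (chunk (V.n x) w.tail.tail).1
      (walk V x (chunk (V.n x) w.tail.tail).2 (chunk (V.n x) w.tail.tail).1
        (w.headD false)).2.1
      (walk V x (chunk (V.n x) w.tail.tail).2 (chunk (V.n x) w.tail.tail).1
        (w.headD false)).2.2.1
      (chunk (V.R x) (walk V x (chunk (V.n x) w.tail.tail).2 (chunk (V.n x) w.tail.tail).1
        (w.headD false)).1).1)

/-- Accept if the phase is `1`, reject if it is `-1`, and follow the first coin otherwise. -/
def verify (x w : List Bool) : Bool :=
  bif (phase V x w.tail).1 && !(phase V x w.tail).2.1 then !(phase V x w.tail).2.2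
  else w.headD false

/-! ### Polynomial time of the verifier -/

section PolynomialTime

open PT

variable {V} {α : Type} [Enc α]

theorem pt_mulPhase {p q : α → Phase} (hp : PT p) (hq : PT q) :
    PT (fun a => mulPhase (p a) (q a)) :=
  pair (and (fst hp) (fst hq)) (pair (xor (fst (snd hp)) (fst (snd hq)))
    (xor (xor (snd (snd hp)) (snd (snd hq))) (and (fst (snd hp)) (fst (snd hq)))))

theorem pt_sameBits {u v : α → List Bool} (hu : PT u) (hv : PT v) :
    PT (fun a => sameBits (u a) (v a)) :=
  and (not (PT.ltBits hu hv)) (not (PT.ltBits hv hu))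

theorem pt_stepEntry (hV : V.Poly) {x cur nxt : α → List Bool} {use axis : α → Bool} (hx : PT x)
    (hcur : PT cur) (hnxt : PT nxt) (huse : PT use) (haxis : PT axis) :
    PT (fun a => stepEntry V (x a) (cur a) (nxt a) (use a) (axis a)) := by
  have h1 : PT fun a => (unary (V.m (x a))).map (fun _ => false) :=
    (foldr (s := fun _ => []) (G := fun _ _ t => false :: t) (comp hV.m hx) (const [])
      (fun b => cons (const false) (snd id)) ⟨1, fun a b t => by simp⟩).congr fun a => by
        induction unary (V.m (x a)) with
        | nil => rfl
        | cons b l ih => rw [List.map_cons, ih, List.foldr_cons]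
  have h2 : PT fun a => (x a, trim (cur a), trim (nxt a)) :=
    pair hx (pair (PT.trim hcur) (PT.trim hnxt))
  exact cond huse (cond haxis (comp hV.im h2) (comp hV.re h2))
    (cons (const false) (append h1 (const [true])))

theorem pt_walkStep (hV : V.Poly) {x nxt r : α → List Bool} {s : α → Walk} {use axis : α → Bool}
    (hx : PT x) (hs : PT s) (huse : PT use) (haxis : PT axis) (hnxt : PT nxt) (hr : PT r) :
    PT (fun a => walkStep V (x a) (s a) (use a) (axis a) (nxt a) (r a)) := by
  have h1 := pt_stepEntry hV hx (fst hs) hnxt huse haxis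
  have hused : PT fun a => (s a).2.2.1 := fst (snd (snd hs))
  exact pair hnxt (pair (cond huse (PT.inc (fst (snd hs))) (fst (snd hs)))
    (pair (and hused huse) (pt_mulPhase (snd (snd (snd hs)))
      (pair (and (PT.ltBits hr (tail h1)) (cond huse hused
        (and (pt_sameBits (fst hs) hnxt) (not haxis)))) (pair haxis (headD h1))))))

theorem pt_readStep (hV : V.Poly) {x : α → List Bool} {t : α → List Bool × Walk}
    (hx : PT x) (ht : PT t) : PT (fun a => readStep V (x a) (t a)) := by
  have h1 : PT fun a => chunk (V.n (x a)) (t a).1.tail.tail :=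
    PT.chunk (comp (g := fun y => unary (V.n y)) hV.n hx) (tail (tail (fst ht)))
  have h2 : PT fun a => chunk (V.R (x a)) (chunk (V.n (x a)) (t a).1.tail.tail).2 :=
    PT.chunk (comp (g := fun y => unary (V.R y)) hV.R hx) (snd h1)
  exact pair (snd h2) (pt_walkStep hV hx (snd ht) (headD (fst ht)) (headD (tail (fst ht)))
    (fst h1) (fst h2))

/-- This is the growth condition for folds: coins are only removed, the new index has `n` bits, and
the counter gains at most one bit. -/
theorem size_readStep_le (x : List Bool) (t : List Bool × Walk) :
    size (readStep V x t) ≤ size t + size (unary (V.n x)) := by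
  obtain ⟨w, cur, cnt, used, a, b, c⟩ := t
  have h1 := (length_chunk_snd (V.R x) (chunk (V.n x) w.tail.tail).2).trans
    (length_chunk_snd (V.n x) w.tail.tail)
  have h2 := length_chunk_fst (V.n x) w.tail.tail
  have h3 : ∀ u : Bool, (bif u then inc cnt else cnt).length ≤ cnt.length + 1 := by
    have := length_addCarry_le true cnt
    rintro (_ | _)
    · simp
    · exact this
  have h4 := h3 (w.headD false)
  simp only [List.length_tail] at h1
  simp only [readStep, walkStep, size_pair, size_list, size_bool, mulPhase, length_unary] at *
  omega

theorem pt_walk (hV : V.Poly) {x w i : α → List Bool} {thr : α → Bool} (hx : PT x) (hw : PT w)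
    (hi : PT i) (hthr : PT thr) : PT (fun a => walk V (x a) (w a) (i a) (thr a)) := by
  obtain ⟨Q, hQ⟩ := (comp hV.n hx).size_le
  refine (foldl (l := fun a => unary (V.d (x a))) (G := fun a _ t => readStep V (x a) t)
    (comp (g := fun y => unary (V.d y)) hV.d hx) (pair hw (pair hi (pair (const []) (pair (not hthr)
      (const ((true, false, false) : Phase))))))
    (fun b => pt_readStep hV (comp hx (fst id)) (snd id))
    ⟨Q, fun a b t => (size_readStep_le _ _).trans (by have := hQ a; omega)⟩).congr fun a => ?_
  have : ∀ k t, (unary k).foldl (fun t _ => readStep V (x a) t) t = (readStep V (x a))^[k] t := by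
    intro k
    induction k with
    | zero => intro t; rfl
    | succ k ih =>
      intro t
      rw [show unary (k + 1) = true :: unary k from List.replicate_succ, List.foldl_cons, ih]
      rfl
  exact (this _ _).symm

theorem pt_phase (hV : V.Poly) {x w : α → List Bool} (hx : PT x) (hw : PT w) :
    PT (fun a => phase V (x a) (w a)) := by
  have h1 : PT fun a => chunk (V.n (x a)) (w a).tail.tail :=
    PT.chunk (comp (g := fun y => unary (V.n y)) hV.n hx) (tail (tail hw))
  have h2 := pt_walk hV hx (snd h1) (fst h1) (headD hw)
  have h3 := PT.chunk (comp (g := fun y => unary (V.R y)) hV.R hx) (fst h2)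
  have h4 : PT fun a => bif (w a).headD false then
      (bif (w a).tail.headD false then V.hi (x a) else V.lo (x a)) else
      V.coef (x a) (walk V (x a) (chunk (V.n (x a)) (w a).tail.tail).2
        (chunk (V.n (x a)) (w a).tail.tail).1 ((w a).headD false)).2.2.1 :=
    cond (headD hw) (cond (headD (tail hw)) (comp hV.hi hx) (comp hV.lo hx))
      (comp hV.coef (pair hx (fst (snd (snd h2)))))
  exact pt_mulPhase (snd (snd (snd (snd h2)))) (pair (and (PT.ltBits (fst h3) (tail h4))
    (and (pt_sameBits (fst (snd h2)) (fst h1)) (or (not (headD hw)) (isEmpty (PT.trim (fst h1))))))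
    (pair (const false) (xor (headD hw) (headD h4))))

/-- The verifier runs in polynomial time. -/
theorem pt_verify (hV : V.Poly) : PT (fun p : List Bool × List Bool => verify V p.1 p.2) := by
  have h := pt_phase hV (fst id) (tail (snd id) : PT fun p : List Bool × List Bool => p.2.tail)
  exact cond (and (fst h) (not (fst (snd h)))) (not (snd (snd h))) (headD (snd id))

end PolynomialTime

end WalkVerifier

/-! ## Averages over strings of coins -/

namespace Coins

open BitString

variable {𝕜 : Type*} [Field 𝕜]

/-- The average of `f` over all strings of length `ℓ`. -/
def avg : ℕ → (List Bool → 𝕜) → 𝕜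
  | 0, f => f []
  | ℓ + 1, f => (avg ℓ (fun w => f (false :: w)) + avg ℓ (fun w => f (true :: w))) / 2

theorem avg_congr {ℓ : ℕ} {f g : List Bool → 𝕜} (h : ∀ w, w.length = ℓ → f w = g w) :
    avg ℓ f = avg ℓ g := by
  induction ℓ generalizing f g with
  | zero => exact h [] rfl
  | succ ℓ ih =>
    rw [avg, avg, ih fun w hw => h (false :: w) (by simp [hw]),
      ih fun w hw => h (true :: w) (by simp [hw])]

theorem avg_mul_left (ℓ : ℕ) (c : 𝕜) (f : List Bool → 𝕜) :
    avg ℓ (fun w => c * f w) = c * avg ℓ f := by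
  induction ℓ generalizing f with
  | zero => rfl
  | succ ℓ ih => rw [avg, avg, ih, ih]; ring

theorem avg_add (ℓ : ℕ) (f g : List Bool → 𝕜) :
    avg ℓ (fun w => f w + g w) = avg ℓ f + avg ℓ g := by
  induction ℓ generalizing f g with
  | zero => rfl
  | succ ℓ ih => rw [avg, avg, avg, ih, ih]; ring

theorem avg_const [CharZero 𝕜] (ℓ : ℕ) (c : 𝕜) : avg ℓ (fun _ => c) = c := by
  induction ℓ with
  | zero => rfl
  | succ ℓ ih => rw [avg, ih]; ring

theorem avg_cast {ℓ : ℕ} (f : List Bool → ℚ) :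
    ((avg ℓ f : ℚ) : ℝ) = avg ℓ (fun w => (f w : ℝ)) := by
  induction ℓ generalizing f with
  | zero => rfl
  | succ ℓ ih => rw [avg, avg, ← ih, ← ih]; push_cast; ring

theorem avg_re {ℓ : ℕ} (f : List Bool → ℂ) : (avg ℓ f).re = avg ℓ (fun w => (f w).re) := by
  induction ℓ generalizing f with
  | zero => rfl
  | succ ℓ ih => rw [avg, avg, ← ih, ← ih, Complex.div_ofNat_re, Complex.add_re]

/-- Fubini's theorem: the first `n` coins are independent of the remaining ones. -/
theorem avg_chunk (n ℓ : ℕ) (F : List Bool → List Bool → 𝕜) :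
    avg (ℓ + n) (fun w => F (chunk n w).1 (chunk n w).2) =
      avg n (fun u => avg ℓ (fun w => F u w)) := by
  induction n generalizing F with
  | zero => rfl
  | succ n ih =>
    rw [← add_assoc, avg, avg]
    simp only [chunk, List.headD_cons, List.tail_cons]
    rw [ih (fun u w => F (false :: u) w), ih (fun u w => F (true :: u) w)]

theorem sum_range_two_mul (N : ℕ) (F : ℕ → 𝕜) :
    ∑ i ∈ Finset.range (2 * N), F i =
      ∑ i ∈ Finset.range N, F (Nat.bit false i) + ∑ i ∈ Finset.range N, F (Nat.bit true i) := by
  induction N with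
  | zero => simp
  | succ N ih =>
    rw [show 2 * (N + 1) = 2 * N + 1 + 1 by ring, Finset.sum_range_succ, Finset.sum_range_succ, ih,
      Finset.sum_range_succ, Finset.sum_range_succ]
    simp only [Nat.bit, cond_true, cond_false]
    ring

theorem avg_val (n : ℕ) (F : ℕ → 𝕜) :
    avg n (fun u => F (val u)) = (∑ i ∈ Finset.range (2 ^ n), F i) / 2 ^ n := by
  induction n generalizing F with
  | zero => simp [avg, val]
  | succ n ih =>
    rw [avg]
    simp only [val]
    rw [ih (fun i => F (Nat.bit false i)), ih (fun i => F (Nat.bit true i)), pow_succ' 2 n,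
      sum_range_two_mul, pow_succ']
    ring

theorem avg_lt [CharZero 𝕜] (n c : ℕ) (h : c ≤ 2 ^ n) :
    avg n (fun u => if val u < c then (1 : 𝕜) else 0) = c / 2 ^ n := by
  rw [avg_val n (fun i => if i < c then (1 : 𝕜) else 0), Finset.sum_ite, Finset.sum_const_zero,
    add_zero, Finset.sum_const, nsmul_one]
  congr 2
  rw [show (Finset.range (2 ^ n)).filter (· < c) = Finset.range c by ext; simp; omega,
    Finset.card_range]

/-- The index with a given binary notation. -/
def ix (n : ℕ) (u : List Bool) : Fin (2 ^ n) := ⟨val u % 2 ^ n, Nat.mod_lt _ (by positivity)⟩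

theorem ix_val {n : ℕ} {u : List Bool} (h : u.length = n) : (ix n u : ℕ) = val u :=
  Nat.mod_eq_of_lt (h ▸ val_lt u)

theorem trim_eq_ix {n : ℕ} {u : List Bool} (h : u.length = n) : trim u = (ix n u : ℕ).bits := by
  rw [trim_eq, ix_val h]

theorem avg_ix (n : ℕ) (F : Fin (2 ^ n) → 𝕜) :
    avg n (fun u => F (ix n u)) = (∑ i, F i) / 2 ^ n := by
  have h := avg_val n (fun i => F ⟨i % 2 ^ n, Nat.mod_lt _ (by positivity)⟩)
  refine h.trans ?_
  rw [Finset.sum_range]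
  congr 1
  exact Finset.sum_congr rfl fun i _ => by
    congr 1; exact Fin.ext (Nat.mod_eq_of_lt i.2)

/-- Separates the coins of a single step, in the order in which `readStep` consumes them, from those
of the rest of the walk. -/
theorem avg_read (n R ℓ : ℕ) (F : Bool → Bool → List Bool → List Bool → List Bool → 𝕜) :
    avg (ℓ + R + n + 1 + 1) (fun w => F (w.headD false) (w.tail.headD false)
      (chunk n w.tail.tail).1 (chunk R (chunk n w.tail.tail).2).1
      (chunk R (chunk n w.tail.tail).2).2) =
    avg n (fun u => avg R (fun r => (avg ℓ (fun w => F false false u r w) +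
      avg ℓ (fun w => F false true u r w) + avg ℓ (fun w => F true false u r w) +
      avg ℓ (fun w => F true true u r w)) / 4)) := by
  have key : ∀ a b, avg (ℓ + R + n) (fun w => F a b (chunk n w).1 (chunk R (chunk n w).2).1
      (chunk R (chunk n w).2).2) =
      avg n (fun u => avg R (fun r => avg ℓ (fun w => F a b u r w))) := by
    intro a b
    rw [avg_chunk n (ℓ + R) (fun u w => F a b u (chunk R w).1 (chunk R w).2)]
    congr 1
    funext u
    rw [avg_chunk R ℓ (fun r w => F a b u r w)]
  rw [avg, avg, avg]
  simp only [List.headD_cons, List.tail_cons]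
  rw [key, key, key, key]
  simp only [div_eq_inv_mul, avg_mul_left, avg_add]
  rw [show (4 : 𝕜)⁻¹ = 2⁻¹ * 2⁻¹ by rw [← mul_inv]; norm_num]
  ring

end Coins

/-! ### The mean phase of a random walk -/

namespace WalkVerifier

open BitString Coins Complex

/-- The value of a phase. -/
noncomputable def phi (p : Phase) : ℂ :=
  if p.1 then (if p.2.2 then -1 else 1) * (if p.2.1 then I else 1) else 0

theorem phi_mulPhase (p q : Phase) : phi (mulPhase p q) = phi p * phi q := by
  obtain ⟨a, b, c⟩ := p
  obtain ⟨a', b', c'⟩ := q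
  cases a <;> cases a' <;> cases b <;> cases b' <;> cases c <;> cases c' <;>
    simp [phi, mulPhase]

theorem sameBits_eq {n : ℕ} {u v : List Bool} (hu : u.length = n) (hv : v.length = n) :
    sameBits u v = decide (ix n u = ix n v) := by
  rw [sameBits, ltBits_eq _ _ (by omega), ltBits_eq _ _ (by omega)]
  rw [Bool.eq_iff_iff]
  simp [Fin.ext_iff, ix_val hu, ix_val hv]
  omega

theorem length_bits_le {z R : ℕ} (h : z < 2 ^ R) : z.bits.length ≤ R := by
  rw [Nat.size_eq_bits_len]
  exact Nat.size_le.2 h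

/-- Exactly `|u|` of the `2^R` equally likely numbers lie below `|u|`, and the sign bit supplies the
sign. -/
theorem avg_phi_ltBits {R : ℕ} {u : ℤ} (hu : u.natAbs < 2 ^ R) (c axis neg : Bool) :
    avg R (fun r => phi (ltBits r (intBits u).tail && c, axis,
      Bool.xor neg ((intBits u).headD false))) =
      if c then (if neg then -1 else 1) * (u / 2 ^ R * (if axis then I else 1)) else 0 := by
  have h1 : ∀ r : List Bool, r.length = R →
      phi (ltBits r (intBits u).tail && c, axis, Bool.xor neg ((intBits u).headD false)) =
      (if c then (if neg then -1 else 1) * ((if u < 0 then -1 else 1) * (if axis then I else 1))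
        else 0) * (if val r < u.natAbs then 1 else 0) := by
    intro r hr
    rw [ltBits_eq _ _ (by rw [hr]; exact length_bits_le hu)]
    simp only [intBits, List.tail_cons, List.headD_cons, val_bits]
    by_cases h : val r < u.natAbs <;> by_cases hz : u < 0 <;> cases c <;> cases neg <;>
      simp [h, hz, phi]
  rw [avg_congr h1, avg_mul_left, avg_lt _ _ hu.le]
  have h2 : (u : ℂ) = (if u < 0 then -1 else 1) * (u.natAbs : ℂ) := by
    by_cases hz : u < 0
    · rw [if_pos hz]
      have : (u.natAbs : ℤ) = -u := by omega
      rw [show (u.natAbs : ℂ) = ((u.natAbs : ℤ) : ℂ) by simp, this]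
      push_cast; ring
    · rw [if_neg hz]
      have : (u.natAbs : ℤ) = u := by omega
      rw [show (u.natAbs : ℂ) = ((u.natAbs : ℤ) : ℂ) by simp, this]
      ring
  rw [h2]
  split_ifs <;> ring

/-- The data return given numbers on the instance `x`. -/
structure Returns (V : Data) (x : List Bool)
    (u v : Fin (2 ^ V.n x) → Fin (2 ^ V.n x) → ℤ) (c : ℕ → ℤ) (a b : ℤ) : Prop where
  re : ∀ i j : Fin (2 ^ V.n x), V.re x (i : ℕ).bits (j : ℕ).bits = intBits (u i j)
  im : ∀ i j : Fin (2 ^ V.n x), V.im x (i : ℕ).bits (j : ℕ).bits = intBits (v i j)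
  coef : ∀ k ≤ V.d x, V.coef x k.bits = intBits (c k)
  lo : V.lo x = intBits a
  hi : V.hi x = intBits b
  re_lt : ∀ i j, (u i j).natAbs < 2 ^ V.R x
  im_lt : ∀ i j, (v i j).natAbs < 2 ^ V.R x
  coef_lt : ∀ k ≤ V.d x, (c k).natAbs < 2 ^ V.R x
  lo_lt : a.natAbs < 2 ^ V.R x
  hi_lt : b.natAbs < 2 ^ V.R x
  m_lt : V.m x < V.R x

theorem intBits_two_pow (m : ℕ) :
    false :: ((unary m).map (fun _ => false) ++ [true]) = intBits (2 ^ m) := by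
  have h1 : ((2 : ℤ) ^ m).natAbs = 2 ^ m := by simp [Int.natAbs_pow]
  have h2 : ∀ m : ℕ, (2 ^ m).bits = List.replicate m false ++ [true] := by
    intro m
    induction m with
    | zero => rfl
    | succ m ih =>
      rw [show 2 ^ (m + 1) = Nat.bit false (2 ^ m) by simp [Nat.bit, pow_succ, mul_comm],
        Nat.bits_append_bit _ _ (by intro h; simp at h), ih]
      rfl
  rw [intBits, h1, h2, decide_eq_false (not_lt.2 (by positivity))]
  simp [unary]

section Correctness

variable {V : Data} {x : List Bool} {u v : Fin (2 ^ V.n x) → Fin (2 ^ V.n x) → ℤ} {c : ℕ → ℤ}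
  {a b : ℤ} (h : Returns V x u v c a b)
include h

/-- Used and idle steps get the same denominator `2^R`: the integers `u`, `v` in one case and `2^m`,
that is 1 at scale `2^m`, in the other. This makes the weight of a walk independent of the number of
uses. -/
theorem avg_stepPhase {cur nxt : List Bool} (hcur : cur.length = V.n x)
    (hnxt : nxt.length = V.n x) (use axis used : Bool) :
    avg (V.R x) (fun r => phi (stepPhase V x cur nxt use axis used r)) =
      if use then (if used then (if axis then v (ix _ cur) (ix _ nxt) * I
        else u (ix _ cur) (ix _ nxt)) / 2 ^ V.R x else 0)
      else (if ix (V.n x) cur = ix _ nxt then (if axis then 0 else 2 ^ V.m x / 2 ^ V.R x) else 0) := by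
  have e1 : ∀ z : ℤ, z.natAbs < 2 ^ V.R x → ∀ cond : Bool,
      avg (V.R x) (fun r => phi (ltBits r (intBits z).tail && cond, axis,
        (intBits z).headD false)) =
      if cond then (z / 2 ^ V.R x * (if axis then I else 1)) else 0 := fun z hz cond => by
    have := avg_phi_ltBits hz cond axis false
    simpa only [Bool.false_bne, if_false, one_mul, Bool.false_eq_true] using this
  cases use
  · have e2 : ((2 : ℤ) ^ V.m x).natAbs < 2 ^ V.R x := by
      rw [Int.natAbs_pow]; exact Nat.pow_lt_pow_right (by norm_num) h.m_lt
    have := e1 _ e2 (sameBits cur nxt && !axis)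
    rw [sameBits_eq hcur hnxt] at this
    simp only [stepPhase, stepEntry, cond_false, intBits_two_pow, sameBits_eq hcur hnxt]
    rw [this]
    cases axis <;> simp
  · have e3 : stepEntry V x cur nxt true axis = intBits (if axis then v (ix _ cur) (ix _ nxt)
        else u (ix _ cur) (ix _ nxt)) := by
      cases axis
      · simp [stepEntry, trim_eq_ix hcur, trim_eq_ix hnxt, h.re]
      · simp [stepEntry, trim_eq_ix hcur, trim_eq_ix hnxt, h.im]
    simp only [stepPhase, e3, cond_true]
    rw [e1 _ (by cases axis; exacts [h.re_lt _ _, h.im_lt _ _])]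
    cases axis <;> cases used <;> simp
    ring

/-- The approximation of the matrix. -/
noncomputable def approx (V : Data) (x : List Bool)
    (u v : Fin (2 ^ V.n x) → Fin (2 ^ V.n x) → ℤ) :
    Matrix (Fin (2 ^ V.n x)) (Fin (2 ^ V.n x)) ℂ :=
  fun i j => (u i j + v i j * I) / 2 ^ V.m x

/-- The weight of a step. -/
noncomputable def stepWeight (V : Data) (x : List Bool) : ℂ :=
  2 ^ V.m x / 2 ^ V.R x / 4 / 2 ^ V.n x

/-- The average phase of the end of a walk. -/
noncomputable def endValue (V : Data) (x : List Bool) (c : ℕ → ℤ) (a b : ℤ) (thr up : Bool)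
    (i j : Fin (2 ^ V.n x)) (k : ℕ) : ℂ :=
  if thr then (if j = i ∧ i = 0 then -((if up then b else a : ℤ) : ℂ) / 2 ^ V.R x else 0)
  else (if j = i then c k / 2 ^ V.R x else 0)

theorem avg_endPhase (thr up : Bool) {i cur : List Bool} (hi : i.length = V.n x)
    (hcur : cur.length = V.n x) {k : ℕ} (hk : k ≤ V.d x) :
    avg (V.R x) (fun r => phi (endPhase V x thr up i cur k.bits r)) =
      endValue V x c a b thr up (ix _ i) (ix _ cur) k := by
  have h0 : (trim i).isEmpty = decide (ix (V.n x) i = 0) := by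
    rw [trim_eq_ix hi, Bool.eq_iff_iff, List.isEmpty_iff, decide_eq_true_eq]
    constructor
    · intro hb
      have := val_bits (ix (V.n x) i)
      rw [hb, val] at this
      exact Fin.ext (by simpa using this.symm)
    · intro hb
      rw [hb]
      simp
  simp only [endPhase, sameBits_eq hcur hi, h0]
  cases thr
  · simp only [cond_false, h.coef k hk]
    rw [avg_phi_ltBits (h.coef_lt k hk)]
    simp [endValue]
  · have e : (bif true then (bif up then V.hi x else V.lo x) else V.coef x k.bits) =
        intBits (if up then b else a) := by
      cases up
      · simp [h.lo]
      · simp [h.hi]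
    simp only [e]
    rw [avg_phi_ltBits (by cases up; exacts [h.lo_lt, h.hi_lt])]
    simp [endValue, neg_div]

/-- The walk unfolds the powers of the matrix from the left. With `r` steps to go and no idling so
far, a step either idles, which fixes the power at the current count `k`, or multiplies by one entry
and raises the count. Once the walk has idled, only idling survives. Both alternatives contribute
the same factor `stepWeight` per step. The surplus `e` stands for coins that are never read. -/
theorem avg_walk (thr up : Bool) {i : List Bool} (hi : i.length = V.n x) (e r : ℕ)
    {cur : List Bool} (hcur : cur.length = V.n x) {k : ℕ} (hk : k + r ≤ V.d x) (used : Bool)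
    (p : Phase) :
    avg (r * (V.R x + V.n x + 2) + (V.R x + e)) (fun w =>
      phi ((readStep V x)^[r] (w, (cur, k.bits, used, p))).2.2.2.2 *
      phi (endPhase V x thr up i ((readStep V x)^[r] (w, (cur, k.bits, used, p))).2.1
        ((readStep V x)^[r] (w, (cur, k.bits, used, p))).2.2.1
        (chunk (V.R x) ((readStep V x)^[r] (w, (cur, k.bits, used, p))).1).1)) =
    phi p * (stepWeight V x ^ r * if used then
      ∑ t ∈ Finset.range (r + 1), ∑ j, (approx V x u v ^ t) (ix _ cur) j *
        endValue V x c a b thr up (ix _ i) j (k + t)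
      else endValue V x c a b thr up (ix _ i) (ix _ cur) k) := by
  induction r generalizing cur k used p with
  | zero =>
    have h1 := avg_endPhase h thr up hi hcur (k := k) (by omega)
    simp only [Function.iterate_zero, id_eq, zero_mul, zero_add]
    rw [add_comm (V.R x) e,
      avg_chunk (V.R x) e (fun r _ => phi p * phi (endPhase V x thr up i cur k.bits r))]
    simp only [avg_const, avg_mul_left, h1]
    cases used
    · simp
    · simp [Matrix.one_apply]
  | succ r ih =>
    set ε : ℂ := 2 ^ V.m x / 2 ^ V.R x with hε
    set E := endValue V x c a b thr up (ix _ i) with hE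
    set B := approx V x u v with hB
    set q : Fin (2 ^ V.n x) := ix (V.n x) cur with hq
    have hnum : (r + 1) * (V.R x + V.n x + 2) + (V.R x + e) =
        (r * (V.R x + V.n x + 2) + (V.R x + e)) + V.R x + V.n x + 1 + 1 := by ring
    have hB' : ∀ i j, B i j * ε = u i j / 2 ^ V.R x + v i j * I / 2 ^ V.R x := by
      intro i j
      have : (2 : ℂ) ^ V.m x ≠ 0 := pow_ne_zero _ two_ne_zero
      simp only [hB, hε, approx]
      field_simp
    rw [hnum]
    simp only [Function.iterate_succ_apply]
    have h1 := avg_read (V.n x) (V.R x) (r * (V.R x + V.n x + 2) + (V.R x + e))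
      (fun use axis nxt rr w =>
        phi ((readStep V x)^[r] (w, walkStep V x (cur, k.bits, used, p) use axis nxt rr)).2.2.2.2 *
        phi (endPhase V x thr up i
          ((readStep V x)^[r] (w, walkStep V x (cur, k.bits, used, p) use axis nxt rr)).2.1
          ((readStep V x)^[r] (w, walkStep V x (cur, k.bits, used, p) use axis nxt rr)).2.2.1
          (chunk (V.R x)
            ((readStep V x)^[r] (w, walkStep V x (cur, k.bits, used, p) use axis nxt rr)).1).1))
    refine h1.trans ?_
    -- For a fixed next index, the first summand is idling on the real axis and the second one
    -- collects the real and the imaginary part of an entry; idling on the imaginary axis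
    -- contributes nothing.
    refine (avg_congr (g := fun nxt => phi p / 4 * ((if q = ix _ nxt then ε else 0) *
        (stepWeight V x ^ r * E (ix _ nxt) k) + (if used then B q (ix _ nxt) * ε *
        (stepWeight V x ^ r * ∑ t ∈ Finset.range (r + 1), ∑ j, (B ^ t) (ix _ nxt) j *
          E j (k + 1 + t)) else 0))) fun nxt hnxt => ?_).trans ?_
    · have hf : ∀ axis rr, walkStep V x (cur, k.bits, used, p) false axis nxt rr =
          (nxt, k.bits, false, mulPhase p (stepPhase V x cur nxt false axis used rr)) := by
        intro axis rr; simp [walkStep]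
      have ht : ∀ axis rr, walkStep V x (cur, k.bits, used, p) true axis nxt rr =
          (nxt, (k + 1).bits, used, mulPhase p (stepPhase V x cur nxt true axis used rr)) := by
        intro axis rr; simp [walkStep, inc_bits]
      simp only [hf, ht, ih hnxt (show k + r ≤ V.d x by omega),
        ih hnxt (show k + 1 + r ≤ V.d x by omega), phi_mulPhase]
      simp only [div_eq_inv_mul _ (4 : ℂ), mul_right_comm (phi p) (phi _) _, avg_mul_left,
        avg_add, avg_stepPhase h hcur hnxt]
      cases used
      · simp only [Bool.false_eq_true, if_false, if_true]
        split_ifs <;> ring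
      · simp only [Bool.false_eq_true, if_false, if_true, hB']
        split_ifs <;> ring
    rw [avg_ix (V.n x) (fun j => phi p / 4 * ((if q = j then ε else 0) *
        (stepWeight V x ^ r * E j k) + (if used then B q j * ε *
        (stepWeight V x ^ r * ∑ t ∈ Finset.range (r + 1), ∑ l, (B ^ t) j l *
          E l (k + 1 + t)) else 0)))]
    rw [← Finset.mul_sum, Finset.sum_add_distrib]
    simp only [ite_mul, zero_mul, Finset.sum_ite_eq, Finset.mem_univ, if_true]
    have hκ : stepWeight V x ^ (r + 1) = stepWeight V x ^ r * (ε / 4 / 2 ^ V.n x) := pow_succ _ _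
    cases used
    · simp only [Bool.false_eq_true, if_false, Finset.sum_const_zero, hκ]
      ring
    · simp only [if_true]
      -- The term `t = 0` is split off and `B^(t+1)` is written as `B * B^t`, which matches the two
      -- alternatives of the first step.
      have h3 : ∑ t ∈ Finset.range (r + 1 + 1), ∑ j, (B ^ t) q j * E j (k + t) =
          E q k + ∑ j, B q j * ∑ t ∈ Finset.range (r + 1), ∑ l, (B ^ t) j l *
            E l (k + 1 + t) := by
        rw [Finset.sum_range_succ', add_comm]
        congr 1
        · simp [Matrix.one_apply]
        · simp only [pow_succ' B, Matrix.mul_apply, Finset.mul_sum (s := Finset.range (r + 1))]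
          rw [Finset.sum_comm (s := Finset.univ) (t := Finset.range (r + 1))]
          refine Finset.sum_congr rfl fun t _ => ?_
          simp only [Finset.sum_mul, Finset.mul_sum]
          rw [Finset.sum_comm]
          refine Finset.sum_congr rfl fun j _ => Finset.sum_congr rfl fun l _ => ?_
          rw [show k + (t + 1) = k + 1 + t by ring]
          ring
      have h4 : ∑ j, B q j * ε * (stepWeight V x ^ r * ∑ t ∈ Finset.range (r + 1), ∑ l,
          (B ^ t) j l * E l (k + 1 + t)) = ε * stepWeight V x ^ r *
          ∑ j, B q j * ∑ t ∈ Finset.range (r + 1), ∑ l, (B ^ t) j l * E l (k + 1 + t) := by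
        rw [Finset.mul_sum]
        exact Finset.sum_congr rfl fun j _ => by ring
      rw [h3, h4, hκ]
      ring

end Correctness

end WalkVerifier

/-! ### The acceptance probability of the verifier -/

namespace WalkVerifier

open BitString Coins Complex

section Correctness

variable {V : Data} {x : List Bool} {u v : Fin (2 ^ V.n x) → Fin (2 ^ V.n x) → ℤ} {c : ℕ → ℤ}
  {a b : ℤ} (h : Returns V x u v c a b)
include h

/-- Summing over the start index closes the walks into traces. A threshold enters through the start
index 0 alone, and therefore with the same factor. -/
theorem avg_phase_of_coins (thr up : Bool) (e : ℕ) :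
    avg (V.d x * (V.R x + V.n x + 2) + (V.R x + e) + V.n x)
      (fun w => phi (phase V x (thr :: up :: w))) =
    stepWeight V x ^ V.d x / 2 ^ V.n x / 2 ^ V.R x *
      if thr then -((if up then b else a : ℤ) : ℂ)
      else ∑ t ∈ Finset.range (V.d x + 1), c t * (approx V x u v ^ t).trace := by
  simp only [phase, phi_mulPhase, List.headD_cons, List.tail_cons]
  rw [avg_chunk (V.n x) _ (fun i w => phi (walk V x w i thr).2.2.2.2 *
    phi (endPhase V x thr up i (walk V x w i thr).2.1 (walk V x w i thr).2.2.1
      (chunk (V.R x) (walk V x w i thr).1).1))]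
  have h1 : phi (true, false, false) = 1 := by simp [phi]
  have h2 : ∀ i : List Bool, i.length = V.n x → avg (V.d x * (V.R x + V.n x + 2) + (V.R x + e))
      (fun w => phi (walk V x w i thr).2.2.2.2 *
        phi (endPhase V x thr up i (walk V x w i thr).2.1 (walk V x w i thr).2.2.1
          (chunk (V.R x) (walk V x w i thr).1).1)) =
      stepWeight V x ^ V.d x / 2 ^ V.R x *
        if thr then (if ix (V.n x) i = 0 then -((if up then b else a : ℤ) : ℂ) else 0)
        else ∑ t ∈ Finset.range (V.d x + 1), c t *
          (approx V x u v ^ t) (ix _ i) (ix _ i) := by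
    intro i hi
    have := avg_walk h thr up hi e (V.d x) hi (k := 0) (by omega) (!thr) (true, false, false)
    rw [Nat.zero_bits] at this
    refine this.trans ?_
    rw [h1, one_mul]
    cases thr
    · simp only [Bool.not_false, if_true, Bool.false_eq_true, if_false, zero_add, endValue,
        mul_ite, mul_zero, Finset.sum_ite_eq', Finset.mem_univ, Finset.mul_sum]
      exact Finset.sum_congr rfl fun t _ => by ring
    · simp only [Bool.not_true, if_true, Bool.false_eq_true, if_false, endValue, true_and]
      split_ifs <;> ring
  rw [avg_congr h2, avg_ix (V.n x) (fun i => stepWeight V x ^ V.d x / 2 ^ V.R x *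
        if thr then (if i = 0 then -((if up then b else a : ℤ) : ℂ) else 0)
        else ∑ t ∈ Finset.range (V.d x + 1), c t * (approx V x u v ^ t) i i), ← Finset.mul_sum]
  cases thr
  · simp only [Bool.false_eq_true, if_false]
    rw [Finset.sum_comm]
    simp only [← Finset.mul_sum, Matrix.trace, Matrix.diag]
    ring
  · simp only [if_true, Finset.sum_ite_eq', Finset.mem_univ]
    ring

/-- The average phase is the weighted difference of the trace and the mean of the thresholds. -/
theorem avg_phase (e : ℕ) :
    avg (V.d x * (V.R x + V.n x + 2) + (V.R x + e) + V.n x + 1 + 1)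
      (fun w => phi (phase V x w)) =
    stepWeight V x ^ V.d x / 2 ^ V.n x / 2 ^ V.R x / 2 *
      (∑ t ∈ Finset.range (V.d x + 1), c t * (approx V x u v ^ t).trace - (a + b) / 2) := by
  -- Of the four values of the two leading coins, two give the trace and one gives each negated
  -- threshold, which leaves the trace minus the mean of the thresholds, halved.
  rw [avg, avg, avg, avg_phase_of_coins h, avg_phase_of_coins h, avg_phase_of_coins h,
    avg_phase_of_coins h]
  simp only [Bool.false_eq_true, if_false, if_true]
  ring

/-- The sign of the bias of the verifier is that of the difference of the trace and the mean of
the thresholds. -/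
theorem avg_verify (e : ℕ) : ∃ κ : ℝ, 0 < κ ∧
    ((avg (V.d x * (V.R x + V.n x + 2) + (V.R x + e) + V.n x + 1 + 1 + 1)
      (fun w => if verify V x w then (1 : ℚ) else 0) : ℚ) : ℝ) =
    1 / 2 + κ * ((∑ t ∈ Finset.range (V.d x + 1), c t * (approx V x u v ^ t).trace).re -
      (a + b) / 2) := by
  refine ⟨((2 ^ V.m x / 2 ^ V.R x / 4 / 2 ^ V.n x) ^ V.d x / 2 ^ V.n x / 2 ^ V.R x / 2) / 2,
    by positivity, ?_⟩
  have h1 := congrArg Complex.re (avg_phase h e)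
  have h2 : stepWeight V x ^ V.d x / 2 ^ V.n x / 2 ^ V.R x / 2 =
      (((2 ^ V.m x / 2 ^ V.R x / 4 / 2 ^ V.n x) ^ V.d x / 2 ^ V.n x / 2 ^ V.R x / 2 : ℝ) : ℂ) := by
    simp [stepWeight]
  have h3 : ((a : ℂ) + b) / 2 = (((a + b) / 2 : ℝ) : ℂ) := by simp
  rw [avg_re, h2, Complex.re_ofReal_mul, Complex.sub_re, h3, Complex.ofReal_re] at h1
  rw [avg_cast, avg, ← avg_add]
  -- The two values of the tie-breaking coin are taken together: they accept twice on phase 1, never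
  -- on -1, and once on 0 and on `±i`, whose real part is zero.
  have h4 : ∀ w : List Bool,
      (((if verify V x (false :: w) then 1 else 0 : ℚ) : ℝ) +
        ((if verify V x (true :: w) then 1 else 0 : ℚ) : ℝ)) =
      1 + (phi (phase V x w)).re := by
    intro w
    simp only [verify, List.tail_cons, List.headD_cons, phi]
    obtain ⟨⟨p, q, r⟩, hq⟩ : ∃ z, phase V x w = z := ⟨_, rfl⟩
    simp only [hq]
    cases p <;> cases q <;> cases r <;> norm_num
  simp only [h4]
  rw [avg_add, avg_const, h1]
  ring

end Correctness

end WalkVerifier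

/-! ## The effect of approximating the data -/

namespace TraceError

/-- Telescoping, by the identity `e` below. As `1 ≤ M`, the exponent may be rounded up to `k`. -/
theorem norm_pow_sub_pow_le {S : Type*} [NormedRing S] [NormOneClass S] {x y : S} {M : ℝ}
    (hM : 1 ≤ M) (hx : ‖x‖ ≤ M) (hy : ‖y‖ ≤ M) (k : ℕ) :
    ‖y ^ k - x ^ k‖ ≤ k * M ^ k * ‖y - x‖ := by
  induction k with
  | zero => simp
  | succ k ih =>
    have h0 : 0 ≤ ‖y - x‖ := norm_nonneg _
    have e : y ^ (k + 1) - x ^ (k + 1) = y ^ k * (y - x) + (y ^ k - x ^ k) * x := by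
      rw [pow_succ, pow_succ]; noncomm_ring
    have h1 : ‖y ^ k * (y - x)‖ ≤ M ^ k * ‖y - x‖ := (norm_mul_le _ _).trans
      (mul_le_mul_of_nonneg_right ((norm_pow_le y k).trans (pow_le_pow_left₀ (norm_nonneg _) hy k))
        h0)
    have h2 : ‖(y ^ k - x ^ k) * x‖ ≤ k * M ^ k * ‖y - x‖ * M := (norm_mul_le _ _).trans
      (mul_le_mul ih hx (norm_nonneg _) (by positivity))
    have h3 : M ^ k * ‖y - x‖ ≤ M ^ (k + 1) * ‖y - x‖ :=
      mul_le_mul_of_nonneg_right (pow_le_pow_right₀ hM (by omega)) h0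
    rw [e]
    refine (norm_add_le _ _).trans ((add_le_add (h1.trans h3) h2).trans (le_of_eq ?_))
    push_cast
    ring

section

attribute [local instance] Matrix.linftyOpNormedRing Matrix.linfty_opNormOneClass

variable {N : ℕ}

/-- The norm is the largest row sum: it is submultiplicative, as powers require, and agrees with the
largest entry up to a factor `N`. -/
theorem norm_matrix_le {M : Matrix (Fin N) (Fin N) ℂ} {c : ℝ} (hc : 0 ≤ c)
    (h : ∀ i j, ‖M i j‖ ≤ c) : ‖M‖ ≤ N * c := by
  lift c to NNReal using hc
  have h1 : ‖M‖₊ ≤ N * c := by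
    rw [Matrix.linfty_opNNNorm_def]
    refine Finset.sup_le fun i _ => ?_
    refine (Finset.sum_le_card_nsmul _ _ c fun j _ => h i j).trans ?_
    simp
  exact_mod_cast h1

theorem norm_apply_le (M : Matrix (Fin N) (Fin N) ℂ) (i j : Fin N) : ‖M i j‖ ≤ ‖M‖ := by
  have h1 : ‖M i j‖₊ ≤ ‖M‖₊ := by
    rw [Matrix.linfty_opNNNorm_def]
    exact (Finset.single_le_sum (f := fun j => ‖M i j‖₊) (fun _ _ => zero_le)
      (Finset.mem_univ j)).trans (Finset.le_sup (f := fun i => ∑ j, ‖M i j‖₊) (Finset.mem_univ i))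
  exact h1

theorem norm_trace_le (M : Matrix (Fin N) (Fin N) ℂ) : ‖M.trace‖ ≤ N * ‖M‖ := by
  refine (norm_sum_le _ _).trans ((Finset.sum_le_card_nsmul _ _ ‖M‖
    fun i _ => norm_apply_le M i i).trans ?_)
  simp

/-- Each term changes by the error of the coefficient times a trace, plus the coefficient times a
difference of powers. Both matrices have norm at most `2 * N` and differ by at most `2 * N * ε` in
norm. The bound is exponential in `d` and `log N`, which a polynomial number of bits of precision
absorbs. -/
theorem norm_sum_sub_sum_le [NeZero N] {A B : Matrix (Fin N) (Fin N) ℂ} {c c' : ℕ → ℝ} {d : ℕ}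
    {C ε : ℝ} (hε : 0 ≤ ε) (hε' : ε ≤ 1 / 2) (hA : ∀ i j, ‖A i j‖ ≤ 1)
    (hB : ∀ i j, ‖B i j - A i j‖ ≤ 2 * ε) (hc : ∀ k, |c k| ≤ C)
    (hc' : ∀ k ≤ d, |c' k - c k| ≤ ε) :
    ‖∑ k ∈ Finset.range (d + 1), (c' k : ℂ) * (B ^ k).trace -
      ∑ k ∈ Finset.range (d + 1), (c k : ℂ) * (A ^ k).trace‖ ≤
      (d + 1) * (N * (2 * N) ^ d * (1 + 2 * N * C * d) * ε) := by
  have hC : 0 ≤ C := (abs_nonneg _).trans (hc 0)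
  have hN : (1 : ℝ) ≤ N := by exact_mod_cast NeZero.one_le
  have hM : (1 : ℝ) ≤ 2 * N := by linarith
  have nA : ‖A‖ ≤ 2 * N := (norm_matrix_le zero_le_one hA).trans (by linarith)
  have nB : ‖B‖ ≤ 2 * N := by
    rw [mul_comm]
    refine norm_matrix_le zero_le_two fun i j => ?_
    have := norm_le_norm_add_norm_sub' (B i j) (A i j)
    have h1 := hA i j
    have h2 := hB i j
    linarith
  have nBA : ‖B - A‖ ≤ N * (2 * ε) := norm_matrix_le (by positivity) hB
  rw [← Finset.sum_sub_distrib]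
  refine (norm_sum_le _ _).trans ((Finset.sum_le_card_nsmul _ _
    (N * (2 * N) ^ d * (1 + 2 * N * C * d) * ε) fun k hk => ?_).trans (by simp))
  have hk : k ≤ d := by simpa [Nat.lt_succ_iff] using hk
  have hpow : ((2 : ℝ) * N) ^ k ≤ (2 * N) ^ d := pow_le_pow_right₀ hM hk
  have e : (c' k : ℂ) * (B ^ k).trace - c k * (A ^ k).trace =
      ((c' k - c k : ℝ) : ℂ) * (B ^ k).trace + c k * (B ^ k - A ^ k).trace := by
    rw [Matrix.trace_sub]; push_cast; ring
  have h1 : ‖((c' k - c k : ℝ) : ℂ) * (B ^ k).trace‖ ≤ ε * (N * (2 * N) ^ d) := by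
    rw [norm_mul, Complex.norm_real]
    refine mul_le_mul (hc' k hk) ((norm_trace_le _).trans ?_) (norm_nonneg _) hε
    exact mul_le_mul_of_nonneg_left (((norm_pow_le B k).trans
      (pow_le_pow_left₀ (norm_nonneg _) nB k)).trans hpow) (by positivity)
  have h2 : ‖(c k : ℂ) * (B ^ k - A ^ k).trace‖ ≤
      C * (N * (d * (2 * N) ^ d * (N * (2 * ε)))) := by
    rw [norm_mul, Complex.norm_real]
    refine mul_le_mul (hc k) ((norm_trace_le _).trans ?_) (norm_nonneg _) hC
    refine mul_le_mul_of_nonneg_left ((norm_pow_sub_pow_le hM nA nB k).trans ?_) (by positivity)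
    refine mul_le_mul (mul_le_mul (by exact_mod_cast hk) hpow (by positivity) (by positivity)) nBA
      (norm_nonneg _) (by positivity)
  rw [e]
  refine (norm_add_le _ _).trans ((add_le_add h1 h2).trans (le_of_eq ?_))
  ring

end

open Matrix in
-- The entry is a coordinate of the image of a unit vector.
theorem norm_entry_le_toEuclideanCLM {N : ℕ} (A : Matrix (Fin N) (Fin N) ℂ) (i j : Fin N) :
    ‖A i j‖ ≤ ‖Matrix.toEuclideanCLM (n := Fin N) (𝕜 := ℂ) A‖ := by
  have h1 := (Matrix.toEuclideanCLM (n := Fin N) (𝕜 := ℂ) A).le_opNorm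
    (PiLp.single 2 j (1 : ℂ))
  rw [PiLp.norm_single, norm_one, mul_one] at h1
  refine le_trans ?_ h1
  have h2 := PiLp.norm_apply_le
    (Matrix.toEuclideanCLM (n := Fin N) (𝕜 := ℂ) A (PiLp.single 2 j (1 : ℂ))) i
  refine le_trans (le_of_eq ?_) h2
  simp [Matrix.ofLp_toEuclideanCLM]

theorem tracePoly_eq {N : ℕ} (A : Matrix (Fin N) (Fin N) ℂ) (p : Polynomial ℝ) {d : ℕ}
    (hd : p.natDegree ≤ d) :
    tracePoly A p = (∑ k ∈ Finset.range (d + 1), (p.coeff k : ℂ) * (A ^ k).trace).re := by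
  rw [tracePoly, Polynomial.aeval_eq_sum_range' (Nat.lt_succ_of_le hd), Matrix.trace_sum]
  congr 1
  refine Finset.sum_congr rfl fun k _ => ?_
  rw [Matrix.trace_smul, Complex.real_smul]

/-- Approximations of the data determine the sign of the difference of the trace and the mean of
the thresholds, if there is a gap. -/
theorem sign_of_approx {N : ℕ} [NeZero N] {A B : Matrix (Fin N) (Fin N) ℂ} {p : Polynomial ℝ}
    {c' : ℕ → ℝ} {d : ℕ} {C ε a b a' b' : ℝ} (hε : 0 < ε) (hε' : ε ≤ 1 / 2)
    (hA : ∀ i j, ‖A i j‖ ≤ 1) (hB : ∀ i j, ‖B i j - A i j‖ ≤ 2 * ε)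
    (hc : ∀ k, |p.coeff k| ≤ C) (hc' : ∀ k ≤ d, |c' k - p.coeff k| ≤ ε)
    (hd : p.natDegree ≤ d) (ha : |a' - a| ≤ ε) (hb : |b' - b| ≤ ε)
    (hgap : 2 * ((d + 1) * (N * (2 * N) ^ d * (1 + 2 * N * C * d) * ε) + ε) < b - a) :
    (b ≤ tracePoly A p →
      0 < (∑ k ∈ Finset.range (d + 1), (c' k : ℂ) * (B ^ k).trace).re - (a' + b') / 2) ∧
    (tracePoly A p ≤ a →
      (∑ k ∈ Finset.range (d + 1), (c' k : ℂ) * (B ^ k).trace).re - (a' + b') / 2 < 0) := by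
  have h1 := norm_sum_sub_sum_le hε.le hε' hA hB hc hc'
  have h2 := (Complex.abs_re_le_norm _).trans h1
  rw [Complex.sub_re, ← tracePoly_eq A p hd, abs_le] at h2
  rw [abs_le] at ha hb
  -- The errors of the trace and of the mean of the thresholds together stay below `(b - a) / 2`,
  -- the distance from either threshold to the mean.
  constructor <;> intro h <;> linarith [h2.1, h2.2, ha.1, ha.2, hb.1, hb.2]

/-- The precision that the gap requires. -/
theorem precision {n d P Q m : ℕ} (hm : 2 * d + 2 * n + (n + 1) * d + P + Q + 4 ≤ m) :
    2 * (((d : ℝ) + 1) * (((2 ^ n : ℕ) : ℝ) * (2 * ((2 ^ n : ℕ) : ℝ)) ^ d *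
      (1 + 2 * ((2 ^ n : ℕ) : ℝ) * 2 ^ P * d) * (1 / 2 ^ m)) + 1 / 2 ^ m) < 1 / 2 ^ Q := by
  have h1 : ∀ d : ℕ, (d : ℝ) + 1 ≤ 2 ^ d := fun d => by
    have := Nat.lt_two_pow_self (n := d)
    exact_mod_cast this
  have h2 : 1 + 2 * (2 : ℝ) ^ n * 2 ^ P * d ≤ 2 ^ (n + P + d + 1) := by
    have h3 : (1 : ℝ) ≤ 2 ^ n * 2 ^ P := by
      rw [← pow_add]; exact one_le_pow₀ one_le_two
    calc 1 + 2 * (2 : ℝ) ^ n * 2 ^ P * d ≤ 2 * (2 ^ n * 2 ^ P) * (d + 1) := by nlinarith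
      _ ≤ 2 * (2 ^ n * 2 ^ P) * 2 ^ d := by gcongr; exact h1 d
      _ = _ := by ring
  -- The exponent collects `d` from `d + 1`, `n + (n + 1) * d` from the powers of `N`, and `n + P +
  -- d + 1` from `h2`.
  have h4 : ((d : ℝ) + 1) * (2 ^ n * (2 * 2 ^ n) ^ d * (1 + 2 * 2 ^ n * 2 ^ P * d)) ≤
      2 ^ (2 * d + 2 * n + (n + 1) * d + P + 1) := by
    calc ((d : ℝ) + 1) * (2 ^ n * (2 * 2 ^ n) ^ d * (1 + 2 * 2 ^ n * 2 ^ P * d))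
        ≤ 2 ^ d * (2 ^ n * (2 * 2 ^ n) ^ d * 2 ^ (n + P + d + 1)) := by
          gcongr
          exact h1 d
      _ = _ := by
        rw [← pow_succ', ← pow_mul]
        ring
  push_cast
  set K := 2 * d + 2 * n + (n + 1) * d + P
  have h5 : (2 : ℝ) ^ (K + Q + 4) ≤ 2 ^ m := pow_le_pow_right₀ one_le_two hm
  have h6 : (1 : ℝ) ≤ 2 ^ K := one_le_pow₀ one_le_two
  rw [← mul_assoc ((d : ℝ) + 1), ← add_one_mul, ← mul_assoc, mul_one_div,
    div_lt_div_iff₀ (by positivity) (by positivity), one_mul]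
  refine lt_of_lt_of_le ?_ h5
  -- The factor in front of `2^(K + Q)` is `2 * (2 + 1) = 6`, which is below `2^4`.
  calc 2 * (((d : ℝ) + 1) * (2 ^ n * (2 * 2 ^ n) ^ d * (1 + 2 * 2 ^ n * 2 ^ P * d)) + 1) * 2 ^ Q
      ≤ 2 * (2 ^ (K + 1) + 2 ^ K) * 2 ^ Q := by gcongr
    _ < 2 ^ (K + Q + 4) := by
      have : (0 : ℝ) < 2 ^ K * 2 ^ Q := by positivity
      rw [show K + Q + 4 = K + (Q + 4) from rfl, pow_add 2 K (Q + 4), pow_add 2 Q 4,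
        pow_add 2 K 1]
      nlinarith

end TraceError

/-! ## The verifier for the trace problem -/

namespace WalkVerifier

open BitString Coins Enc

theorem natAbs_lt_of_length {u : ℤ} {R : ℕ} (h : (intBits u).length ≤ R) : u.natAbs < 2 ^ R := by
  have h1 := val_lt u.natAbs.bits
  rw [val_bits] at h1
  refine h1.trans_le (Nat.pow_le_pow_right two_pos ?_)
  simp only [intBits, List.length_cons] at h
  omega

theorem norm_sub_le_of_approxComplex {m : ℕ} {z : ℂ} {u v : ℤ} (h : ApproxComplex m z u v) :
    ‖((u : ℂ) + v * Complex.I) / 2 ^ m - z‖ ≤ 2 * (1 / 2 ^ m) := by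
  have e : ((u : ℂ) + v * Complex.I) / 2 ^ m =
      ((u / 2 ^ m : ℝ) : ℂ) + ((v / 2 ^ m : ℝ) : ℂ) * Complex.I := by
    push_cast; ring
  refine (Complex.norm_le_abs_re_add_abs_im _).trans ?_
  have h1 := h.1
  have h2 := h.2
  rw [ApproxReal, abs_sub_comm] at h1 h2
  rw [e, Complex.sub_re, Complex.sub_im]
  simp only [Complex.add_re, Complex.add_im, Complex.ofReal_re, Complex.ofReal_im,
    Complex.re_ofReal_mul, Complex.im_ofReal_mul, Complex.I_re, Complex.I_im, mul_zero, add_zero,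
    mul_one, zero_add]
  linarith

/-- The verifier is correct on an instance if its data approximate the matrix, the polynomial and
the thresholds well enough. -/
theorem verify_correct {V : Data} {x : List Bool} {N : ℕ} (hN : V.n x = N)
    {A : Matrix (Fin (2 ^ N)) (Fin (2 ^ N)) ℂ} {p : Polynomial ℝ} {a b : ℝ} {P Q : ℕ}
    (hA : ‖Matrix.toEuclideanCLM (n := Fin (2 ^ N)) (𝕜 := ℂ) A‖ ≤ 1)
    (hdeg : p.natDegree ≤ V.d x) (hP : ∀ k, |p.coeff k| ≤ 2 ^ P) (hQ : 1 / 2 ^ Q ≤ b - a)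
    (hent : ∀ i j : Fin (2 ^ N), ∃ u v : ℤ, V.re x (i : ℕ).bits (j : ℕ).bits = intBits u ∧
      V.im x (i : ℕ).bits (j : ℕ).bits = intBits v ∧ ApproxComplex (V.m x) (A i j) u v)
    (hcoef : ∀ k ≤ V.d x, ∃ u : ℤ, V.coef x k.bits = intBits u ∧
      ApproxReal (V.m x) (p.coeff k) u)
    (hlo : ∃ u : ℤ, V.lo x = intBits u ∧ ApproxReal (V.m x) a u)
    (hhi : ∃ u : ℤ, V.hi x = intBits u ∧ ApproxReal (V.m x) b u)
    (hm : 2 * V.d x + 2 * N + (N + 1) * V.d x + P + Q + 4 ≤ V.m x) (hmR : V.m x < V.R x)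
    (re_le : ∀ i j : Fin (2 ^ N), (V.re x (i : ℕ).bits (j : ℕ).bits).length ≤ V.R x)
    (im_le : ∀ i j : Fin (2 ^ N), (V.im x (i : ℕ).bits (j : ℕ).bits).length ≤ V.R x)
    (coef_le : ∀ k ≤ V.d x, (V.coef x k.bits).length ≤ V.R x)
    (lo_le : (V.lo x).length ≤ V.R x) (hi_le : (V.hi x).length ≤ V.R x) {ℓ : ℕ}
    (hℓ : V.d x * (V.R x + N + 2) + V.R x + N + 3 ≤ ℓ) :
    (b ≤ tracePoly A p → 1 / 2 ≤ avg ℓ (fun w => if verify V x w then (1 : ℚ) else 0)) ∧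
    (tracePoly A p ≤ a → avg ℓ (fun w => if verify V x w then (1 : ℚ) else 0) < 1 / 2) := by
  subst hN
  choose u v hu hv huv using hent
  choose! c hc hc' using hcoef
  obtain ⟨lo, hlo, hlo'⟩ := hlo
  obtain ⟨hi, hhi, hhi'⟩ := hhi
  have ret : Returns V x u v c lo hi :=
    { re := hu, im := hv, coef := hc, lo := hlo, hi := hhi
      re_lt := fun i j => natAbs_lt_of_length (hu i j ▸ re_le i j)
      im_lt := fun i j => natAbs_lt_of_length (hv i j ▸ im_le i j)
      coef_lt := fun k hk => natAbs_lt_of_length (hc k hk ▸ coef_le k hk)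
      lo_lt := natAbs_lt_of_length (hlo ▸ lo_le)
      hi_lt := natAbs_lt_of_length (hhi ▸ hi_le)
      m_lt := hmR }
  -- The number `e` of surplus coins allows the length to be a polynomial in the size of the
  -- instance that only dominates the number of coins needed.
  obtain ⟨e, rfl⟩ : ∃ e, ℓ =
      V.d x * (V.R x + V.n x + 2) + (V.R x + e) + V.n x + 1 + 1 + 1 := ⟨_, by
    rw [show V.d x * (V.R x + V.n x + 2) + (V.R x + (ℓ - (V.d x * (V.R x + V.n x + 2) + V.R x +
      V.n x + 3))) + V.n x + 1 + 1 + 1 = V.d x * (V.R x + V.n x + 2) + V.R x + V.n x + 3 +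
      (ℓ - (V.d x * (V.R x + V.n x + 2) + V.R x + V.n x + 3)) by ring, Nat.add_sub_cancel' hℓ]⟩
  obtain ⟨κ, hκ, h1⟩ := avg_verify ret e
  have habs : ∀ {r : ℝ} {z : ℤ}, ApproxReal (V.m x) r z →
      |(z : ℝ) / 2 ^ V.m x - r| ≤ 1 / 2 ^ V.m x := fun h => by rw [abs_sub_comm]; exact h
  have hε : (1 : ℝ) / 2 ^ V.m x ≤ 1 / 2 := one_div_le_one_div_of_le two_pos
    (le_self_pow₀ one_le_two (by omega))
  have hsign := TraceError.sign_of_approx (A := A) (B := approx V x u v) (p := p)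
    (c' := fun k => c k / 2 ^ V.m x) (d := V.d x) (C := 2 ^ P) (ε := 1 / 2 ^ V.m x) (a := a)
    (b := b) (a' := lo / 2 ^ V.m x) (b' := hi / 2 ^ V.m x) (by positivity) hε
    (fun i j => (TraceError.norm_entry_le_toEuclideanCLM A i j).trans hA)
    (fun i j => norm_sub_le_of_approxComplex (huv i j)) hP (fun k hk => habs (hc' k hk)) hdeg
    (habs hlo') (habs hhi') ((TraceError.precision hm).trans_le hQ)
  -- The verifier works with the numerators of coefficients and thresholds. Restoring the
  -- denominators costs a common positive factor `2^m`, which does not affect the sign.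
  have h2 : (∑ t ∈ Finset.range (V.d x + 1), (c t : ℂ) * (approx V x u v ^ t).trace).re -
      ((lo : ℝ) + hi) / 2 = 2 ^ V.m x *
      ((∑ k ∈ Finset.range (V.d x + 1), ((c k / 2 ^ V.m x : ℝ) : ℂ) *
        (approx V x u v ^ k).trace).re - (lo / 2 ^ V.m x + hi / 2 ^ V.m x) / 2) := by
    have h3 : ∑ t ∈ Finset.range (V.d x + 1), (c t : ℂ) * (approx V x u v ^ t).trace =
        ((2 ^ V.m x : ℝ) : ℂ) * ∑ k ∈ Finset.range (V.d x + 1), ((c k / 2 ^ V.m x : ℝ) : ℂ) *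
        (approx V x u v ^ k).trace := by
      rw [Finset.mul_sum]
      refine Finset.sum_congr rfl fun k _ => ?_
      push_cast
      field_simp
    rw [h3, Complex.re_ofReal_mul]
    field_simp
  have hpos : 0 < κ * 2 ^ V.m x := by positivity
  rw [h2, ← mul_assoc] at h1
  constructor <;> intro h
  · have := mul_pos hpos (hsign.1 h)
    have h4 : ((1 / 2 : ℚ) : ℝ) ≤ (avg (V.d x * (V.R x + V.n x + 2) + (V.R x + e) + V.n x +
        1 + 1 + 1) (fun w => if verify V x w then (1 : ℚ) else 0) : ℚ) := by
      rw [h1, show ((1 / 2 : ℚ) : ℝ) = 1 / 2 by norm_num]; linarith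
    exact_mod_cast h4
  · have := mul_neg_of_pos_of_neg hpos (hsign.2 h)
    have h4 : ((avg (V.d x * (V.R x + V.n x + 2) + (V.R x + e) + V.n x +
        1 + 1 + 1) (fun w => if verify V x w then (1 : ℚ) else 0) : ℚ) : ℝ) < (1 / 2 : ℚ) := by
      rw [h1, show ((1 / 2 : ℚ) : ℝ) = 1 / 2 by norm_num]; linarith
    exact_mod_cast h4

/-- The trace problem has a verifier that uses polynomially many coins. -/
theorem exists_verifier {D : Set (List Bool)} {n d : List Bool → ℕ}
    {A : ∀ x : List Bool, Matrix (Fin (2 ^ n x)) (Fin (2 ^ n x)) ℂ}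
    {p : List Bool → Polynomial ℝ} {a b : List Bool → ℝ}
    (hn : PolyParam D n) (hA : QueryAccess D n A)
    (hNorm : ∀ x ∈ D, ‖Matrix.toEuclideanCLM (n := Fin (2 ^ n x)) (𝕜 := ℂ) (A x)‖ ≤ 1)
    (hd : PolyParam D d) (hdeg : ∀ x ∈ D, (p x).natDegree ≤ d x) (hp : CoeffAccess D d p)
    (hc : ∃ P : Polynomial ℕ, ∀ x ∈ D, ∀ k : ℕ, |(p x).coeff k| ≤ 2 ^ P.eval x.length)
    (ha : RealAccess D a) (hb : RealAccess D b)
    (hgap : ∃ P : Polynomial ℕ, ∀ x ∈ D, 1 / 2 ^ P.eval x.length ≤ b x - a x) :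
    ∃ (F : List Bool × List Bool → Bool) (L : Polynomial ℕ), PT F ∧ ∀ x ∈ D,
      (b x ≤ tracePoly (A x) (p x) →
        1 / 2 ≤ avg (L.eval x.length) (fun w => if F (x, w) then (1 : ℚ) else 0)) ∧
      (tracePoly (A x) (p x) ≤ a x →
        avg (L.eval x.length) (fun w => if F (x, w) then (1 : ℚ) else 0) < 1 / 2) := by
  obtain ⟨⟨Pn, hPn⟩, algn, hn, hn'⟩ := hn
  obtain ⟨⟨Pd, hPd⟩, algd, hd, hd'⟩ := hd
  obtain ⟨algA, hA, hA'⟩ := hA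
  obtain ⟨algc, hp, hp'⟩ := hp
  obtain ⟨alga, ha, ha'⟩ := ha
  obtain ⟨algb, hb, hb'⟩ := hb
  obtain ⟨P, hP⟩ := hc
  obtain ⟨Q, hQ⟩ := hgap
  -- The precision demanded by `TraceError.precision`, with `n` and `d` replaced by their polynomial
  -- bounds.
  let Pm : Polynomial ℕ := 2 * Pd + 2 * Pn + (Pn + 1) * Pd + P + Q + 4
  let m : List Bool → ℕ := fun y => Pm.eval y.length
  have hm : ∀ {α : Type} [Enc α] {x : α → List Bool}, PT x → PT fun q => unary (m (x q)) :=
    fun hx => PT.unary_eval (PT.unary_length hx) Pm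
  let out (f : List (List Bool) → List (List Bool)) (k : ℕ) (l : List (List Bool)) : List Bool :=
    (f l).getD k []
  have hent : ∀ k, PT fun q : List Bool × List Bool × List Bool =>
      out algA k [q.1, q.2.1, q.2.2, unary (m q.1)] := fun k =>
    PT.comp (PT.alg (α := List Bool × List Bool × List Bool × List Bool) hA k)
      (f := fun q : List Bool × List Bool × List Bool => (q.1, q.2.1, q.2.2, unary (m q.1)))
      (PT.pair (PT.fst PT.id) (PT.pair (PT.fst (PT.snd PT.id))
        (PT.pair (PT.snd (PT.snd PT.id)) (hm (PT.fst PT.id)))))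
  have hcoef : PT fun q : List Bool × List Bool => out algc 0 [q.1, q.2, unary (m q.1)] :=
    PT.comp (PT.alg (α := List Bool × List Bool × List Bool) hp 0)
      (f := fun q : List Bool × List Bool => (q.1, q.2, unary (m q.1)))
      (PT.pair (PT.fst PT.id) (PT.pair (PT.snd PT.id) (hm (PT.fst PT.id))))
  have hlo : PT fun y : List Bool => out alga 0 [y, unary (m y)] :=
    PT.comp (PT.alg (α := List Bool × List Bool) ha 0) (f := fun y : List Bool => (y, unary (m y)))
      (PT.pair PT.id (hm PT.id))
  have hhi : PT fun y : List Bool => out algb 0 [y, unary (m y)] :=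
    PT.comp (PT.alg (α := List Bool × List Bool) hb 0) (f := fun y : List Bool => (y, unary (m y)))
      (PT.pair PT.id (hm PT.id))
  obtain ⟨T0, hT0⟩ := (hent 0).size_le
  obtain ⟨T1, hT1⟩ := (hent 1).size_le
  obtain ⟨T2, hT2⟩ := hcoef.size_le
  obtain ⟨T3, hT3⟩ := hlo.size_le
  obtain ⟨T4, hT4⟩ := hhi.size_le
  -- One length of random numbers for all comparisons: it bounds the length of every algorithm's
  -- output on the largest arguments that occur, and exceeds `m`. The shifts 3, 2 and 1 count the
  -- separators of the arguments.
  let PR : Polynomial ℕ := (T0 + T1).comp (Polynomial.X + 2 * Pn + 3) +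
    T2.comp (Polynomial.X + Pd + 2) + (T3 + T4).comp (Polynomial.X + 1) + Pm + 1
  let V : Data :=
    -- Off `D` nothing is known about the outputs. Taking their lengths still gives parameters
    -- computable in unary for every string, so that the verifier runs in polynomial time on all
    -- inputs.
    { n := fun y => (out algn 0 [y]).length
      d := fun y => (out algd 0 [y]).length
      m := m
      R := fun y => PR.eval y.length
      re := fun y i j => out algA 0 [y, i, j, unary (m y)]
      im := fun y i j => out algA 1 [y, i, j, unary (m y)]
      coef := fun y k => out algc 0 [y, k, unary (m y)]
      lo := fun y => out alga 0 [y, unary (m y)]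
      hi := fun y => out algb 0 [y, unary (m y)] }
  have hV : V.Poly :=
    { n := PT.unary_length (PT.alg hn 0)
      d := PT.unary_length (PT.alg hd 0)
      m := hm PT.id
      R := PT.unary_eval (PT.unary_length PT.id) PR
      re := hent 0
      im := hent 1
      coef := hcoef
      lo := hlo
      hi := hhi }
  refine ⟨fun q => verify V q.1 q.2, Pd * (PR + Pn + 2) + PR + Pn + 3, pt_verify hV,
    fun x hx => ?_⟩
  have hVn : V.n x = n x := by
    simp only [V, out, hn' x hx, List.getD_cons_zero, PT.length_unary]
  have hVd : V.d x = d x := by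
    simp only [V, out, hd' x hx, List.getD_cons_zero, PT.length_unary]
  have hnx := hPn x hx
  have hdx := hPd x hx
  have hbits : ∀ i : Fin (2 ^ n x), (i : ℕ).bits.length ≤ Pn.eval x.length := fun i =>
    (length_bits_le i.2).trans hnx
  have hR : V.R x = T0.eval (x.length + 2 * Pn.eval x.length + 3) +
      T1.eval (x.length + 2 * Pn.eval x.length + 3) + T2.eval (x.length + Pd.eval x.length + 2) +
      (T3.eval (x.length + 1) + T4.eval (x.length + 1)) + V.m x + 1 := by
    simp [V, PR, m]
  have hij : ∀ i j : Fin (2 ^ n x), size (x, (i : ℕ).bits, (j : ℕ).bits) ≤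
      x.length + 2 * Pn.eval x.length + 3 := fun i j => by
    have h1 := hbits i
    have h2 := hbits j
    simp only [size_pair, size_list]
    omega
  have hk : ∀ k ≤ V.d x, size (x, k.bits) ≤ x.length + Pd.eval x.length + 2 := fun k hk => by
    -- The crude bound `k ≤ d` on the number of digits is good enough.
    have h1 : k.bits.length ≤ k := length_bits_le Nat.lt_two_pow_self
    simp only [size_pair, size_list]
    omega
  have hx1 : size x = x.length + 1 := size_list x
  refine verify_correct hVn (P := P.eval x.length) (Q := Q.eval x.length) (hNorm x hx)
    (hVd ▸ hdeg x hx) (hP x hx) (hQ x hx) (fun i j => ?_) (fun k hk => ?_) ?_ ?_ ?_ ?_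
    (fun i j => ?_) (fun i j => ?_) (fun k h => ?_) ?_ ?_ ?_
  · obtain ⟨u, v, h, h'⟩ := hA' x hx i j (m x)
    exact ⟨u, v, by simp [V, out, h], by simp [V, out, h], h'⟩
  · obtain ⟨u, h, h'⟩ := hp' x hx k (hVd ▸ hk) (m x)
    exact ⟨u, by simp [V, out, h], h'⟩
  · obtain ⟨u, h, h'⟩ := ha' x hx (m x)
    exact ⟨u, by simp [V, out, h], h'⟩
  · obtain ⟨u, h, h'⟩ := hb' x hx (m x)
    exact ⟨u, by simp [V, out, h], h'⟩
  · rw [hVd]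
    simp only [V, m, Pm, Polynomial.eval_add, Polynomial.eval_mul, Polynomial.eval_ofNat,
      Polynomial.eval_one]
    gcongr
  · omega
  · have h1 := (hT0 (x, (i : ℕ).bits, (j : ℕ).bits)).trans (StackProg.monotone_eval T0 (hij i j))
    rw [size_list] at h1
    dsimp only at h1
    exact Nat.le_of_succ_le (h1.trans (by omega))
  · have h1 := (hT1 (x, (i : ℕ).bits, (j : ℕ).bits)).trans (StackProg.monotone_eval T1 (hij i j))
    rw [size_list] at h1
    dsimp only at h1
    exact Nat.le_of_succ_le (h1.trans (by omega))
  · have h1 := (hT2 (x, k.bits)).trans (StackProg.monotone_eval T2 (hk k h))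
    rw [size_list] at h1
    dsimp only at h1
    exact Nat.le_of_succ_le (h1.trans (by omega))
  · have h1 := hT3 x
    rw [size_list, hx1] at h1
    exact Nat.le_of_succ_le (h1.trans (by omega))
  · have h1 := hT4 x
    rw [size_list, hx1] at h1
    exact Nat.le_of_succ_le (h1.trans (by omega))
  · rw [hVd]
    simp only [V, Polynomial.eval_add, Polynomial.eval_mul, Polynomial.eval_ofNat]
    gcongr

end WalkVerifier

/-! ## Probabilistic machines from verifiers -/

namespace TwoWay

open Turing

variable {K : Type} [DecidableEq K] {Γ : K → Type} {Λ σ : Type}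

/-- From the given configuration, the machine halts within the given time whatever the coins, and
accepts with the given probability. -/
inductive Outcome (M : Bool → Λ → TM2.Stmt Γ Λ σ) (acc : σ → Bool) :
    ℕ → TM2.Cfg Γ Λ σ → ℚ → Prop
  | halt {t v S} : Outcome M acc t ⟨none, v, S⟩ (if acc v = true then 1 else 0)
  | step {t l v S q q'} : Outcome M acc t (TM2.stepAux (M false l) v S) q →
      Outcome M acc t (TM2.stepAux (M true l) v S) q' →
      Outcome M acc (t + 1) ⟨some l, v, S⟩ ((q + q') / 2)

variable {M : Bool → Λ → TM2.Stmt Γ Λ σ} {acc : σ → Bool}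

theorem Outcome.mono {t t' : ℕ} {c : TM2.Cfg Γ Λ σ} {q : ℚ} (h : Outcome M acc t c q)
    (ht : t ≤ t') : Outcome M acc t' c q := by
  induction h generalizing t' with
  | halt => exact .halt
  | step _ _ ih ih' =>
    obtain ⟨t', rfl⟩ : ∃ s, t' = s + 1 := ⟨t' - 1, by omega⟩
    exact .step (ih (by omega)) (ih' (by omega))

/-- While the coins do not matter, both branches have the same probability `q`, and `(q + q) / 2 =
q`. -/
theorem Runs.outcome {n t : ℕ} {c c' : TM2.Cfg Γ Λ σ} {q : ℚ} (h : Runs M n c c')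
    (h' : Outcome M acc t c' q) : Outcome M acc (t + n) c q := by
  induction n generalizing c with
  | zero => cases h; exact h'
  | succ n ih =>
    obtain ⟨c₁, h₁, h₂⟩ := h
    obtain ⟨l, v, S⟩ := c
    cases l with
    | none => simpa using h₁ true
    | some l =>
      have h₃ : ∀ b, TM2.stepAux (M b l) v S = c₁ := fun b => Option.some.inj (h₁ b)
      have := Outcome.step (M := M) (l := l) (v := v) (S := S) ((h₃ false).symm ▸ ih h₂)
        ((h₃ true).symm ▸ ih h₂)
      rwa [add_self_div_two] at this

theorem _root_.ProbTM.of_outcome (P : ProbTM) {t : ℕ} {c : P.tm.Cfg} {q : ℚ}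
    (h : Outcome (fun b => cond b P.alt P.tm.m) P.acc t c q) :
    P.HaltsWithin t c ∧ P.acceptProb t c = q := by
  induction h with
  | @halt t v S => cases t <;> simp [ProbTM.HaltsWithin, ProbTM.acceptProb]
  | step _ _ ih ih' => exact ⟨⟨ih.1, ih'.1⟩, by rw [← ih.2, ← ih'.2]; rfl⟩

end TwoWay

namespace Coins

theorem avg_append {𝕜 : Type*} [Field 𝕜] (ℓ : ℕ) (f : List Bool → 𝕜) :
    avg (ℓ + 1) f = (avg ℓ (fun w => f (w ++ [false])) + avg ℓ (fun w => f (w ++ [true]))) / 2 := by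
  induction ℓ generalizing f with
  | zero => rfl
  | succ ℓ ih =>
    rw [avg, ih, ih, avg, avg]
    simp only [List.cons_append]
    ring

/-- Coins pushed on a stack are read in the opposite order, which does not change averages. -/
theorem avg_reverse {𝕜 : Type*} [Field 𝕜] (ℓ : ℕ) (f : List Bool → 𝕜) :
    avg ℓ (fun w => f w.reverse) = avg ℓ f := by
  induction ℓ generalizing f with
  | zero => rfl
  | succ ℓ ih =>
    rw [avg_append, avg]
    simp only [List.reverse_append, List.reverse_singleton, List.singleton_append]
    rw [ih (fun w => f (false :: w)), ih (fun w => f (true :: w))]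

end Coins

/-! ### A machine that tosses coins and runs a verifier -/

namespace StackProg

open Turing Function TwoWay Coins Enc

section Coins

variable {ι : Type} [DecidableEq ι] {sub : ι → Sub} {Λ : Type}

/-- For each symbol of the first stack before the separator, push a coin on the second one. -/
def flips : Prog ι (Fin 3) := .loop 0 Option.isSome fun _ => .flip 1

/-- Each symbol of the clock costs two steps, a pop on which both transition functions agree and a
push where they differ. The branching at the push is the recursion that defines `avg`; the last step
consumes the separator. -/
theorem outcome_flips {M : Bool → Λ → TM2.Stmt (HG (Fin 3) sub) Λ (HS sub)} {acc : HS sub → Bool}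
    {e : Lab sub (flips : Prog ι (Fin 3)) → Λ} {x : Λ}
    (hM : ∀ b l, M b (e l) = compile sub b flips e x l) {inp : List Bool}
    {c : List (Option Bool)} {T : ℕ} (L : ℕ) {l : List (Option Bool)} {q : List Bool → ℚ}
    (h : ∀ u : List Bool, u.length = L → ∀ r,
      Outcome M acc T (hcfg sub x r ![[], u.reverse.map some ++ l, c] inp) (q u))
    (r : Option (Option Bool)) :
    Outcome M acc (T + 2 * L + 1)
      (hcfg sub (e (entry sub flips)) r ![(unary L).map some ++ [none], l, c] inp) (avg L q) := by
  have h₁ : ∀ b, M b (e (entry sub flips)) = .pop (Sum.inl (.inl 0)) (fun v a => (a, v.2))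
      (.goto fun v => v.1.elim x fun a => if a.isSome then e (some ⟨a, ()⟩) else x) :=
    fun b => hM b _
  have h₂ : ∀ b a, M b (e (some ⟨a, ()⟩)) = .push (Sum.inl (.inl 1)) (fun _ => some b)
      (.goto fun _ => e (entry sub flips)) := fun b a => hM b _
  have h₃ : ∀ a b l : List (Option Bool), update ![a, l, c] (0 : Fin 3) b = ![b, l, c] := by
    intro a b l; funext j; fin_cases j <;> simp
  have h₄ : ∀ a b l : List (Option Bool), update ![a, b, c] (1 : Fin 3) l = ![a, l, c] := by
    intro a b l; funext j; fin_cases j <;> simp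
  induction L generalizing l q r with
  | zero =>
    refine Runs.outcome (Runs.one fun b => ?_) (h [] rfl (some none))
    rw [h₁]
    simp only [TM2.stepAux, update_hstk_own, h₃]
    rfl
  | succ L ih =>
    have h₅ : ∀ b : Bool, Outcome M acc (T + 2 * L + 1) (hcfg sub (e (entry sub flips))
        (some (some true)) ![(unary L).map some ++ [none], some b :: l, c] inp)
        (avg L fun u => q (b :: u)) := fun b =>
      ih (fun u hu r => by simpa using h (b :: u) (by simp [hu]) r) _
    refine Outcome.mono (Runs.outcome (n := 1) (c' := hcfg sub (e (some ⟨some true, ()⟩))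
      (some (some true)) ![(unary L).map some ++ [none], l, c] inp)
      (Runs.one fun b => ?_) (Outcome.step (t := T + 2 * L + 1) ?_ ?_)) (by omega)
    · rw [h₁]
      simp only [TM2.stepAux, update_hstk_own, h₃]
      rfl
    · rw [h₂]
      simp only [TM2.stepAux, update_hstk_own, h₄]
      exact h₅ false
    · rw [h₂]
      simp only [TM2.stepAux, update_hstk_own, h₄]
      exact h₅ true

end Coins

/-- The clock and the verifier as subroutines. -/
def clockAndVerifier (s s' : Sub) : Bool → Sub
  | false => s
  | true => s'

/-- The program that prepares the tossing of coins. -/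
def prepare : Prog Bool (Fin 3) :=
  .seq (.push 0 none) (.seq (.push 1 none) (.seq (transfer 2 false [0, 1])
    (.seq (.call false 0) (.push 1 none))))

/-- The program that tosses coins and runs the verifier. -/
def tossAndVerify : Prog Bool (Fin 3) := .seq prepare (.seq flips (.call true 1))

/-- The transition functions of a machine that runs the program and accepts if it outputs `1`. -/
def tossStmt (sub : Bool → Sub) (b : Bool) : Bool ⊕ Lab sub tossAndVerify →
    TM2.Stmt (HG (Fin 3) sub) (Bool ⊕ Lab sub tossAndVerify) (HS sub)
  | .inl false => moveStmt (.inl (.inr false)) (.inl (.inl 2)) some (fun a => a) (.inl false)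
      (.inr (entry sub tossAndVerify))
  | .inl true => .pop (Sum.inl (.inl 1)) (fun v a => (a, v.2)) .halt
  | .inr l => compile sub b tossAndVerify Sum.inr (.inl true) l

/-- The probabilistic machine that tosses coins and runs the verifier. -/
noncomputable def tossTM (sub : Bool → Sub) : ProbTM :=
  letI := fun i => (sub i).tm.kFin
  letI := fun i => (sub i).tm.σFin
  haveI := finite_lab sub tossAndVerify
  letI := Fintype.ofFinite (Lab sub tossAndVerify)
  { tm :=
      { K := HK (Fin 3) sub
        k₀ := .inl (.inr false)
        k₁ := .inl (.inr false)
        Γ := HG (Fin 3) sub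
        Λ := Bool ⊕ Lab sub tossAndVerify
        main := .inl false
        σ := HS sub
        initialState := (none, fun i => (sub i).tm.initialState)
        Γk₀Fin := inferInstanceAs (Fintype Bool)
        m := tossStmt sub false }
    alt := tossStmt sub true
    inputAlphabet := Equiv.refl Bool
    acc := fun v => decide (v.1 = some (some true)) }

/-- The input arrives reversed, from its move off the input stack, and the transfer to two stacks
turns it round again. One copy becomes the clock; the other gets a separator on top, above which the
coins will form a field of their own. -/
theorem evalLe_prepare {s s' : Sub} {x : List Bool} {L T : ℕ}
    (h : ∃ n ≤ T, SubRuns s (word x) (word (unary L)) n) :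
    EvalLe (clockAndVerifier s s') prepare ![[], [], x.reverse.map some]
      ![(unary L).map some ++ [none], none :: word x, []] (T + 6 * x.length + 2 * L + 12) := by
  have h1 : EvalLe (clockAndVerifier s s') (.push 0 none) ![[], [], x.reverse.map some]
      ![[none], [], x.reverse.map some] 1 :=
    (evalLe_push 0 none).of_eq (by funext j; fin_cases j <;> simp) le_rfl
  have h2 : EvalLe (clockAndVerifier s s') (.push 1 none) ![[none], [], x.reverse.map some]
      ![[none], [none], x.reverse.map some] 1 :=
    (evalLe_push 1 none).of_eq (by funext j; fin_cases j <;> simp) le_rfl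
  have h3 : EvalLe (clockAndVerifier s s') (transfer 2 false [0, 1])
      ![[none], [none], x.reverse.map some] ![word x, word x, []] (4 * x.length + 1) :=
    (evalLe_transfer_all (S := ![[none], [none], x.reverse.map some]) (k := 2) (ks := [0, 1])
      (l := x.reverse.map some) (by decide) rfl).of_eq
      (by funext j; fin_cases j <;> simp [word_list]) (by simp)
  have h4 : EvalLe (clockAndVerifier s s') (.call false 0) ![word x, word x, []]
      ![word (unary L), word x, []] _ := evalLe_call0 h
  have h5 : EvalLe (clockAndVerifier s s') (.push 1 none) ![word (unary L), word x, []]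
      ![(unary L).map some ++ [none], none :: word x, []] 1 :=
    (evalLe_push 1 none).of_eq (by funext j; fin_cases j <;> simp [word_list]) le_rfl
  refine (h1.seq (h2.seq (h3.seq (h4.seq h5)))).mono ?_
  simp only [word_list, List.length_append, List.length_map, PT.length_unary, List.length_cons,
    List.length_nil]
  omega

/-- The machine follows the verifier on random coins. -/
theorem outcome_tossTM {s s' : Sub} {F : List Bool × List Bool → Bool} {x : List Bool}
    {L T T' : ℕ} (h : ∃ n ≤ T, SubRuns s (word x) (word (unary L)) n)
    (h' : ∀ w : List Bool, w.length = L → ∃ n ≤ T', SubRuns s' (word (w, x)) (word (F (x, w))) n) :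
    (tossTM (clockAndVerifier s s')).HaltsWithin (T + T' + 9 * x.length + 6 * L + 30)
      ((tossTM (clockAndVerifier s s')).init x) ∧
    (tossTM (clockAndVerifier s s')).acceptProb (T + T' + 9 * x.length + 6 * L + 30)
      ((tossTM (clockAndVerifier s s')).init x) =
      avg L (fun w => if F (x, w) then (1 : ℚ) else 0) := by
  set sub := clockAndVerifier s s' with hsub
  have hz : hstk (K₀ := Fin 3) sub (fun _ => []) [] [] (fun _ _ => []) = fun _ => [] := by
    funext k
    rcases k with (k | b) | ⟨i, k⟩
    · rfl
    · cases b <;> rfl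
    · rfl
  have hinit : (tossTM sub).init x = hcfg sub (.inl false) none (fun _ => []) x := by
    have := initList_stk (tossTM sub).tm (x.map (tossTM sub).inputAlphabet.symm)
    unfold hcfg
    rw [← update_hstk_inp (inp := []), hz]
    change (⟨_, _, (initList (tossTM sub).tm (x.map (tossTM sub).inputAlphabet.symm)).stk⟩ :
      TM2.Cfg _ _ _) = _
    rw [this]
    congr 1
    exact congrArg _ (List.map_id x)
  let acc : HS sub → Bool := fun v => decide (v.1 = some (some true))
  -- The pop brings the verdict of the verifier into the register, which is all that acceptance
  -- looks at.
  have hend : ∀ (w : List Bool) r, Outcome (tossStmt sub) acc 1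
      (hcfg sub (.inl true) r ![[], word (F (x, w)), []] [])
      (if F (x, w) then (1 : ℚ) else 0) := fun w r => by
    refine Runs.outcome (n := 1) (t := 0)
      (c' := ⟨none, (some (some (F (x, w))), fun i => (sub i).tm.initialState),
        hstk sub ![[], [none], []] [] [] (fun _ _ => [])⟩) (Runs.one fun b => ?_) ?_
    · have h1 : tossStmt sub b (.inl true) =
          .pop (Sum.inl (.inl 1)) (fun v a => (a, v.2)) .halt := rfl
      rw [h1, word_bool]
      simp only [TM2.stepAux, update_hstk_own]
      congr 2
      funext j
      fin_cases j <;> simp [hstk]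
    · have := Outcome.halt (M := tossStmt sub) (acc := acc) (t := 0)
        (v := (some (some (F (x, w))), fun i => (sub i).tm.initialState))
        (S := hstk sub ![[], [none], []] [] [] (fun _ _ => []))
      simpa [acc] using this
  have hcall : ∀ (w : List Bool), w.length = L → ∀ r, Outcome (tossStmt sub) acc
      (1 + (T' + 2 * (L + x.length + 2) + 8)) (hcfg sub (.inr (.inr (.inr (entry sub (.call true 1))))) r
        ![[], word (w, x), []] []) (if F (x, w) then (1 : ℚ) else 0) := fun w hw r => by
    obtain ⟨t, ht, he⟩ := evalLe_call1 (sub := sub) (i := true) (a := []) (c := []) (h' w hw)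
    obtain ⟨r', hr⟩ := runs_of_eval he (M := tossStmt sub)
      (e := fun l => .inr (.inr (.inr l))) (x := .inl true) (fun b l => rfl) r []
    refine (hr.outcome (hend w r')).mono ?_
    have h1 := size_pair w x
    have h2 := size_bool (F (x, w))
    simp only [size] at h1 h2 ht
    simp only [word_list, List.length_append, List.length_map, List.length_cons,
      List.length_nil] at h1
    omega
  have hflip : ∀ r, Outcome (tossStmt sub) acc _ (hcfg sub (.inr (.inr (.inl (entry sub flips)))) r
      ![(unary L).map some ++ [none], none :: word x, []] [])
      (avg L fun u => if F (x, u.reverse) then (1 : ℚ) else 0) :=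
    outcome_flips (M := tossStmt sub) (e := fun l => .inr (.inr (.inl l)))
      (x := .inr (.inr (.inr (entry sub (.call true 1))))) (fun b l => rfl) L fun u hu r => by
        have := hcall u.reverse (by simpa using hu) r
        rwa [word_pair, word_list, List.append_assoc, List.singleton_append] at this
  -- The last coin tossed is on top of the stack, so the verifier sees the coins reversed.
  rw [avg_reverse L (fun w => if F (x, w) then (1 : ℚ) else 0)] at hflip
  obtain ⟨t, ht, he⟩ := evalLe_prepare (s := s) (s' := s') h
  obtain ⟨r, hr⟩ := runs_of_eval he (M := tossStmt sub) (e := fun l => .inr (.inl l))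
    (x := .inr (.inr (.inl (entry sub flips)))) (fun b l => rfl) none []
  have hmove := runs_moveStmt (M := tossStmt sub) (sub := sub) (k := .inl (.inr false))
    (k' := .inl (.inl 2)) (by simp) (u := some) (v := fun a => a) (self := .inl false)
    (x := .inr (entry sub tossAndVerify)) (fun b => rfl) none
    (fun i => (sub i).tm.initialState) (hstk sub (fun _ => []) [] x (fun _ _ => []))
  rw [update_hstk_inp, update_hstk_own] at hmove
  have e1 : update (fun _ => []) (2 : Fin 3) (x.reverse.map some ++ []) =
      ![[], [], x.reverse.map some] := by
    funext j; fin_cases j <;> simp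
  have hmove' : Runs (tossStmt sub) (x.length + 1) (hcfg sub (.inl false) none (fun _ => []) x)
      (hcfg sub (.inr (entry sub tossAndVerify)) none ![[], [], x.reverse.map some] []) := by
    unfold hcfg
    rw [← e1]
    exact hmove
  have hfinal := ((hmove'.trans hr).outcome (hflip r)).mono
    (t' := T + T' + 9 * x.length + 6 * L + 30) (by omega)
  have hM : tossStmt sub = fun b => cond b (tossStmt sub true) (tossStmt sub false) := by
    funext b; cases b <;> rfl
  rw [hM] at hfinal
  refine (tossTM sub).of_outcome ?_
  rw [hinit]
  exact hfinal

/-- A promise problem is in `PP` if a polynomial time verifier accepts yes-instances with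
probability at least `1/2`, and no-instances with a smaller one, on polynomially many coins. -/
theorem inPP_of_verifier {P : PromiseProblem} {F : List Bool × List Bool → Bool} (hF : PT F)
    (L : Polynomial ℕ)
    (yes : ∀ x ∈ P.yes, 1 / 2 ≤ avg (L.eval x.length) (fun w => if F (x, w) then (1 : ℚ) else 0))
    (no : ∀ x ∈ P.no, avg (L.eval x.length) (fun w => if F (x, w) then (1 : ℚ) else 0) < 1 / 2) :
    InPP P := by
  have h1 : PT fun x : List Bool => unary (L.eval x.length) :=
    PT.unary_eval (PT.unary_length PT.id) L
  -- The coins lie above the input on the stack, so the subroutine receives them as the first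
  -- component.
  have h2 : PT fun q : List Bool × List Bool => F (q.2, q.1) :=
    PT.comp (f := fun q : List Bool × List Bool => (q.2, q.1)) hF
      (PT.pair (PT.snd PT.id) (PT.fst PT.id))
  obtain ⟨s, T, h⟩ := h1.exists_sub
  obtain ⟨s', T', h'⟩ := h2.exists_sub
  have key := fun x : List Bool => outcome_tossTM (F := F) (x := x) (h x).1
    (T' := T'.eval (L.eval x.length + x.length + 2)) (fun w hw => by
      obtain ⟨n, hn, hr⟩ := (h' (w, x)).1
      refine ⟨n, hn.trans (le_of_eq ?_), hr⟩
      congr 1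
      simp [word_pair, word_list, hw]
      ring)
  have e : ∀ x : List Bool, (T.comp (Polynomial.X + 1) + T'.comp (L + Polynomial.X + 2) +
      9 * Polynomial.X + 6 * L + 30).eval x.length = T.eval (word x).length +
      T'.eval (L.eval x.length + x.length + 2) + 9 * x.length + 6 * L.eval x.length + 30 := by
    intro x
    simp [word_list]
  refine ⟨tossTM (clockAndVerifier s s'), T.comp (Polynomial.X + 1) +
    T'.comp (L + Polynomial.X + 2) + 9 * Polynomial.X + 6 * L + 30, fun x => ?_, fun x hx => ?_,
    fun x hx => ?_⟩
  · rw [e]; exact (key x).1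
  · rw [e, (key x).2]; exact yes x hx
  · rw [e, (key x).2]; exact no x hx

end StackProg

theorem theorem5p4
    (D : Set (List Bool)) (n s d : List Bool → ℕ)
    (A : ∀ x : List Bool, Matrix (Fin (2 ^ n x)) (Fin (2 ^ n x)) ℂ)
    (p : List Bool → Polynomial ℝ) (a b : List Bool → ℝ)
    (hn : PolyParam D n)
    (hA : SparseAccess D n s A)
    (hHerm : ∀ x ∈ D, (A x).IsHermitian)
    (hNorm : ∀ x ∈ D, ‖Matrix.toEuclideanCLM (n := Fin (2 ^ n x)) (𝕜 := ℂ) (A x)‖ ≤ 1)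
    (hd : PolyParam D d)
    (hdeg : ∀ x ∈ D, (p x).natDegree ≤ d x)
    (hp : CoeffAccess D d p)
    (hc : ∃ P : Polynomial ℕ, ∀ x ∈ D, ∀ k : ℕ, |(p x).coeff k| ≤ 2 ^ P.eval x.length)
    (ha : RealAccess D a) (hb : RealAccess D b)
    (hgap : ∃ P : Polynomial ℕ, ∀ x ∈ D, 1 / 2 ^ P.eval x.length ≤ b x - a x) :
    InPP (traceProblem D n A p a b) := by
  obtain ⟨F, L, hF, h⟩ :=
    WalkVerifier.exists_verifier hn hA.1 hNorm hd hdeg hp hc ha hb hgap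
  exact StackProg.inPP_of_verifier hF L (fun x hx => (h x hx.1).1 hx.2)
    (fun x hx => (h x hx.1).2 hx.2)
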